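/- **Conventions.** $q$ is an odd prime, $n\ge 1$ is a power of $2$, $R_q=\mathbb Z_q[X]/(X^n+1)$, and $m,l,\gamma,\eta$ are positive integers. For $r=\sum_{i<n}a_iX^i\in R_q$, $\|r\|_\infty$ is the largest absolute value of the representatives of the $a_i$ in $[-\frac{q-1}2,\frac{q-1}2]$; for vectors, $\|\cdot\|_\infty$ is the maximum over the entries; $S_\eta=\{r\in R_q:\|r\|_\infty\le\eta\}$. A quantum algorithm is a circuit of gates $T$, $H$, $\mathrm{CNOT}$ on finitely many qubits, applied to the binary encoding of the input (each coefficient in $\mathbb Z_q$ on $\lceil\log_2 q\rceil$ qubits) followed by qubits in the state $|0\rangle$; $\mathrm{Time}$ is its number of gates (for a two-stage algorithm, of both stages together). **MLWE.** The advantage of $\mathcal B$ for $\mathsf{MLWE}_{l,m,\eta}$ is $\bigl|\Pr[\mathcal B(A,t)=0]-\Pr[\mathcal B(A,As_1+s_2)=0]\bigr|$, where $A\leftarrow R_q^{l\times m}$, $t\leftarrow R_q^l$, $s_1\leftarrow S_\eta^m$, $s_2\leftarrow S_\eta^l$ are uniform and independent. **Collapse.** In $\mathsf{Collapse}_{m,l,\gamma}$,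 a two-stage quantum algorithm $\mathcal A=(\mathcal A_1,\mathcal A_2)$ is given a uniformly random $A\leftarrow R_q^{m\times l}$; $\mathcal A_1(A)$ outputs registers $(Y,Z,T)$, with $Y$ on $R_q^l$, $Z$ on $R_q^m$, $T$ arbitrary. The value $z$ in $Z$ is classical, i.e. $Z$ is measured in the computational basis. A uniform bit $b$ is sampled and $Y$ is measured in the computational basis if $b=1$; $\mathcal A_2(Y,Z,T)$ outputs a bit $b'$. The advantage is $2\Pr[b'=b]-1$. $\mathcal A$ is *valid* if for every $A$ the state of $(Y,Z)$ output by $\mathcal A_1$ is supported on $(y,z)$ with $Ay=z$ and $\|y\|_\infty\le\gamma$. **Proposition 3.5.** (i) There is a polynomial $P$ with natural-number coefficients, independent of all parameters, such that the following holds. Suppose $q\ge16$ and $2\gamma\eta nl<\lfloor q/32\rfloor$, and let $\mathcal A$ be a valid quantum algorithm with advantage $\epsilon$ in $\mathsf{Collapse}_{m,l,\gamma}$. Then for every integer $w\ge 0$ there is a quantum algorithm $\mathcal B$ whose advantage for $\mathsf{MLWE}_{l,m,\eta}$ is at least $(\epsilon-3^{-w})/4$ and which satisfies $$\mathrm{Time}(\mathcal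 B)\le\mathrm{Time}(\mathcal A)+P(w,n,\lceil\log_2 q\rceil,m,l).$$ (ii) Consequently, let $q,n,m,l,\gamma,\eta$ be functions of $\lambda\in\mathbb N$ that satisfy the assumptions in (i) for every $\lambda$ (in particular this covers $q\equiv1\bmod 2n$), with $n,\log q,m,l$ bounded by polynomials in $\lambda$. If every family of quantum algorithms with $\mathrm{poly}(\lambda)$ gates has advantage at most $\mathrm{negl}(\lambda)$ for $\mathsf{MLWE}_{l,m,\eta}$, then the $\mathsf{MSIS}$ hash function is collapsing: every family of valid quantum algorithms with $\mathrm{poly}(\lambda)$ gates has advantage at most $\mathrm{negl}(\lambda)$ in $\mathsf{Collapse}_{m,l,\gamma}$. Here $f\le\mathrm{negl}(\lambda)$ means that for every $c$, $f(\lambda)\le\lambda^{-c}$ for all large $\lambda$. -/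

import Mathlib

open scoped BigOperators

namespace MSISHash

noncomputable section

/-! ### The ring `R_q = ℤ_q[X] / (X ^ n + 1)` -/

/-- The ring `R_q = ℤ_q[X] / (X ^ n + 1)`. -/
abbrev Rq (q n : ℕ) : Type := AdjoinRoot (Polynomial.X ^ n + 1 : Polynomial (ZMod q))

theorem monic_modulus (q n : ℕ) [NeZero n] :
    (Polynomial.X ^ n + 1 : Polynomial (ZMod q)).Monic := by
  simpa using Polynomial.monic_X_pow_add_C (R := ZMod q) 1 (NeZero.ne n)

instance Rq.instFinite (q n : ℕ) [NeZero q] [NeZero n] : Finite (Rq q n) := by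
  have : Module.Finite (ZMod q) (Rq q n) := (monic_modulus q n).finite_adjoinRoot
  exact Module.finite_of_finite (ZMod q)

instance Rq.instFintype (q n : ℕ) [NeZero q] [NeZero n] : Fintype (Rq q n) :=
  Fintype.ofFinite _

instance Rq.instDecidableEq (q n : ℕ) : DecidableEq (Rq q n) := Classical.decEq _

/-- The coefficient `a_i` in `r = a_0 + a_1 X + ⋯ + a_{n-1} X ^ (n-1)`. -/
def Rq.coeff {q n : ℕ} [NeZero n] (r : Rq q n) (i : Fin n) : ZMod q :=
  (AdjoinRoot.modByMonicHom (monic_modulus q n) r).coeff i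

/-- `‖r‖_∞`: the largest absolute value of the representatives of the coefficients in
`[-(q-1)/2, (q-1)/2]`. -/
def Rq.norm {q n : ℕ} [NeZero n] (r : Rq q n) : ℕ :=
  Finset.univ.sup fun i : Fin n => (r.coeff i).valMinAbs.natAbs

/-- `‖v‖_∞ = max_i ‖v_i‖_∞` for a vector over `R_q`. -/
def vecNorm {q n k : ℕ} [NeZero n] (v : Fin k → Rq q n) : ℕ :=
  Finset.univ.sup fun i => (v i).norm

/-- `S_η = {r ∈ R_q | ‖r‖_∞ ≤ η}`. -/
def shortSet (q n : ℕ) [NeZero q] [NeZero n] (η : ℕ) : Finset (Rq q n) :=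
  Finset.univ.filter fun r => r.norm ≤ η

/-- `S_η ^ k`. -/
def shortVecs (q n : ℕ) [NeZero q] [NeZero n] (k η : ℕ) : Finset (Fin k → Rq q n) :=
  Fintype.piFinset fun _ => shortSet q n η

/-! ### Quantum circuits over the gate set `T`, `H`, `CNOT`

A register of qubits is indexed by a finite type `ι`; its computational basis is `ι → Bool`. -/

/-- The matrix `diag(1, e^{iπ/4})`. -/
def tMatrix : Matrix Bool Bool ℂ :=
  Matrix.diagonal fun b => if b then Complex.exp (Complex.I * Real.pi / 4) else 1

/-- The matrix `(1/√2) [[1, 1], [1, -1]]`. -/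
def hMatrix : Matrix Bool Bool ℂ :=
  Matrix.of fun a b => (if a && b then -1 else 1) / (Real.sqrt 2 : ℂ)

/-- The matrix of `|c, t⟩ ↦ |c, t ⊕ c⟩`. -/
def cnotMatrix : Matrix (Bool × Bool) (Bool × Bool) ℂ :=
  Matrix.of fun x y => if x = (y.1, xor y.2 y.1) then 1 else 0

/-- An elementary gate, together with the qubit(s) on which it acts; `cnot i j` has control `i` and
target `j`. -/
inductive Gate (ι : Type) : Type
  | t (i : ι) : Gate ι
  | h (i : ι) : Gate ι
  | cnot (i j : ι) (hne : i ≠ j) : Gate ι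

section
variable {ι : Type} [Fintype ι] [DecidableEq ι]

/-- The unitary of an elementary gate on the whole register: the small matrix tensored with
identity matrices on the remaining qubits. -/
def Gate.matrix : Gate ι → Matrix (ι → Bool) (ι → Bool) ℂ
  | .t i => Matrix.of fun x y => if ∀ k, k ≠ i → x k = y k then tMatrix (x i) (y i) else 0
  | .h i => Matrix.of fun x y => if ∀ k, k ≠ i → x k = y k then hMatrix (x i) (y i) else 0
  | .cnot i j _ => Matrix.of fun x y =>
      if ∀ k, k ≠ i → k ≠ j → x k = y k then cnotMatrix (x i, x j) (y i, y j) else 0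

/-- The unitary of a sequence of gates; the head of the list is applied first. -/
def circuitUnitary : List (Gate ι) → Matrix (ι → Bool) (ι → Bool) ℂ
  | [] => 1
  | g :: C => circuitUnitary C * g.matrix

/-- Density matrices (and, more generally, operators) on the register. -/
abbrev Op (ι : Type) : Type := Matrix (ι → Bool) (ι → Bool) ℂ

/-- The pure state `|x⟩⟨x|`. -/
def basisState (x : ι → Bool) : Op ι := Matrix.single x x 1

/-- Running a circuit on a state: `ρ ↦ U ρ U†`. -/
def evolve (C : List (Gate ι)) (ρ : Op ι) : Op ι :=
  circuitUnitary C * ρ * (circuitUnitary C).conjTranspose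

/-- The projection onto the basis states whose restriction to the sub-register `reg` is `s`. -/
def regProj {κ : Type} [Fintype κ] (reg : κ ↪ ι) (s : κ → Bool) : Op ι :=
  Matrix.diagonal fun x => if (fun k => x (reg k)) = s then 1 else 0

/-- Measuring the sub-register `reg` in the computational basis: `ρ ↦ ∑ s, P_s ρ P_s`. -/
def measure {κ : Type} [Fintype κ] [DecidableEq κ] (reg : κ ↪ ι) (ρ : Op ι) : Op ι :=
  ∑ s : κ → Bool, regProj reg s * ρ * regProj reg s

/-- The probability that a measurement of the register in the computational basis yields the
value `v` on qubit `i`. -/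
def probBit (i : ι) (v : Bool) (ρ : Op ι) : ℝ :=
  ∑ x : ι → Bool, if x i = v then (ρ x x).re else 0

end

/-- The basis state in which the input `x` is followed by `a` qubits in the state `|0⟩`. -/
def startState {κ : Type} [Fintype κ] [DecidableEq κ] (a : ℕ) (x : κ → Bool) : Op (κ ⊕ Fin a) :=
  basisState (Sum.elim x fun _ => false)

/-! ### Encoding of vectors and matrices over `R_q`

Each coefficient in `ℤ_q` is written in binary, on the least number of qubits that suffices. -/

/-- The qubits of a register on `R_q ^ k`. -/
abbrev VecQubits (q n k : ℕ) : Type := Fin k × Fin n × Fin (Nat.clog 2 q)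

/-- The qubits of a register on `R_q ^ (m × l)`. -/
abbrev MatQubits (q n m l : ℕ) : Type := Fin m × Fin l × Fin n × Fin (Nat.clog 2 q)

def encVec {q n k : ℕ} [NeZero n] (v : Fin k → Rq q n) : VecQubits q n k → Bool :=
  fun p => ((v p.1).coeff p.2.1).val.testBit p.2.2

def encMat {q n m l : ℕ} [NeZero n] (A : Matrix (Fin m) (Fin l) (Rq q n)) :
    MatQubits q n m l → Bool :=
  fun p => ((A p.1 p.2.1).coeff p.2.2.1).val.testBit p.2.2.2

/-! ### The `MLWE` problem -/

/-- A quantum algorithm for `MLWE_{m,k,η}`: a circuit whose input is the encoding of a pair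
`(A, t) ∈ R_q ^ (m × k) × R_q ^ m`, followed by `anc` qubits in the state `|0⟩`, with a designated
output qubit. -/
structure MLWEAlg (q n m k : ℕ) : Type where
  anc : ℕ
  gates : List (Gate ((MatQubits q n m k ⊕ VecQubits q n m) ⊕ Fin anc))
  out : (MatQubits q n m k ⊕ VecQubits q n m) ⊕ Fin anc

namespace MLWEAlg
variable {q n m k : ℕ}

/-- The number of elementary gates. -/
def time (B : MLWEAlg q n m k) : ℕ := B.gates.length

/-- The probability that the output bit on input `(A, t)` is `0`. -/
def probZero [NeZero n] (B : MLWEAlg q n m k) (A : Matrix (Fin m) (Fin k) (Rq q n))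
    (t : Fin m → Rq q n) : ℝ :=
  probBit B.out false (evolve B.gates (startState B.anc (Sum.elim (encMat A) (encVec t))))

/-- The advantage for solving `MLWE_{m,k,η}`. -/
def advantage [NeZero q] [NeZero n] (B : MLWEAlg q n m k) (η : ℕ) : ℝ :=
  |(𝔼 A : Matrix (Fin m) (Fin k) (Rq q n), 𝔼 t : Fin m → Rq q n, B.probZero A t) -
    𝔼 A : Matrix (Fin m) (Fin k) (Rq q n),
      𝔼 s ∈ shortVecs q n k η ×ˢ shortVecs q n m η, B.probZero A (A.mulVec s.1 + s.2)|

end MLWEAlg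

/-! ### The collapsing experiment -/

/-- A two-stage quantum algorithm for the collapsing experiment. The whole register consists of the
qubits of the input matrix, followed by `anc` qubits in the state `|0⟩`. The registers `Y` and `Z`
are disjoint sets of qubits of it, and all of its other qubits form the register `T`. -/
structure CollapseAlg (q n m l : ℕ) : Type where
  anc : ℕ
  Y : VecQubits q n l ↪ MatQubits q n m l ⊕ Fin anc
  Z : VecQubits q n m ↪ MatQubits q n m l ⊕ Fin anc
  disjoint : ∀ i j, Y i ≠ Z j
  gates₁ : List (Gate (MatQubits q n m l ⊕ Fin anc))
  gates₂ : List (Gate (MatQubits q n m l ⊕ Fin anc))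
  out : MatQubits q n m l ⊕ Fin anc

namespace CollapseAlg
variable {q n m l : ℕ}

/-- The number of elementary gates, in both stages together. -/
def time (𝒜 : CollapseAlg q n m l) : ℕ := 𝒜.gates₁.length + 𝒜.gates₂.length

/-- The state of `(Y, Z, T)` after the first stage has been run on input `A`. -/
def firstState [NeZero n] (𝒜 : CollapseAlg q n m l) (A : Matrix (Fin m) (Fin l) (Rq q n)) :
    Op (MatQubits q n m l ⊕ Fin 𝒜.anc) :=
  evolve 𝒜.gates₁ (startState 𝒜.anc (encMat A))

/-- For every input `A`, the state of `(Y, Z)` output by the first stage is supported on pairs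
`(y, z)` with `A y = z` and `‖y‖_∞ ≤ γ`. -/
def Valid [NeZero n] (𝒜 : CollapseAlg q n m l) (γ : ℕ) : Prop :=
  ∀ (A : Matrix (Fin m) (Fin l) (Rq q n)) (x : MatQubits q n m l ⊕ Fin 𝒜.anc → Bool),
    𝒜.firstState A x x ≠ 0 →
      ∃ (y : Fin l → Rq q n) (z : Fin m → Rq q n),
        (fun i => x (𝒜.Y i)) = encVec y ∧ (fun i => x (𝒜.Z i)) = encVec z ∧
          A.mulVec y = z ∧ vecNorm y ≤ γ

/-- The state handed to the second stage when the challenge bit is `b`. The prover sends a classical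
value `z` to the verifier, so `Z` is measured; the register `Y` is measured if and only if
`b = 1`. -/
def challengeState [NeZero n] (𝒜 : CollapseAlg q n m l) (A : Matrix (Fin m) (Fin l) (Rq q n))
    (b : Bool) : Op (MatQubits q n m l ⊕ Fin 𝒜.anc) :=
  if b then measure 𝒜.Y (measure 𝒜.Z (𝒜.firstState A)) else measure 𝒜.Z (𝒜.firstState A)

/-- The probability that the collapsing experiment outputs `1`: for uniformly random `A` and `b`,
the output bit of the second stage is `b`. -/
def winProb [NeZero q] [NeZero n] (𝒜 : CollapseAlg q n m l) : ℝ :=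
  𝔼 A : Matrix (Fin m) (Fin l) (Rq q n), 𝔼 b : Bool,
    probBit 𝒜.out b (evolve 𝒜.gates₂ (𝒜.challengeState A b))

/-- The advantage `2 p - 1` in the collapsing experiment. -/
def advantage [NeZero q] [NeZero n] (𝒜 : CollapseAlg q n m l) : ℝ := 2 * 𝒜.winProb - 1

end CollapseAlg

/-! ### Asymptotic notions -/

/-- `f(λ) ≤ poly(λ)`. -/
def PolyBounded (f : ℕ → ℕ) : Prop := ∃ p : Polynomial ℕ, ∀ k, f k ≤ p.eval k

/-- `f(λ) ≤ negl(λ)`. -/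
def Negligible (f : ℕ → ℝ) : Prop := ∀ c : ℕ, ∀ᶠ k in Filter.atTop, f k ≤ 1 / (k : ℝ) ^ c

/-- No quantum algorithm with polynomially many gates solves `MLWE_{m,k,η}` with non-negligible
advantage; all parameters are functions of the security parameter. -/
def MLWEHard (q n m k η : ℕ → ℕ) [∀ i, NeZero (q i)] [∀ i, NeZero (n i)] : Prop :=
  ∀ B : ∀ i, MLWEAlg (q i) (n i) (m i) (k i),
    PolyBounded (fun i => (B i).time) → Negligible (fun i => (B i).advantage (η i))

/-- The `MSIS` hash function is collapsing: no valid quantum algorithm with polynomially many gates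
has a non-negligible advantage in the collapsing experiment. -/
def IsCollapsing (q n m l γ : ℕ → ℕ) [∀ i, NeZero (q i)] [∀ i, NeZero (n i)] : Prop :=
  ∀ 𝒜 : ∀ i, CollapseAlg (q i) (n i) (m i) (l i), (∀ i, (𝒜 i).Valid (γ i)) →
    PolyBounded (fun i => (𝒜 i).time) → Negligible (fun i => (𝒜 i).advantage)

end

end MSISHash

/-! On input `(A, t)` the reduction runs the first stage on the transpose of `A`, measures `Z`,
measures one random bit that depends on the constant coefficient of `t ⬝ᵥ y`, and runs the second
stage. Expand the intermediate state according to the contents of `Z` and `Y`. Every output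
probability involved is then a sum of fixed interference coefficients over pairs with equal `z`, and
a partial measurement of `Y` only multiplies the coefficient of `(y, y')` by the probability that
the measured bit agrees on `y` and `y'` (`sum_normSq_projAmp_comp`, `CollapseAlg.exists_mlweAlg`).
The factor 1 is the experiment without measurement, the Kronecker delta the one with measurement;
the difference of the two is the collapsing advantage ε (`CollapseAlg.advantage_eq`).

Let `D` be the difference of the pairings of `t` with `y` and `y'`. If `t = A s₁ + s₂` and `y`, `y'`
are short with the same image, then `s₁` drops out and `D` is congruent modulo `q` to some `d` with
`|d| ≤ 2γηnl` (`exists_small_pairing_sub`). If `t` is uniform and `y ≠ y'`, then `D` is uniform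
modulo `q` (`expect_constCoeff_dotProduct`). The latter needs only a nonzero linear functional over
the prime field, not invertibility in `R_q`, so the ring may split completely.

The bit is the top bit of `C * pairing` plus a uniform shift, modulo a power of two `Q`, with `C =
⌊Q / q⌋`. It agrees on `y` and `y'` with probability `1 - 2x`, where `x` is the cyclic distance of
`C * D` from 0 divided by `Q`. For small `d` this is close to 1 but not constant. A second
measurement, with `4 * C` in place of `C` and with the output bit complemented, enters with a minus
sign, and weights 3/4 and 3/16 cancel the linear terms: `3/4 (1 - 2x) - 3/16 (1 - 8x) = 9/16`
exactly for `x ≤ 1/8` (`triangle_scale_small`). With the remaining probability 1/16 nothing is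
measured.

Up to terms common to both cases, a sample thus gives exactly 9/16 of the coherent probability. A
uniform `t` gives approximately `9/16 (π * coherent + (1 - π) * collapsed)`, where `π ≤ 17/32` is
the mean of `triangle q`. The gap is `9/16 (1 - π) ε ≥ 135/512 ε ≥ ε/4` for `ε ≥ 0`. The rounding
error for uniform `t`, even after multiplication by the number of values of `Y`, is at most
`3^(-w)/4` once `Q` has polynomially many bits.

The rest is implementation: the bit is computed by a straight-line program, which is turned into a
reversible circuit and then into elementary gates; copying a bit to a fresh qubit measures it, and
coins are qubits in uniform superposition. -/

namespace MSISHash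
noncomputable section

set_option linter.unusedSectionVars false

/-! ### Action of the gates on the computational basis -/

section Gates
variable {ι Ω : Type} [Fintype ι] [DecidableEq ι] [Fintype Ω] [DecidableEq Ω]

/-- The vector `|x⟩`. -/
def ket (x : ι → Bool) : (ι → Bool) → ℂ := Pi.single x 1

theorem ket_apply (x y : ι → Bool) : ket x y = if y = x then 1 else 0 := by
  simp [ket, Pi.single_apply]

theorem mulVec_ket (M : Op ι) (y x : ι → Bool) : M.mulVec (ket y) x = M x y := by
  simp [ket]

theorem Op.ext_ket {M N : Op ι} (h : ∀ y, M.mulVec (ket y) = N.mulVec (ket y)) : M = N := by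
  ext x y
  rw [← mulVec_ket M y x, h, mulVec_ket N y x]

/-- The phase `e^{iπ/4}`. -/
def omega : ℂ := Complex.exp (Complex.I * Real.pi / 4)

theorem omega_pow_four : omega ^ 4 = -1 := by
  rw [omega, ← Complex.exp_nat_mul]
  rw [← Complex.exp_pi_mul_I]
  congr 1
  push_cast
  ring

theorem forall_ne_imp_eq_iff (x y : ι → Bool) (i : ι) :
    (∀ k, k ≠ i → x k = y k) ↔ x = Function.update y i (x i) := by
  constructor
  · intro h
    funext k
    by_cases hk : k = i
    · subst hk; simp
    · simp [hk, h k hk]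
  · intro h k hk
    rw [h]; simp [hk]

theorem t_mulVec_ket (i : ι) (y : ι → Bool) :
    (Gate.t i).matrix.mulVec (ket y) = (if y i then omega else 1) • ket y := by
  funext x
  rw [mulVec_ket]
  simp only [Gate.matrix, Matrix.of_apply, tMatrix, Matrix.diagonal_apply, Pi.smul_apply,
    ket_apply, smul_eq_mul]
  by_cases hxy : x = y
  · subst hxy
    simp [omega]
  · by_cases h : ∀ k, k ≠ i → x k = y k
    · have : x i ≠ y i := by
        intro hi
        apply hxy
        funext k
        by_cases hk : k = i
        · rw [hk, hi]
        · exact h k hk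
      simp [this, hxy]
    · simp [h, hxy]

theorem h_mulVec_ket (i : ι) (y : ι → Bool) :
    (Gate.h i).matrix.mulVec (ket y) = ((Real.sqrt 2 : ℂ)⁻¹) •
      (ket (Function.update y i false) +
        (if y i then (-1 : ℂ) else 1) • ket (Function.update y i true)) := by
  funext x
  rw [mulVec_ket]
  simp only [Gate.matrix, Matrix.of_apply, hMatrix, Pi.smul_apply, Pi.add_apply,
    ket_apply, smul_eq_mul]
  by_cases h : ∀ k, k ≠ i → x k = y k
  · rw [if_pos h]
    have h' := (forall_ne_imp_eq_iff x y i).1 h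
    cases hx : x i
    · rw [hx] at h'
      have h2 : x ≠ Function.update y i true := by
        intro h3; rw [h3] at hx; simp at hx
      rw [if_pos h', if_neg h2]
      simp [div_eq_mul_inv]
    · rw [hx] at h'
      have h2 : x ≠ Function.update y i false := by
        intro h3; rw [h3] at hx; simp at hx
      rw [if_neg h2, if_pos h']
      simp [div_eq_mul_inv, mul_comm]
  · rw [if_neg h]
    have h1 : ∀ b, x ≠ Function.update y i b := by
      intro b hb
      apply h
      rw [forall_ne_imp_eq_iff, hb]
      simp
    simp [h1]

theorem cnot_mulVec_ket (i j : ι) (hij : i ≠ j) (y : ι → Bool) :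
    (Gate.cnot i j hij).matrix.mulVec (ket y) =
      ket (Function.update y j (xor (y j) (y i))) := by
  funext x
  rw [mulVec_ket]
  simp only [Gate.matrix, Matrix.of_apply, cnotMatrix, ket_apply, Prod.mk.injEq, ← ite_and]
  congr 1
  simp only [eq_iff_iff]
  constructor
  · rintro ⟨h, h1, h2⟩
    funext k
    by_cases hj : k = j
    · subst hj; simp [h2]
    · by_cases hi : k = i
      · subst hi; simp [hj, h1]
      · simp [hj, h k hi hj]
  · intro h
    subst h
    refine ⟨fun k h1 h2 => by simp [h2], by simp [hij], by simp⟩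

theorem circuitUnitary_cons_mulVec (g : Gate ι) (C : List (Gate ι)) (ψ : (ι → Bool) → ℂ) :
    (circuitUnitary (g :: C)).mulVec ψ = (circuitUnitary C).mulVec (g.matrix.mulVec ψ) := by
  simp [circuitUnitary]

theorem circuitUnitary_append (C D : List (Gate ι)) :
    circuitUnitary (C ++ D) = circuitUnitary D * circuitUnitary C := by
  induction C with
  | nil => simp [circuitUnitary]
  | cons g C ih => simp [circuitUnitary, ih, Matrix.mul_assoc]

theorem circuitUnitary_append_mulVec (C D : List (Gate ι)) (ψ : (ι → Bool) → ℂ) :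
    (circuitUnitary (C ++ D)).mulVec ψ =
      (circuitUnitary D).mulVec ((circuitUnitary C).mulVec ψ) := by
  simp [circuitUnitary_append]

theorem Gate.matrix_cnot_involutive (i j : ι) (hij : i ≠ j) :
    (Gate.cnot i j hij).matrix * (Gate.cnot i j hij).matrix = 1 := by
  apply Op.ext_ket
  intro y
  rw [← Matrix.mulVec_mulVec, cnot_mulVec_ket, cnot_mulVec_ket, Matrix.one_mulVec]
  congr 1
  funext k
  by_cases hk : k = j
  · subst hk; simp [hij]
  · simp [hk]

theorem sqrt_two_inv_sq : ((Real.sqrt 2 : ℂ)⁻¹) * ((Real.sqrt 2 : ℂ)⁻¹) = 1 / 2 := by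
  rw [← mul_inv, ← Complex.ofReal_mul, Real.mul_self_sqrt (by norm_num)]
  norm_num

theorem Gate.matrix_h_involutive (i : ι) :
    (Gate.h i).matrix * (Gate.h i).matrix = 1 := by
  apply Op.ext_ket
  intro y
  rw [← Matrix.mulVec_mulVec, h_mulVec_ket, Matrix.mulVec_smul, Matrix.mulVec_add,
    Matrix.mulVec_smul, h_mulVec_ket, h_mulVec_ket, Matrix.one_mulVec]
  simp only [Function.update_idem, Function.update_self]
  have hs := sqrt_two_inv_sq
  funext x
  simp only [Pi.smul_apply, Pi.add_apply, smul_eq_mul, Bool.false_eq_true, if_true, if_false]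
  cases hy : y i
  · have : Function.update y i false = y := by rw [← hy]; simp
    simp only [this, Bool.false_eq_true, if_false]
    linear_combination (2 * ket y x) * hs
  · have : Function.update y i true = y := by rw [← hy]; simp
    simp only [this, if_true]
    linear_combination (2 * ket y x) * hs

theorem Gate.conjTranspose_mul_matrix (g : Gate ι) : g.matrix.conjTranspose * g.matrix = 1 := by
  cases g with
  | t i =>
    have : (Gate.t i).matrix = Matrix.diagonal fun y => if y i then omega else 1 := by
      apply Op.ext_ket
      intro y
      rw [t_mulVec_ket]
      funext x
      rw [mulVec_ket, Matrix.diagonal_apply]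
      by_cases h : x = y
      · subst h; simp [ket_apply]
      · simp [h, ket_apply]
    rw [this, Matrix.diagonal_conjTranspose, Matrix.diagonal_mul_diagonal, ← Matrix.diagonal_one]
    congr 1
    funext y
    -- The phase has modulus one: its conjugate has the opposite exponent.
    have : (starRingEnd ℂ) omega * omega = 1 := by
      rw [omega, ← Complex.exp_conj, ← Complex.exp_add, map_div₀, map_mul, Complex.conj_I,
        Complex.conj_ofReal, Complex.conj_ofNat, neg_mul, neg_div, neg_add_cancel, Complex.exp_zero]
    cases hy : y i <;> simp [hy, this]
  | h i =>
    have : (Gate.h i).matrix.conjTranspose = (Gate.h i).matrix := by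
      ext x y
      simp only [Gate.matrix, Matrix.conjTranspose_apply, Matrix.of_apply, hMatrix, eq_comm]
      split_ifs <;> simp_all
    rw [this, Gate.matrix_h_involutive]
  | cnot i j hij =>
    have : (Gate.cnot i j hij).matrix.conjTranspose = (Gate.cnot i j hij).matrix := by
      ext x y
      have h1 : (∀ k, k ≠ i → k ≠ j → y k = x k) ↔ ∀ k, k ≠ i → k ≠ j → x k = y k :=
        forall_congr' fun k => imp_congr_right fun _ => imp_congr_right fun _ => eq_comm
      have h2 : (y i = x i ∧ y j = xor (x j) (x i)) ↔ (x i = y i ∧ x j = xor (y j) (y i)) := by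
        cases x i <;> cases x j <;> cases y i <;> cases y j <;> simp
      simp only [Gate.matrix, Matrix.conjTranspose_apply, Matrix.of_apply, cnotMatrix,
        Prod.mk.injEq, h1, h2]
      split_ifs <;> simp
    rw [this, Gate.matrix_cnot_involutive]

theorem circuitUnitary_conjTranspose_mul (C : List (Gate ι)) :
    (circuitUnitary C).conjTranspose * circuitUnitary C = 1 := by
  induction C with
  | nil => simp [circuitUnitary]
  | cons g C ih =>
    rw [circuitUnitary, Matrix.conjTranspose_mul, Matrix.mul_assoc,
      ← Matrix.mul_assoc _ (circuitUnitary C), ih, Matrix.one_mul, g.conjTranspose_mul_matrix]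

theorem sum_normSq_mulVec {M : Op ι} (hM : M.conjTranspose * M = 1) (ψ : (ι → Bool) → ℂ) :
    ∑ x, Complex.normSq (M.mulVec ψ x) = ∑ x, Complex.normSq (ψ x) := by
  have h : star (M.mulVec ψ) ⬝ᵥ M.mulVec ψ = star ψ ⬝ᵥ ψ := by
    rw [Matrix.star_mulVec, Matrix.dotProduct_mulVec, Matrix.vecMul_vecMul, hM, Matrix.vecMul_one]
  have key : ∀ φ : (ι → Bool) → ℂ, star φ ⬝ᵥ φ = ((∑ x, Complex.normSq (φ x) : ℝ) : ℂ) := by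
    intro φ
    simp [dotProduct, Complex.normSq_eq_conj_mul_self]
  rw [key, key] at h
  exact_mod_cast h

theorem sum_normSq_circuit (C : List (Gate ι)) (ψ : (ι → Bool) → ℂ) :
    ∑ x, Complex.normSq ((circuitUnitary C).mulVec ψ x) = ∑ x, Complex.normSq (ψ x) :=
  sum_normSq_mulVec (circuitUnitary_conjTranspose_mul C) ψ

/-! ### Circuits on a part of the register -/

/-- A gate, relabelled along an embedding of registers. -/
def Gate.map {ι Ω : Type} (f : ι ↪ Ω) : Gate ι → Gate Ω
  | .t i => .t (f i)
  | .h i => .h (f i)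
  | .cnot i j hij => .cnot (f i) (f j) (f.injective.ne hij)

theorem forall_range_iff (f : ι ↪ Ω) (x y : Ω → Bool) (p : ι → Prop) :
    (∀ k, (∀ i, k = f i → p i) → x k = y k) ↔
      (∀ k, k ∉ Set.range f → x k = y k) ∧ ∀ i, p i → x (f i) = y (f i) := by
  constructor
  · intro h
    refine ⟨fun k hk => h k fun i hi => (hk ⟨i, hi.symm⟩).elim, fun i hi => h _ ?_⟩
    intro j hj
    rwa [← f.injective hj]
  · rintro ⟨h1, h2⟩ k hk
    by_cases hr : k ∈ Set.range f
    · obtain ⟨i, rfl⟩ := hr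
      exact h2 i (hk i rfl)
    · exact h1 k hr

open Classical in
theorem Gate.map_matrix (f : ι ↪ Ω) (g : Gate ι) (x y : Ω → Bool) :
    (g.map f).matrix x y =
      if ∀ k, k ∉ Set.range f → x k = y k then g.matrix (x ∘ f) (y ∘ f) else 0 := by
  cases g with
  | t i =>
    have := forall_range_iff f x y (fun k => k ≠ i)
    have h2 : (∀ k, k ≠ f i → x k = y k) ↔ (∀ k, (∀ j, k = f j → j ≠ i) → x k = y k) := by
      refine forall_congr' fun k => imp_congr_left ⟨fun h j hj hji => h (by rw [hj, hji]),
        fun h hk => h i hk rfl⟩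
    simp only [Gate.map, Gate.matrix, Matrix.of_apply, h2, this, ite_and, Function.comp]
  | h i =>
    have := forall_range_iff f x y (fun k => k ≠ i)
    have h2 : (∀ k, k ≠ f i → x k = y k) ↔ (∀ k, (∀ j, k = f j → j ≠ i) → x k = y k) := by
      refine forall_congr' fun k => imp_congr_left ⟨fun h j hj hji => h (by rw [hj, hji]),
        fun h hk => h i hk rfl⟩
    simp only [Gate.map, Gate.matrix, Matrix.of_apply, h2, this, ite_and, Function.comp]
  | cnot i j hij =>
    have := forall_range_iff f x y (fun k => k ≠ i ∧ k ≠ j)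
    have h2 : (∀ k, k ≠ f i → k ≠ f j → x k = y k) ↔
        (∀ k, (∀ a, k = f a → a ≠ i ∧ a ≠ j) → x k = y k) := by
      refine forall_congr' fun k => ?_
      rw [← and_imp]
      exact imp_congr_left ⟨fun h a ha => ⟨fun hi => h.1 (by rw [ha, hi]),
        fun hi => h.2 (by rw [ha, hi])⟩,
        fun h => ⟨fun hk => (h i hk).1 rfl, fun hk => (h j hk).2 rfl⟩⟩
    simp only [Gate.map, Gate.matrix, Matrix.of_apply, h2, this, ite_and, Function.comp, and_imp]

theorem eq_extend_iff (f : ι ↪ Ω) (w z : Ω → Bool) (x : ι → Bool) :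
    w = Function.extend f x z ↔ x = w ∘ f ∧ ∀ k, k ∉ Set.range f → w k = z k := by
  constructor
  · rintro rfl
    refine ⟨by funext i; simp [f.injective.extend_apply], fun k hk => ?_⟩
    exact Function.extend_apply' _ _ _ (by simpa using hk)
  · rintro ⟨rfl, h⟩
    funext k
    by_cases hk : k ∈ Set.range f
    · obtain ⟨i, rfl⟩ := hk
      simp [f.injective.extend_apply]
    · rw [Function.extend_apply' _ _ _ (by simpa using hk), h k hk]

/-- Off the range of `f` the basis label stays that of `z`, which is what `Function.extend f x z`
records; this is the form in which tensoring with the identity is used. -/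
theorem Gate.map_mulVec_ket (f : ι ↪ Ω) (g : Gate ι) (z : Ω → Bool) :
    (g.map f).matrix.mulVec (ket z) =
      ∑ x, g.matrix x (z ∘ f) • ket (Function.extend f x z) := by
  classical
  funext w
  rw [mulVec_ket, Gate.map_matrix]
  simp only [Finset.sum_apply, Pi.smul_apply, ket_apply, smul_eq_mul, eq_extend_iff]
  by_cases h : ∀ k, k ∉ Set.range f → w k = z k
  · rw [if_pos h]
    simp only [and_iff_left h, mul_ite, mul_one, mul_zero]
    simp
  · rw [if_neg h]
    simp only [h, and_false, if_false, mul_zero, Finset.sum_const_zero]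

/-- A circuit on a sub-register acts on the corresponding tensor factor. -/
theorem circuitUnitary_map_mulVec_ket (f : ι ↪ Ω) (C : List (Gate ι)) (z : Ω → Bool) :
    (circuitUnitary (C.map (Gate.map f))).mulVec (ket z) =
      ∑ x, circuitUnitary C x (z ∘ f) • ket (Function.extend f x z) := by
  classical
  induction C generalizing z with
  | nil =>
    simp only [List.map_nil, circuitUnitary, Matrix.one_mulVec, Matrix.one_apply, ite_smul,
      one_smul, zero_smul, Finset.sum_ite_eq', Finset.mem_univ, if_true]
    congr 1
    exact (eq_extend_iff f z z _).2 ⟨rfl, fun _ _ => rfl⟩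
  | cons g C ih =>
    rw [List.map_cons, circuitUnitary_cons_mulVec, Gate.map_mulVec_ket, Matrix.mulVec_sum]
    simp only [Matrix.mulVec_smul, ih, circuitUnitary, Matrix.mul_apply, Finset.sum_smul,
      Finset.smul_sum]
    rw [Finset.sum_comm]
    refine Finset.sum_congr rfl fun x' _ => Finset.sum_congr rfl fun x _ => ?_
    have h1 : Function.extend f x z ∘ f = x := by
      funext i; simp [f.injective.extend_apply]
    have h2 : Function.extend f x' (Function.extend f x z) = Function.extend f x' z := by
      rw [eq_extend_iff]
      refine ⟨by funext i; simp [f.injective.extend_apply], fun k hk => ?_⟩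
      rw [Function.extend_apply' _ _ _ (by simpa using hk),
        Function.extend_apply' _ _ _ (by simpa using hk)]
    rw [h1, h2, smul_smul, mul_comm]

end Gates


/-! ### Reversible classical circuits -/

section Monomial
variable {ι : Type} [Fintype ι] [DecidableEq ι]

/-- The circuit `C` maps `|y⟩` to `ω ^ p |y'⟩`. -/
def Monomial (C : List (Gate ι)) (y : ι → Bool) (p : ℕ) (y' : ι → Bool) : Prop :=
  (circuitUnitary C).mulVec (ket y) = omega ^ p • ket y'

theorem Monomial.nil (y : ι → Bool) : Monomial [] y 0 y := by
  simp [Monomial, circuitUnitary]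

theorem Monomial.append {C D : List (Gate ι)} {x y z : ι → Bool} {p r : ℕ}
    (h : Monomial C x p y) (h' : Monomial D y r z) : Monomial (C ++ D) x (p + r) z := by
  unfold Monomial at *
  rw [circuitUnitary_append_mulVec, h, Matrix.mulVec_smul, h', smul_smul, pow_add]

theorem Monomial.t (i : ι) (y : ι → Bool) : Monomial [Gate.t i] y (if y i then 1 else 0) y := by
  unfold Monomial
  rw [circuitUnitary_cons_mulVec, t_mulVec_ket]
  cases y i <;> simp [circuitUnitary]

theorem Monomial.cnot (i j : ι) (hij : i ≠ j) (y : ι → Bool) :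
    Monomial [Gate.cnot i j hij] y 0 (Function.update y j (xor (y j) (y i))) := by
  unfold Monomial
  rw [circuitUnitary_cons_mulVec, cnot_mulVec_ket]
  simp [circuitUnitary]

theorem Monomial.t_pow (k : ℕ) (i : ι) (y : ι → Bool) :
    Monomial (List.replicate k (Gate.t i)) y (k * if y i then 1 else 0) y := by
  induction k with
  | zero => simpa using Monomial.nil y
  | succ k ih =>
    rw [List.replicate_succ, ← List.singleton_append, Nat.succ_mul, Nat.add_comm]
    exact (Monomial.t i y).append ih

/-- If `C` only multiplies basis states by a sign `-1` depending on the qubit `i` and a further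
condition `b`, then conjugating it with Hadamard gates gives a controlled negation of `i`. -/
theorem hadamard_conj {C : List (Gate ι)} (i : ι) (y : ι → Bool) (b : Bool)
    (hC : ∀ v, ∃ p, Monomial C (Function.update y i v) p (Function.update y i v) ∧
      omega ^ p = if b && v then -1 else 1) :
    (circuitUnitary (Gate.h i :: (C ++ [Gate.h i]))).mulVec (ket y) =
      ket (Function.update y i (xor (y i) b)) := by
  obtain ⟨p, hp, hp'⟩ := hC false
  obtain ⟨r, hr, hr'⟩ := hC true
  unfold Monomial at hp hr
  have hs := sqrt_two_inv_sq
  rw [circuitUnitary_cons_mulVec, circuitUnitary_append_mulVec, h_mulVec_ket, Matrix.mulVec_smul,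
    Matrix.mulVec_add, Matrix.mulVec_smul (circuitUnitary C), hp, hr, hp', hr', circuitUnitary_cons_mulVec]
  simp only [Matrix.mulVec_smul, Matrix.mulVec_add, h_mulVec_ket, Function.update_idem,
    Function.update_self]
  funext x
  cases hy : y i <;> cases b <;>
  simp only [circuitUnitary, Matrix.one_mulVec, Pi.smul_apply, Pi.add_apply, smul_eq_mul,
      Bool.false_eq_true, if_true, if_false, Bool.and_true, Bool.and_false, Bool.xor_false,
      Bool.xor_true, Bool.not_true, Bool.not_false]
  · linear_combination (2 * ket (Function.update y i false) x) * hs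
  · linear_combination (2 * ket (Function.update y i true) x) * hs
  · linear_combination (2 * ket (Function.update y i true) x) * hs
  · linear_combination (2 * ket (Function.update y i false) x) * hs

/-- A negation gate. -/
def notCircuit (i : ι) : List (Gate ι) := Gate.h i :: (List.replicate 4 (Gate.t i) ++ [Gate.h i])

theorem notCircuit_mulVec_ket (i : ι) (y : ι → Bool) :
    (circuitUnitary (notCircuit i)).mulVec (ket y) = ket (Function.update y i (!y i)) := by
  rw [notCircuit, hadamard_conj i y true, Bool.xor_true]
  intro v
  refine ⟨_, Monomial.t_pow 4 i _, ?_⟩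
  cases v <;> simp [omega_pow_four]

/-- Between the two CNOT gates qubit `j` holds the parity of `i` and `j`, so a phase gate placed
there contributes a phase that depends on this parity. -/
theorem Monomial.cnot_conj {C : List (Gate ι)} (i j : ι) (hij : i ≠ j) (y : ι → Bool) {p : ℕ}
    (h : Monomial C (Function.update y j (xor (y j) (y i))) p
      (Function.update y j (xor (y j) (y i)))) :
    Monomial ([Gate.cnot i j hij] ++ (C ++ [Gate.cnot i j hij])) y p y := by
  have key := (Monomial.cnot i j hij y).append (h.append (Monomial.cnot i j hij _))
  rw [zero_add, add_zero] at key
  convert key using 1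
  funext k
  by_cases hk : k = j
  · subst hk; simp [hij]
  · simp [hk]

/-- A doubly controlled phase gate on three qubits. -/
def cczCircuit (a b c : ι) (hab : a ≠ b) (hac : a ≠ c) (hbc : b ≠ c) : List (Gate ι) :=
  [Gate.t a] ++ ([Gate.t b] ++ ([Gate.t c] ++
    (([Gate.cnot a b hab] ++ (List.replicate 7 (Gate.t b) ++ [Gate.cnot a b hab])) ++
    (([Gate.cnot a c hac] ++ (List.replicate 7 (Gate.t c) ++ [Gate.cnot a c hac])) ++
    (([Gate.cnot b c hbc] ++ (List.replicate 7 (Gate.t c) ++ [Gate.cnot b c hbc])) ++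
    ([Gate.cnot a c hac] ++ (([Gate.cnot b c hbc] ++ ([Gate.t c] ++ [Gate.cnot b c hbc])) ++
      [Gate.cnot a c hac])))))))

/-- For bits, `a + b + c - (a⊕b) - (a⊕c) - (b⊕c) + (a⊕b⊕c) = 4abc`. Each summand is the exponent of
one phase gate on a parity; the negative ones appear as seventh powers since `omega ^ 8 = 1`, and
`omega ^ 4 = -1`. -/
theorem cczCircuit_monomial (a b c : ι) (hab : a ≠ b) (hac : a ≠ c) (hbc : b ≠ c) (y : ι → Bool) :
    ∃ p, Monomial (cczCircuit a b c hab hac hbc) y p y ∧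
      omega ^ p = if y a && y b && y c then -1 else 1 := by
  have key := (Monomial.t a y).append <| (Monomial.t b y).append <| (Monomial.t c y).append <|
    (Monomial.cnot_conj a b hab y (Monomial.t_pow 7 b _)).append <|
    (Monomial.cnot_conj a c hac y (Monomial.t_pow 7 c _)).append <|
    (Monomial.cnot_conj b c hbc y (Monomial.t_pow 7 c _)).append <|
    Monomial.cnot_conj a c hac y (Monomial.cnot_conj b c hbc _ (Monomial.t c _))
  refine ⟨_, key, ?_⟩
  have h8 : omega ^ 8 = 1 := by
    rw [show 8 = 4 * 2 from rfl, pow_mul, omega_pow_four]; norm_num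
  have h16 : omega ^ 16 = 1 := by
    rw [show 16 = 8 * 2 from rfl, pow_mul, h8]; norm_num
  cases ha : y a <;> cases hb : y b <;> cases hc : y c <;>
    simp [hb, hbc, h16, omega_pow_four]

/-- A Toffoli gate: `c` is negated if `a` and `b` are set. -/
def toffoliCircuit (a b c : ι) (hab : a ≠ b) (hac : a ≠ c) (hbc : b ≠ c) : List (Gate ι) :=
  Gate.h c :: (cczCircuit a b c hab hac hbc ++ [Gate.h c])

theorem toffoliCircuit_mulVec_ket (a b c : ι) (hab : a ≠ b) (hac : a ≠ c) (hbc : b ≠ c)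
    (y : ι → Bool) :
    (circuitUnitary (toffoliCircuit a b c hab hac hbc)).mulVec (ket y) =
      ket (Function.update y c (xor (y c) (y a && y b))) := by
  rw [toffoliCircuit, hadamard_conj c y (y a && y b)]
  intro v
  obtain ⟨p, hp, hp'⟩ := cczCircuit_monomial a b c hab hac hbc (Function.update y c v)
  refine ⟨p, hp, ?_⟩
  rw [hp']
  simp [hac, hbc]

/-- Reversible gates: the target is negated if all the controls are set. -/
inductive RevGate (ι : Type) : Type
  | not (i : ι) : RevGate ι
  | cnot (i j : ι) (hne : i ≠ j) : RevGate ι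
  | toffoli (a b c : ι) (hab : a ≠ b) (hac : a ≠ c) (hbc : b ≠ c) : RevGate ι

/-- The action of a reversible gate on classical states. -/
def RevGate.eval : RevGate ι → (ι → Bool) → ι → Bool
  | .not i, y => Function.update y i (!y i)
  | .cnot i j _, y => Function.update y j (xor (y j) (y i))
  | .toffoli a b c _ _ _, y => Function.update y c (xor (y c) (y a && y b))

theorem RevGate.eval_eval (g : RevGate ι) (y : ι → Bool) : g.eval (g.eval y) = y := by
  cases g with
  | not i => simp [RevGate.eval]
  | cnot i j hij => simp [RevGate.eval, hij]
  | toffoli a b c hab hac hbc => simp [RevGate.eval, hac, hbc]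

/-- The action of a reversible circuit; the head of the list is applied first. -/
def revEval : List (RevGate ι) → (ι → Bool) → ι → Bool
  | [], y => y
  | g :: C, y => revEval C (g.eval y)

theorem revEval_append (C D : List (RevGate ι)) (y : ι → Bool) :
    revEval (C ++ D) y = revEval D (revEval C y) := by
  induction C generalizing y with
  | nil => rfl
  | cons g C ih => exact ih _

theorem revEval_reverse (C : List (RevGate ι)) (y : ι → Bool) :
    revEval C.reverse (revEval C y) = y := by
  induction C generalizing y with
  | nil => rfl
  | cons g C ih =>
    rw [List.reverse_cons, revEval_append]
    simp only [revEval, ih, RevGate.eval_eval]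

/-- The implementation of a reversible gate by elementary gates. -/
def RevGate.compile : RevGate ι → List (Gate ι)
  | .not i => notCircuit i
  | .cnot i j hij => [Gate.cnot i j hij]
  | .toffoli a b c hab hac hbc => toffoliCircuit a b c hab hac hbc

theorem RevGate.length_compile (g : RevGate ι) : g.compile.length ≤ 40 := by
  cases g <;> simp [RevGate.compile, notCircuit, toffoliCircuit, cczCircuit]

theorem RevGate.compile_mulVec_ket (g : RevGate ι) (y : ι → Bool) :
    (circuitUnitary g.compile).mulVec (ket y) = ket (g.eval y) := by
  cases g with
  | not i => exact notCircuit_mulVec_ket i y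
  | cnot i j hij =>
    simp [RevGate.compile, circuitUnitary, cnot_mulVec_ket, RevGate.eval]
  | toffoli a b c hab hac hbc => exact toffoliCircuit_mulVec_ket a b c hab hac hbc y

/-- The implementation of a reversible circuit by elementary gates. -/
def compile (C : List (RevGate ι)) : List (Gate ι) := C.flatMap RevGate.compile

theorem length_compile (C : List (RevGate ι)) : (compile C).length ≤ 40 * C.length := by
  induction C with
  | nil => simp [compile]
  | cons g C ih =>
    have := g.length_compile
    simp only [compile, List.flatMap_cons, List.length_append, List.length_cons] at ih ⊢
    omega

theorem compile_mulVec_ket (C : List (RevGate ι)) (y : ι → Bool) :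
    (circuitUnitary (compile C)).mulVec (ket y) = ket (revEval C y) := by
  induction C generalizing y with
  | nil => simp [compile, circuitUnitary, revEval]
  | cons g C ih =>
    rw [compile, List.flatMap_cons, circuitUnitary_append_mulVec, g.compile_mulVec_ket]
    exact ih _

end Monomial


/-! ### Straight-line programs -/

section Programs
variable {κ : Type}

/-- `Straight L` says that `L`, read from its end, is a straight-line program: each function is a
constant, an input bit, or the exclusive or, or the conjunction, of two functions further down. -/
inductive Straight : List ((κ → Bool) → Bool) → Prop
  | nil : Straight []
  | const {L} (b : Bool) (hL : Straight L) : Straight ((fun _ => b) :: L)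
  | input {L} (i : κ) (hL : Straight L) : Straight ((fun x => x i) :: L)
  | xor {L f g} (hL : Straight L) (hf : f ∈ L) (hg : g ∈ L) :
      Straight ((fun x => Bool.xor (f x) (g x)) :: L)
  | and {L f g} (hL : Straight L) (hf : f ∈ L) (hg : g ∈ L) :
      Straight ((fun x => f x && g x) :: L)

/-- Every line of the program owns one work qubit, initially 0, which is written once and only read
afterwards. The newest line is the head of the list and has index 0, so the induction shifts the
older lines by `Fin.succ`. An exclusive or takes two CNOT gates, every other line at most one gate.
-/
theorem Straight.exists_revEval {L : List ((κ → Bool) → Bool)} (hL : Straight L) {Ω : Type}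
    [Fintype Ω] [DecidableEq Ω] (inp : κ → Ω) (wk : Fin L.length ↪ Ω)
    (hdisj : ∀ i j, inp i ≠ wk j) :
    ∃ R : List (RevGate Ω), R.length ≤ 2 * L.length ∧ ∀ x : Ω → Bool,
      (∀ j, x (wk j) = false) →
        (∀ k, k ∉ Set.range wk → revEval R x k = x k) ∧
          ∀ j, revEval R x (wk j) = L.get j fun i => x (inp i) := by
  have step : ∀ (L : List ((κ → Bool) → Bool)) (f : (κ → Bool) → Bool)
      (inp : κ → Ω) (wk : Fin (f :: L).length ↪ Ω) (_ : ∀ i j, inp i ≠ wk j)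
      (ih : ∀ wk : Fin L.length ↪ Ω, (∀ i j, inp i ≠ wk j) →
        ∃ R : List (RevGate Ω), R.length ≤ 2 * L.length ∧ ∀ x : Ω → Bool,
        (∀ j, x (wk j) = false) →
        (∀ k, k ∉ Set.range wk → revEval R x k = x k) ∧
          ∀ j, revEval R x (wk j) = L.get j fun i => x (inp i))
      (S : List (RevGate Ω)) (_ : S.length ≤ 2)
      (_ : ∀ (x y : Ω → Bool), y (wk 0) = false → (∀ i, y (inp i) = x (inp i)) →
        (∀ j : Fin L.length, y (wk j.succ) = L.get j fun i => x (inp i)) →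
        revEval S y = Function.update y (wk 0) (f fun i => x (inp i))),
      ∃ R : List (RevGate Ω), R.length ≤ 2 * (f :: L).length ∧ ∀ x : Ω → Bool,
        (∀ j, x (wk j) = false) →
        (∀ k, k ∉ Set.range wk → revEval R x k = x k) ∧
          ∀ j, revEval R x (wk j) = (f :: L).get j fun i => x (inp i) := by
    intro L f inp wk hdisj ih S hS hS'
    obtain ⟨R, hR, hR'⟩ := ih ((Fin.succEmb L.length).trans wk)
      (fun i j => hdisj i _)
    refine ⟨R ++ S, by simp; omega, fun x hx => ?_⟩
    obtain ⟨h1, h2⟩ := hR' x (fun j => hx _)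
    have h3 := hS' x (revEval R x)
      (by
        rw [h1, hx]
        rintro ⟨j, hj⟩
        exact Fin.succ_ne_zero j (wk.injective hj))
      (fun i => h1 _ (by rintro ⟨j, hj⟩; exact hdisj _ _ hj.symm)) h2
    rw [revEval_append, h3]
    refine ⟨fun k hk => ?_, fun j => ?_⟩
    · rw [Function.update_of_ne (fun h => hk ⟨_, h.symm⟩), h1]
      rintro ⟨j, hj⟩
      exact hk ⟨_, hj⟩
    · refine Fin.cases ?_ (fun j => ?_) j
      · rw [Function.update_self]; rfl
      · have : wk j.succ ≠ wk 0 := wk.injective.ne (Fin.succ_ne_zero j)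
        rw [Function.update_of_ne this]
        exact h2 j
  induction hL with
  | nil => exact ⟨[], by simp, fun x _ => ⟨fun _ _ => rfl, fun j => j.elim0⟩⟩
  | const b hL ih =>
    refine step _ _ inp wk hdisj ih (if b then [.not (wk 0)] else []) (by split_ifs <;> simp) ?_
    intro x y h0 hi hj
    cases b
    · funext k; by_cases hk : k = wk 0
      · subst hk; simp [revEval, h0]
      · simp [revEval, hk]
    · simp [revEval, RevGate.eval, h0]
  | input i hL ih =>
    refine step _ _ inp wk hdisj ih [.cnot (inp i) (wk 0) (hdisj _ _)] (by simp) ?_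
    intro x y h0 hi hj
    simp [revEval, RevGate.eval, h0, hi]
  | @xor L f g hL hf hg ih =>
    obtain ⟨a, rfl⟩ := List.get_of_mem hf
    obtain ⟨b, rfl⟩ := List.get_of_mem hg
    have ha : wk a.succ ≠ wk 0 := wk.injective.ne (Fin.succ_ne_zero a)
    have hb : wk b.succ ≠ wk 0 := wk.injective.ne (Fin.succ_ne_zero b)
    refine step _ _ inp wk hdisj ih [.cnot _ _ ha, .cnot _ _ hb] (by simp) ?_
    intro x y h0 hi hj
    simp [revEval, RevGate.eval, h0, hj, hb]
  | @and L f g hL hf hg ih =>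
    obtain ⟨a, rfl⟩ := List.get_of_mem hf
    obtain ⟨b, rfl⟩ := List.get_of_mem hg
    have ha : wk a.succ ≠ wk 0 := wk.injective.ne (Fin.succ_ne_zero a)
    have hb : wk b.succ ≠ wk 0 := wk.injective.ne (Fin.succ_ne_zero b)
    -- A Toffoli gate needs distinct controls; the conjunction of a line with itself is a copy.
    by_cases hab : a = b
    · refine step _ _ inp wk hdisj ih [.cnot _ _ ha] (by simp) ?_
      intro x y h0 hi hj
      simp [revEval, RevGate.eval, h0, hj, hab]
    · have hab' : wk a.succ ≠ wk b.succ :=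
        wk.injective.ne (fun h => hab (Fin.succ_injective _ h))
      refine step _ _ inp wk hdisj ih [.toffoli _ _ _ hab' ha hb] (by simp) ?_
      intro x y h0 hi hj
      simp [revEval, RevGate.eval, h0, hj]

theorem revEval_copy {O Ω : Type} [DecidableEq Ω] (src tgt : O → Ω)
    (hne : ∀ o o', src o ≠ tgt o') (htgt : Function.Injective tgt) (l : List O) (hl : l.Nodup)
    (x : Ω → Bool) :
    (∀ k, (∀ o ∈ l, k ≠ tgt o) →
      revEval (l.map fun o => .cnot (src o) (tgt o) (hne o o)) x k = x k) ∧
    ∀ o ∈ l, revEval (l.map fun o => .cnot (src o) (tgt o) (hne o o)) x (tgt o) =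
      xor (x (tgt o)) (x (src o)) := by
  induction l generalizing x with
  | nil => simp [revEval]
  | cons a l ih =>
    obtain ⟨hal, hl⟩ := List.nodup_cons.1 hl
    obtain ⟨h1, h2⟩ := ih hl (Function.update x (tgt a) (xor (x (tgt a)) (x (src a))))
    simp only [List.map_cons, revEval, RevGate.eval]
    refine ⟨fun k hk => ?_, fun o ho => ?_⟩
    · rw [h1 k fun o ho => hk o (List.mem_cons_of_mem _ ho)]
      simp [hk a]
    · rcases List.mem_cons.1 ho with rfl | ho
      · rw [h1 _ fun o' ho' h => hal (by rw [htgt h]; exact ho')]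
        simp
      · rw [h2 o ho]
        have : tgt o ≠ tgt a := fun h => hal (htgt h ▸ ho)
        simp [this, hne]

/-- The functions computed by a straight-line program can be computed by a quantum circuit that
resets all of its work qubits. -/
theorem Straight.exists_circuit [Fintype κ] [DecidableEq κ] {O : Type} [Fintype O] [DecidableEq O]
    {L : List ((κ → Bool) → Bool)} (hL : Straight L) (G : O → (κ → Bool) → Bool)
    (hG : ∀ o, G o ∈ L) :
    ∃ C : List (Gate ((κ ⊕ O) ⊕ Fin L.length)),
      C.length ≤ 40 * (4 * L.length + Fintype.card O) ∧
      ∀ u : κ → Bool,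
        (circuitUnitary C).mulVec
          (ket (Sum.elim (Sum.elim u fun _ => false) fun _ => false)) =
        ket (Sum.elim (Sum.elim u fun o => G o u) fun _ => false) := by
  obtain ⟨R, hR, hR'⟩ := hL.exists_revEval
    (Ω := (κ ⊕ O) ⊕ Fin L.length) (fun i => Sum.inl (Sum.inl i)) Function.Embedding.inr (by simp)
  choose idx hidx using fun o => List.get_of_mem (hG o)
  have hne : ∀ o o' : O, (Sum.inr (idx o) : (κ ⊕ O) ⊕ Fin L.length) ≠ Sum.inl (Sum.inr o') := by
    simp
  set copy : List (RevGate ((κ ⊕ O) ⊕ Fin L.length)) :=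
    (Finset.univ : Finset O).toList.map fun o => .cnot _ _ (hne o o) with hcopy
  refine ⟨compile (R ++ (copy ++ R.reverse)), (length_compile _).trans ?_, fun u => ?_⟩
  · simp [hcopy]
    omega
  · rw [compile_mulVec_ket, revEval_append, revEval_append]
    congr 1
    set x : (κ ⊕ O) ⊕ Fin L.length → Bool := Sum.elim (Sum.elim u fun _ => false) fun _ => false
    set y : (κ ⊕ O) ⊕ Fin L.length → Bool := Sum.elim (Sum.elim u fun o => G o u) fun _ => false
    obtain ⟨hx1, hx2⟩ := hR' x (fun _ => rfl)
    obtain ⟨hy1, hy2⟩ := hR' y (fun _ => rfl)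
    obtain ⟨hc1, hc2⟩ := revEval_copy _ _ hne
      (fun a b h => by simpa using h) _ (Finset.univ : Finset O).nodup_toList (revEval R x)
    rw [← hcopy] at hc1 hc2
    -- `R` leaves the output qubits alone and its work qubits depend only on the input, so copying
    -- after `R` gives the same state as starting `R` with the outputs already filled in. Hence
    -- `R.reverse` clears the work qubits and keeps the outputs.
    have : revEval copy (revEval R x) = revEval R y := by
      funext k
      rcases k with (i | o) | j
      · rw [hc1 _ (by simp), hx1 _ (by simp), hy1 _ (by simp)]
        rfl
      · rw [hc2 o (by simp), hx1 _ (by simp), hy1 _ (by simp)]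
        have := hx2 (idx o)
        simp only [Function.Embedding.inr_apply] at this
        rw [this, hidx]
        simp [x, y]
      · rw [hc1 _ (by simp)]
        exact (hx2 j).trans (hy2 j).symm
    rw [this, revEval_reverse]

end Programs


/-! ### Arithmetic by straight-line programs -/

/-- The carry into position `k` in the addition of `a` and `b`. -/
def natCarry (a b k : ℕ) : Bool := decide (2 ^ k ≤ a % 2 ^ k + b % 2 ^ k)

/-- The next carry is the majority of the two bits and the carry, in a form that uses only
conjunction and exclusive or. -/
theorem natCarry_succ (a b k : ℕ) :
    natCarry a b (k + 1) = Bool.xor (a.testBit k && b.testBit k)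
      (natCarry a b k && Bool.xor (a.testBit k) (b.testBit k)) := by
  have h := BitVec.carry_succ (w := k + 1) k (BitVec.ofNat (k + 1) a) (BitVec.ofNat (k + 1) b)
    (c := false)
  have hm : ∀ a : ℕ, a % 2 ^ (k + 1) % 2 ^ k = a % 2 ^ k := fun a =>
    Nat.mod_mod_of_dvd _ (pow_dvd_pow 2 (Nat.le_succ k))
  simp only [BitVec.carry, BitVec.toNat_ofNat, Bool.toNat_false, add_zero, ge_iff_le,
    Nat.mod_mod, hm, BitVec.getLsbD_ofNat, Nat.lt_succ_self, decide_true, Bool.true_and] at h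
  unfold natCarry
  rw [h]
  cases a.testBit k <;> cases b.testBit k <;>
    cases decide (2 ^ k ≤ a % 2 ^ k + b % 2 ^ k) <;> rfl

theorem testBit_add_eq (a b k : ℕ) :
    (a + b).testBit k = Bool.xor (Bool.xor (a.testBit k) (b.testBit k)) (natCarry a b k) := by
  have h := BitVec.getLsbD_add (w := k + 1) (i := k) (Nat.lt_succ_self k)
    (BitVec.ofNat (k + 1) a) (BitVec.ofNat (k + 1) b)
  have hm : ∀ a : ℕ, a % 2 ^ (k + 1) % 2 ^ k = a % 2 ^ k := fun a =>
    Nat.mod_mod_of_dvd _ (pow_dvd_pow 2 (Nat.le_succ k))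
  rw [← BitVec.ofNat_add] at h
  simp only [BitVec.carry, BitVec.toNat_ofNat, Bool.toNat_false, add_zero, ge_iff_le,
    hm, BitVec.getLsbD_ofNat, Nat.lt_succ_self, decide_true, Bool.true_and] at h
  rw [h, natCarry, Bool.xor_assoc]

section Arithmetic
variable {κ : Type}

/-- The functions in `S` can be computed by extending the program `L` by at most `c` lines. -/
def Extends (L : List ((κ → Bool) → Bool)) (c : ℕ) (S : Set ((κ → Bool) → Bool)) : Prop :=
  ∃ L', Straight L' ∧ L ⊆ L' ∧ L'.length ≤ L.length + c ∧ ∀ f ∈ S, f ∈ L'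

theorem Extends.mono {L : List ((κ → Bool) → Bool)} {c d : ℕ} {S T : Set ((κ → Bool) → Bool)}
    (h : Extends L c S) (hcd : c ≤ d) (hT : T ⊆ S) : Extends L d T := by
  obtain ⟨L', h1, h2, h3, h4⟩ := h
  exact ⟨L', h1, h2, by omega, fun f hf => h4 f (hT hf)⟩

/-- The function `f` can be computed by at most `c` additional lines in every program that contains
the functions in `S`. -/
def Computable (S : Set ((κ → Bool) → Bool)) (c : ℕ) (T : Set ((κ → Bool) → Bool)) : Prop :=
  ∀ L, Straight L → (∀ f ∈ S, f ∈ L) → Extends L c T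

theorem Computable.mono {S S' T T' : Set ((κ → Bool) → Bool)} {c c' : ℕ} (h : Computable S c T)
    (hS : S ⊆ S') (hT : T' ⊆ T) (hc : c ≤ c') : Computable S' c' T' :=
  fun L hL hLS => (h L hL fun f hf => hLS f (hS hf)).mono hc hT

theorem Computable.of_subset {S T : Set ((κ → Bool) → Bool)} (hT : T ⊆ S) : Computable S 0 T :=
  fun L hL hLS => ⟨L, hL, List.Subset.refl _, by simp, fun f hf => hLS f (hT hf)⟩

/-- Intermediate results stay in the program, so they are kept in the conclusion and shared by all
later computations at no further cost. -/
theorem Computable.trans {S T U : Set ((κ → Bool) → Bool)} {c d : ℕ} (h : Computable S c T)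
    (h' : Computable (S ∪ T) d U) : Computable S (c + d) (T ∪ U) := by
  intro L hL hLS
  obtain ⟨L₁, h1, h2, h3, h4⟩ := h L hL hLS
  obtain ⟨L₂, k1, k2, k3, k4⟩ := h' L₁ h1 (by
    rintro f (hf | hf)
    · exact h2 (hLS f hf)
    · exact h4 f hf)
  refine ⟨L₂, k1, fun f hf => k2 (h2 hf), by omega, ?_⟩
  rintro f (hf | hf)
  · exact k2 (h4 f hf)
  · exact k4 f hf

theorem Computable.trans_right {S T U : Set ((κ → Bool) → Bool)} {c d : ℕ} (h : Computable S c T)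
    (h' : Computable (S ∪ T) d U) : Computable S (c + d) U :=
  (h.trans h').mono subset_rfl Set.subset_union_right le_rfl

theorem Computable.const (S : Set ((κ → Bool) → Bool)) (b : Bool) :
    Computable S 1 {fun _ => b} :=
  fun L hL _ => ⟨_, hL.const b, List.subset_cons_self _ _, by simp, by simp⟩

theorem Computable.input (S : Set ((κ → Bool) → Bool)) (i : κ) :
    Computable S 1 {fun x => x i} :=
  fun L hL _ => ⟨_, hL.input i, List.subset_cons_self _ _, by simp, by simp⟩

theorem Computable.xor {S : Set ((κ → Bool) → Bool)} {f g : (κ → Bool) → Bool} (hf : f ∈ S)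
    (hg : g ∈ S) : Computable S 1 {fun x => Bool.xor (f x) (g x)} :=
  fun L hL hLS => ⟨_, hL.xor (hLS f hf) (hLS g hg), List.subset_cons_self _ _, by simp, by simp⟩

theorem Computable.and {S : Set ((κ → Bool) → Bool)} {f g : (κ → Bool) → Bool} (hf : f ∈ S)
    (hg : g ∈ S) : Computable S 1 {fun x => f x && g x} :=
  fun L hL hLS => ⟨_, hL.and (hLS f hf) (hLS g hg), List.subset_cons_self _ _, by simp, by simp⟩

theorem Computable.biUnion {J : Type} (l : Finset J) (S : Set ((κ → Bool) → Bool))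
    (T : J → Set ((κ → Bool) → Bool)) {c : ℕ} (h : ∀ j ∈ l, Computable S c (T j)) :
    Computable S (l.card * c) (⋃ j ∈ l, T j) := by
  classical
  induction l using Finset.induction_on with
  | empty => simpa using Computable.of_subset (Set.empty_subset S)
  | insert a l ha ih =>
    have h1 := ih fun j hj => h j (Finset.mem_insert_of_mem hj)
    have h2 := (h a (Finset.mem_insert_self a l)).mono (S' := S ∪ ⋃ j ∈ l, T j)
      Set.subset_union_left subset_rfl le_rfl
    refine (h1.trans h2).mono subset_rfl ?_ ?_
    · rw [Finset.set_biUnion_insert, Set.union_comm]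
    · rw [Finset.card_insert_of_notMem ha, Nat.succ_mul]

/-- The `K` lowest bits of a natural number that depends on the input. -/
def word (K : ℕ) (a : (κ → Bool) → ℕ) : Set ((κ → Bool) → Bool) :=
  {f | ∃ i < K, f = fun x => (a x).testBit i}

/-- Ripple-carry addition: each position costs five lines, and the induction must carry along the
current carry. The extra line is the initial carry, the constant 0. -/
theorem Computable.add_aux {S : Set ((κ → Bool) → Bool)} {K : ℕ} {a b : (κ → Bool) → ℕ}
    (ha : word K a ⊆ S) (hb : word K b ⊆ S) (k : ℕ) (hk : k ≤ K) :
    Computable S (5 * k + 1) ({fun x => natCarry (a x) (b x) k} ∪ word k fun x => a x + b x) := by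
  induction k with
  | zero =>
    refine (Computable.const S false).mono subset_rfl ?_ (by simp)
    rintro f (rfl | ⟨i, hi, rfl⟩)
    · simp only [Set.mem_singleton_iff]
      funext x
      simp [natCarry, Nat.mod_one]
    · omega
  | succ k ih =>
    set A : (κ → Bool) → Bool := fun x => (a x).testBit k
    set B : (κ → Bool) → Bool := fun x => (b x).testBit k
    set D : (κ → Bool) → Bool := fun x => natCarry (a x) (b x) k
    have hA : A ∈ S := ha ⟨k, hk, rfl⟩
    have hB : B ∈ S := hb ⟨k, hk, rfl⟩
    have h0 := ih (by omega)
    have h1 := h0.trans (U := {fun x => A x && B x})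
      (Computable.and (Or.inl hA) (Or.inl hB))
    have h2 := h1.trans (U := {fun x => Bool.xor (A x) (B x)})
      (Computable.xor (Or.inl hA) (Or.inl hB))
    have h3 := h2.trans (U := {fun x => D x && Bool.xor (A x) (B x)})
      (Computable.and (by simp [D]) (by simp))
    have h4 := h3.trans (U := {fun x => Bool.xor (A x && B x) (D x && Bool.xor (A x) (B x))})
      (Computable.xor (by simp) (by simp))
    have h5 := h4.trans (U := {fun x => Bool.xor (Bool.xor (A x) (B x)) (D x)})
      (Computable.xor (by simp) (by simp [D]))
    refine h5.mono subset_rfl ?_ (by omega)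
    rintro f (rfl | ⟨i, hi, rfl⟩)
    · simp only [natCarry_succ]
      simp [A, B, D]
    · rcases Nat.lt_succ_iff_lt_or_eq.1 hi with h | rfl
      · refine Or.inl (Or.inl (Or.inl (Or.inl (Or.inl (Or.inr ⟨i, h, rfl⟩)))))
      · simp only [testBit_add_eq]
        simp [A, B, D]

theorem Computable.add {S : Set ((κ → Bool) → Bool)} {K : ℕ} {a b : (κ → Bool) → ℕ}
    (ha : word K a ⊆ S) (hb : word K b ⊆ S) :
    Computable S (5 * K + 1) (word K fun x => a x + b x) :=
  (Computable.add_aux ha hb K le_rfl).mono subset_rfl Set.subset_union_right le_rfl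

/-- Every bit of a constant switched by `f` is either `f` itself or 0, so such a word needs no new
lines. -/
theorem word_ite_subset {S : Set ((κ → Bool) → Bool)} (K c : ℕ) {f : (κ → Bool) → Bool}
    (hf : f ∈ S) (h0 : (fun _ => false) ∈ S) : (word K fun x => if f x then c else 0) ⊆ S := by
  rintro g ⟨i, -, rfl⟩
  cases h : c.testBit i
  · convert h0 using 2 with x
    beta_reduce
    cases f x <;> simp [h]
  · convert hf using 2 with x
    beta_reduce
    cases f x <;> simp [h]

theorem Computable.sum {S : Set ((κ → Bool) → Bool)} {J : Type} (l : Finset J) (K : ℕ)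
    (c : J → ℕ) (f : J → (κ → Bool) → Bool) (hf : ∀ j ∈ l, f j ∈ S) (h0 : (fun _ => false) ∈ S) :
    Computable S (l.card * (5 * K + 1)) (word K fun x => ∑ j ∈ l, if f j x then c j else 0) := by
  classical
  induction l using Finset.induction_on with
  | empty =>
    have := word_ite_subset K 0 h0 h0
    refine (Computable.of_subset this).mono subset_rfl ?_ (by simp)
    simp
  | insert a l ha ih =>
    have h1 := ih fun j hj => hf j (Finset.mem_insert_of_mem hj)
    have h2 := h1.trans_right (U := word K fun x => (if f a x then c a else 0) +
      ∑ j ∈ l, if f j x then c j else 0) (Computable.add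
        ((word_ite_subset K (c a) (hf a (Finset.mem_insert_self a l)) h0).trans
          Set.subset_union_left) Set.subset_union_right)
    refine h2.mono subset_rfl ?_ ?_
    · simp only [Finset.sum_insert ha]
      exact subset_rfl
    · rw [Finset.card_insert_of_notMem ha, Nat.add_mul, one_mul]

end Arithmetic


/-! ### Output probabilities -/

section Output
variable {ι : Type} [Fintype ι] [DecidableEq ι]

/-- The probability that qubit `i` has value `v` after the circuit `C` has been run on `|x₀⟩`. -/
def outProb (C : List (Gate ι)) (i : ι) (v : Bool) (x₀ : ι → Bool) : ℝ :=
  ∑ x, if x i = v then Complex.normSq ((circuitUnitary C).mulVec (ket x₀) x) else 0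

theorem probBit_evolve_basisState (C : List (Gate ι)) (i : ι) (v : Bool) (x₀ : ι → Bool) :
    probBit i v (evolve C (basisState x₀)) = outProb C i v x₀ := by
  unfold probBit outProb
  refine Finset.sum_congr rfl fun x _ => ?_
  congr 1
  have : evolve C (basisState x₀) x x =
      circuitUnitary C x x₀ * (starRingEnd ℂ) (circuitUnitary C x x₀) := by
    simp [evolve, basisState, Matrix.mul_apply, Matrix.single_apply, ite_and]
  rw [this, Complex.mul_conj, mulVec_ket, Complex.ofReal_re]

theorem sum_normSq_ket (x₀ : ι → Bool) : ∑ x, Complex.normSq (ket x₀ x) = 1 := by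
  simp [ket_apply, apply_ite Complex.normSq]

theorem sum_normSq_sum_smul_ket {J : Type} [Fintype J] (b : J → ι → Bool)
    (hb : Function.Injective b) (c : J → ℂ) (i : ι) (v : Bool) :
    (∑ x, if x i = v then Complex.normSq ((∑ j, c j • ket (b j)) x) else 0) =
      ∑ j, if b j i = v then Complex.normSq (c j) else 0 := by
  classical
  have h1 : ∀ x, (∑ j, c j • ket (b j)) x = ∑ j, if x = b j then c j else 0 := by
    intro x
    simp [Finset.sum_apply, ket_apply]
  have h2 : ∀ x, (if x i = v then Complex.normSq ((∑ j, c j • ket (b j)) x) else 0) =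
      ∑ j, if x = b j then (if b j i = v then Complex.normSq (c j) else 0) else 0 := by
    intro x
    rw [h1]
    by_cases hx : ∃ j, x = b j
    · obtain ⟨j, rfl⟩ := hx
      have h3 : ∀ k, b j = b k ↔ j = k := fun k => hb.eq_iff
      simp [h3]
    · push Not at hx
      simp [hx]
  simp_rw [h2]
  rw [Finset.sum_comm]
  simp

/-- A layer of Hadamard gates on `|0⟩` qubits. -/
theorem hadamard_list_mulVec_ket (l : List ι) (hl : l.Nodup) (y : ι → Bool)
    (hy : ∀ i ∈ l, y i = false) (x : ι → Bool) :
    (circuitUnitary (l.map Gate.h)).mulVec (ket y) x =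
      if ∀ k, k ∉ l → x k = y k then ((Real.sqrt 2 : ℂ)⁻¹) ^ l.length else 0 := by
  induction l generalizing y with
  | nil => simp [circuitUnitary, ket_apply, funext_iff]
  | cons a l ih =>
    obtain ⟨hal, hl⟩ := List.nodup_cons.1 hl
    have hy' : ∀ v, ∀ i ∈ l, Function.update y a v i = false := by
      intro v i hi
      have : i ≠ a := fun h => hal (h ▸ hi)
      simp [this, hy i (List.mem_cons_of_mem _ hi)]
    have hiff : ∀ v, (∀ k, k ∉ l → x k = Function.update y a v k) ↔
        x a = v ∧ ∀ k, k ∉ a :: l → x k = y k := by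
      intro v
      constructor
      · intro h
        refine ⟨by simpa using h a hal, fun k hk => ?_⟩
        rw [List.mem_cons, not_or] at hk
        simpa [hk.1] using h k hk.2
      · rintro ⟨h1, h2⟩ k hk
        by_cases hka : k = a
        · subst hka; simpa using h1
        · simpa [hka] using h2 k (by simp [hka, hk])
    rw [List.map_cons, circuitUnitary_cons_mulVec, h_mulVec_ket, hy a (by simp)]
    simp only [Bool.false_eq_true, if_false, one_smul, Matrix.mulVec_smul, Matrix.mulVec_add,
      Pi.smul_apply, Pi.add_apply, ih hl _ (hy' _), smul_eq_mul, hiff, List.length_cons, pow_succ']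
    cases x a <;> by_cases h : ∀ k, k ∉ a :: l → x k = y k <;> simp

/-- The Hadamard gates on all qubits of a register. -/
def hadamardLayer (ρ : Type) [Fintype ρ] : List (Gate ρ) :=
  (Finset.univ : Finset ρ).toList.map Gate.h

theorem length_hadamardLayer (ρ : Type) [Fintype ρ] :
    (hadamardLayer ρ).length = Fintype.card ρ := by
  simp [hadamardLayer]

theorem circuitUnitary_hadamardLayer {ρ : Type} [Fintype ρ] [DecidableEq ρ] (x : ρ → Bool) :
    circuitUnitary (hadamardLayer ρ) x (fun _ => false) =
      ((Real.sqrt 2 : ℂ)⁻¹) ^ Fintype.card ρ := by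
  rw [← mulVec_ket (circuitUnitary (hadamardLayer ρ)) (fun _ => false) x, hadamardLayer,
    hadamard_list_mulVec_ket _ (Finset.nodup_toList _) _ (by simp)]
  simp

/-- Qubits that are put into a uniform superposition and later used only as controls are uniformly
random bits. -/
theorem outProb_hadamardLayer {ρ : Type} [Fintype ρ] [DecidableEq ρ] (rnd : ρ ↪ ι)
    (C : List (Gate ι)) (i : ι) (v : Bool) (x₀ : ι → Bool) (h₀ : ∀ k, x₀ (rnd k) = false)
    (hC : ∀ (f : ρ → Bool) x,
      (circuitUnitary C).mulVec (ket (Function.extend rnd f x₀)) x ≠ 0 → x ∘ rnd = f) :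
    outProb ((hadamardLayer ρ).map (Gate.map rnd) ++ C) i v x₀ =
      𝔼 f : ρ → Bool, outProb C i v (Function.extend rnd f x₀) := by
  classical
  set φ : (ρ → Bool) → (ι → Bool) → ℂ :=
    fun f => (circuitUnitary C).mulVec (ket (Function.extend rnd f x₀)) with hφ
  have h0 : x₀ ∘ rnd = fun _ => false := funext h₀
  have h1 : (circuitUnitary ((hadamardLayer ρ).map (Gate.map rnd) ++ C)).mulVec (ket x₀) =
      ((Real.sqrt 2 : ℂ)⁻¹) ^ Fintype.card ρ • ∑ f, φ f := by
    rw [circuitUnitary_append_mulVec, circuitUnitary_map_mulVec_ket, h0]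
    simp only [circuitUnitary_hadamardLayer, Matrix.mulVec_sum, Matrix.mulVec_smul,
      Finset.smul_sum, hφ]
  -- The final basis state still records the coins, so at most one branch contributes to each
  -- amplitude and distinct branches do not interfere.
  have h2 : ∀ x, (∑ f, φ f) x = φ (x ∘ rnd) x := by
    intro x
    rw [Finset.sum_apply, Finset.sum_eq_single (x ∘ rnd)]
    · intro f _ hf
      by_contra hne
      exact hf (hC f x hne).symm
    · simp
  have h3 : ∀ x, Complex.normSq (φ (x ∘ rnd) x) = ∑ f, Complex.normSq (φ f x) := by
    intro x
    rw [Finset.sum_eq_single (x ∘ rnd)]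
    · intro f _ hf
      rw [Complex.normSq_eq_zero]
      by_contra hne
      exact hf (hC f x hne).symm
    · simp
  have h4 : Complex.normSq (((Real.sqrt 2 : ℂ)⁻¹) ^ Fintype.card ρ) =
      ((2 : ℝ) ^ Fintype.card ρ)⁻¹ := by
    rw [map_pow, map_inv₀, Complex.normSq_ofReal, Real.mul_self_sqrt (by norm_num), inv_pow]
  simp only [outProb, h1, Pi.smul_apply, smul_eq_mul, map_mul, h4, h2, h3]
  rw [Finset.expect_eq_sum_div_card, Finset.sum_comm, Finset.sum_div]
  refine Finset.sum_congr rfl fun x _ => ?_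
  simp only [Finset.card_univ, Fintype.card_fun, Fintype.card_bool]
  split_ifs
  · push_cast
    rw [inv_mul_eq_div]
  · simp

end Output

/-! ### The circuit that measures functions of the state between two circuits -/

section Probe
variable {ι I O ρ : Type} [Fintype ι] [DecidableEq ι] [Fintype I] [DecidableEq I]
  [Fintype O] [DecidableEq O] [Fintype ρ] [DecidableEq ρ]

/-- The embedding of the first summand. -/
def firstEmb (ι I O : Type) (N : ℕ) : ι ↪ ((ι ⊕ I) ⊕ O) ⊕ Fin N :=
  ((Function.Embedding.inl.trans Function.Embedding.inl).trans Function.Embedding.inl)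

/-- Run `C₁`, copy the outputs of the program `M` to fresh qubits, run `C₂`, and add the output `e`
to the qubit `out`. -/
def probeCircuit {N : ℕ} (rnd : ρ ↪ I) (C₁ C₂ : List (Gate ι))
    (M : List (Gate (((ι ⊕ I) ⊕ O) ⊕ Fin N))) (e : O) (out : ι) :
    List (Gate (((ι ⊕ I) ⊕ O) ⊕ Fin N)) :=
  (hadamardLayer ρ).map (Gate.map (rnd.trans (Function.Embedding.inr.trans
    (Function.Embedding.inl.trans Function.Embedding.inl)))) ++
  (C₁.map (Gate.map (firstEmb ι I O N)) ++ (M ++ (C₂.map (Gate.map (firstEmb ι I O N)) ++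
    [Gate.cnot (Sum.inl (Sum.inr e)) (Sum.inl (Sum.inl (Sum.inl out))) (by simp)])))

theorem extend_firstEmb {N : ℕ} (x a : ι → Bool) (b : I → Bool) (o : O → Bool) (n : Fin N → Bool) :
    Function.extend (firstEmb ι I O N) x (Sum.elim (Sum.elim (Sum.elim a b) o) n) =
      Sum.elim (Sum.elim (Sum.elim x b) o) n := by
  symm
  rw [eq_extend_iff]
  refine ⟨rfl, ?_⟩
  rintro (((i | i) | o) | n) hk
  · exact (hk ⟨i, rfl⟩).elim
  · rfl
  · rfl
  · rfl

theorem map_firstEmb_mulVec_ket {N : ℕ} (C : List (Gate ι)) (a : ι → Bool) (b : I → Bool)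
    (o : O → Bool) (n : Fin N → Bool) :
    (circuitUnitary (C.map (Gate.map (firstEmb ι I O N)))).mulVec
      (ket (Sum.elim (Sum.elim (Sum.elim a b) o) n)) =
    ∑ x, circuitUnitary C x a • ket (Sum.elim (Sum.elim (Sum.elim x b) o) n) := by
  rw [circuitUnitary_map_mulVec_ket]
  simp only [extend_firstEmb]
  rfl

/-- The amplitude of `|w⟩` if `C₁` is run on `|a⟩`, the result is projected onto the states `x` with
`G x = o`, and `C₂` is run. -/
def projAmp {O' : Type} [DecidableEq O'] (C₁ C₂ : List (Gate ι)) (a : ι → Bool)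
    (G : (ι → Bool) → O') (o : O') (w : ι → Bool) : ℂ :=
  ∑ x, if G x = o then circuitUnitary C₂ w x * circuitUnitary C₁ x a else 0

/-- The values of `G` sit on qubits that `C₂` does not touch. They label orthogonal branches, whose
amplitudes are those of a projection between `C₁` and `C₂`. -/
theorem probe_state {N : ℕ} (C₁ C₂ : List (Gate ι))
    (M : List (Gate (((ι ⊕ I) ⊕ O) ⊕ Fin N))) (G : O → (ι ⊕ I → Bool) → Bool)
    (hM : ∀ u : ι ⊕ I → Bool,
        (circuitUnitary M).mulVec
          (ket (Sum.elim (Sum.elim u fun _ => false) fun _ => false)) =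
        ket (Sum.elim (Sum.elim u fun o => G o u) fun _ => false))
    (e : O) (E : (I → Bool) → Bool) (hE : ∀ x b, G e (Sum.elim x b) = E b)
    (out : ι) (a : ι → Bool) (b : I → Bool) :
    (circuitUnitary (C₁.map (Gate.map (firstEmb ι I O N)) ++ (M ++
        (C₂.map (Gate.map (firstEmb ι I O N)) ++
      [Gate.cnot (Sum.inl (Sum.inr e)) (Sum.inl (Sum.inl (Sum.inl out))) (by simp)])))).mulVec
      (ket (Sum.elim (Sum.elim (Sum.elim a b) fun _ => false) fun _ => false)) =
    ∑ p : (ι → Bool) × (O → Bool),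
      projAmp C₁ C₂ a (fun x o => G o (Sum.elim x b)) p.2 p.1 •
        ket (Sum.elim (Sum.elim (Sum.elim (Function.update p.1 out (xor (p.1 out) (E b))) b) p.2)
          fun _ => false) := by
  have hlast : ∀ (w : ι → Bool) (o : O → Bool), o e = E b →
      (circuitUnitary [Gate.cnot (Sum.inl (Sum.inr e)) (Sum.inl (Sum.inl (Sum.inl out)))
        (by simp)]).mulVec (ket (Sum.elim (Sum.elim (Sum.elim w b) o)
          fun _ : Fin N => false)) =
      ket (Sum.elim (Sum.elim (Sum.elim (Function.update w out (xor (w out) (E b))) b) o)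
          fun _ => false) := by
    intro w o ho
    rw [circuitUnitary_cons_mulVec, cnot_mulVec_ket]
    rw [circuitUnitary, Matrix.one_mulVec]
    simp only [Sum.elim_inl, Sum.elim_inr, Sum.update_elim_inl, ho]
  have hrest : ∀ x : ι → Bool, (circuitUnitary (M ++ (C₂.map (Gate.map (firstEmb ι I O N)) ++
      [Gate.cnot (Sum.inl (Sum.inr e)) (Sum.inl (Sum.inl (Sum.inl out))) (by simp)]))).mulVec
      (ket (Sum.elim (Sum.elim (Sum.elim x b) fun _ => false) fun _ => false)) =
      ∑ w, circuitUnitary C₂ w x •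
        ket (Sum.elim (Sum.elim (Sum.elim (Function.update w out (xor (w out) (E b))) b)
          fun o => G o (Sum.elim x b)) fun _ => false) := by
    intro x
    rw [circuitUnitary_append_mulVec, hM, circuitUnitary_append_mulVec, map_firstEmb_mulVec_ket,
      Matrix.mulVec_sum]
    refine Finset.sum_congr rfl fun w _ => ?_
    rw [Matrix.mulVec_smul, hlast _ _ (hE x b)]
  rw [circuitUnitary_append_mulVec, map_firstEmb_mulVec_ket, Matrix.mulVec_sum]
  simp only [Matrix.mulVec_smul, hrest, projAmp]
  rw [Fintype.sum_prod_type]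
  simp only [Finset.smul_sum, Finset.sum_smul, ite_smul, zero_smul]
  rw [Finset.sum_comm]
  refine Finset.sum_congr rfl fun w _ => ?_
  rw [Finset.sum_comm]
  refine Finset.sum_congr rfl fun x _ => ?_
  rw [Finset.sum_ite_eq, if_pos (Finset.mem_univ _), smul_smul, mul_comm]

/-- The bit `E` depends only on the extra input and the coins, so the final CNOT is a random
complementation of the output: the output 0 means that `out` would have been `E`. -/
theorem outProb_probeCircuit {N : ℕ} (rnd : ρ ↪ I) (C₁ C₂ : List (Gate ι))
    (M : List (Gate (((ι ⊕ I) ⊕ O) ⊕ Fin N))) (G : O → (ι ⊕ I → Bool) → Bool)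
    (hM : ∀ u : ι ⊕ I → Bool,
        (circuitUnitary M).mulVec
          (ket (Sum.elim (Sum.elim u fun _ => false) fun _ => false)) =
        ket (Sum.elim (Sum.elim u fun o => G o u) fun _ => false))
    (e : O) (E : (I → Bool) → Bool) (hE : ∀ x b, G e (Sum.elim x b) = E b)
    (out : ι) (a : ι → Bool) (b : I → Bool) (hb : ∀ k, b (rnd k) = false) :
    outProb (probeCircuit rnd C₁ C₂ M e out) (Sum.inl (Sum.inl (Sum.inl out))) false
      (Sum.elim (Sum.elim (Sum.elim a b) fun _ => false) fun _ => false) =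
    𝔼 f : ρ → Bool, ∑ o : O → Bool, ∑ w : ι → Bool,
      if w out = E (Function.extend rnd f b) then
        Complex.normSq
          (projAmp C₁ C₂ a (fun x o => G o (Sum.elim x (Function.extend rnd f b))) o w)
      else 0 := by
  classical
  set emb : ρ ↪ ((ι ⊕ I) ⊕ O) ⊕ Fin N := rnd.trans (Function.Embedding.inr.trans
    (Function.Embedding.inl.trans Function.Embedding.inl)) with hemb
  have hext : ∀ f, Function.extend emb f
      (Sum.elim (Sum.elim (Sum.elim a b) fun _ => false) fun _ => false) =
      Sum.elim (Sum.elim (Sum.elim a (Function.extend rnd f b)) fun _ => false)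
        fun _ => false := by
    intro f
    symm
    rw [eq_extend_iff]
    refine ⟨?_, ?_⟩
    · funext k
      exact (rnd.injective.extend_apply f b k).symm
    · rintro (((i | i) | o) | n) hk
      · rfl
      · refine Function.extend_apply' _ _ _ ?_
        rintro ⟨k, rfl⟩
        exact hk ⟨k, rfl⟩
      · rfl
      · rfl
  rw [probeCircuit, ← hemb, outProb_hadamardLayer emb _ _ _ _ hb]
  · refine Finset.expect_congr rfl fun f _ => ?_
    rw [hext, outProb, probe_state C₁ C₂ M G hM e E hE, sum_normSq_sum_smul_ket, Finset.sum_comm,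
      Fintype.sum_prod_type]
    · refine Finset.sum_congr rfl fun w _ => Finset.sum_congr rfl fun o _ => ?_
      congr 1
      simp only [Sum.elim_inl, Function.update_self, eq_iff_iff]
      cases w out <;> cases E (Function.extend rnd f b) <;> simp
    · rintro ⟨w, o⟩ ⟨w', o'⟩ h
      simp only [Sum.elim_eq_iff, and_true] at h
      obtain ⟨h1, rfl⟩ := h
      congr 1
      funext k
      by_cases hk : k = out
      · subst hk
        have := congrFun h1 k
        simpa using this
      · have := congrFun h1 k
        simpa [hk] using this
  · intro f x hx
    rw [hext, probe_state C₁ C₂ M G hM e E hE, Finset.sum_apply] at hx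
    obtain ⟨p, -, hp⟩ := Finset.exists_ne_zero_of_sum_ne_zero hx
    rw [Pi.smul_apply, ket_apply] at hp
    split_ifs at hp with h
    · subst h
      funext k
      exact rnd.injective.extend_apply f b k
    · simp at hp

end Probe


/-! ### Relabelling the qubits. -/

section Transport
variable {ι Ω : Type} [Fintype ι] [DecidableEq ι] [Fintype Ω] [DecidableEq Ω]

theorem outProb_map_equiv (e : ι ≃ Ω) (C : List (Gate ι)) (i : ι) (v : Bool) (z : Ω → Bool) :
    outProb (C.map (Gate.map e.toEmbedding)) (e i) v z = outProb C i v (z ∘ e) := by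
  have hinj : Function.Injective fun x : ι → Bool => Function.extend e.toEmbedding x z := by
    intro x x' h
    funext k
    have := congrFun h (e k)
    simpa [e.injective.extend_apply] using this
  rw [outProb, circuitUnitary_map_mulVec_ket,
    sum_normSq_sum_smul_ket (fun x : ι → Bool => Function.extend e.toEmbedding x z) hinj, outProb]
  refine Finset.sum_congr rfl fun x _ => ?_
  rw [mulVec_ket]
  congr 2
  exact e.injective.extend_apply x z i

/-- Brings a register into the shape that `MLWEAlg` prescribes, the input qubits followed by a
numbered block of ancillas. -/
theorem exists_equiv_sum_fin {ι Ω : Type} [Fintype Ω] (inp : ι ↪ Ω) :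
    ∃ (anc : ℕ) (e : Ω ≃ ι ⊕ Fin anc), ∀ i, e (inp i) = Sum.inl i := by
  classical
  refine ⟨Fintype.card {x : Ω // x ∉ Set.range inp},
    (Equiv.sumCompl (· ∈ Set.range inp)).symm.trans
      (Equiv.sumCongr (Equiv.ofInjective inp inp.injective).symm (Fintype.equivFin _)), fun i => ?_⟩
  have : (Equiv.sumCompl (· ∈ Set.range inp)).symm (inp i) = Sum.inl ⟨inp i, i, rfl⟩ :=
    Equiv.sumCompl_symm_apply_of_pos ⟨i, rfl⟩
  simp only [Equiv.trans_apply, this, Equiv.sumCongr_apply, Sum.map_inl]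
  congr 1
  exact (Equiv.ofInjective inp inp.injective).symm_apply_apply i

end Transport

/-! ### Measurements and interference terms -/

section Interference
variable {ι : Type} [Fintype ι] [DecidableEq ι]

theorem measure_apply {κ : Type} [Fintype κ] [DecidableEq κ] (reg : κ ↪ ι) (ρ : Op ι)
    (x x' : ι → Bool) :
    measure reg ρ x x' =
      if (fun k => x (reg k)) = (fun k => x' (reg k)) then ρ x x' else 0 := by
  have : ∀ s : κ → Bool, (regProj reg s * ρ * regProj reg s) x x' =
      if (fun k => x (reg k)) = s then
        (if (fun k => x' (reg k)) = s then ρ x x' else 0) else 0 := by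
    intro s
    rw [regProj, Matrix.mul_diagonal, Matrix.diagonal_mul]
    split_ifs <;> simp
  rw [measure, Matrix.sum_apply, Finset.sum_congr rfl fun s _ => this s, Finset.sum_ite_eq,
    if_pos (Finset.mem_univ _)]
  simp only [eq_comm]

theorem evolve_basisState_apply (C : List (Gate ι)) (a x x' : ι → Bool) :
    evolve C (basisState a) x x' =
      circuitUnitary C x a * (starRingEnd ℂ) (circuitUnitary C x' a) := by
  simp [evolve, basisState, Matrix.mul_apply, Matrix.single_apply, ite_and]

theorem normSq_sum_eq {J : Type} [Fintype J] (c : J → ℂ) :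
    Complex.normSq (∑ j, c j) = ∑ j, ∑ k, (c j * (starRingEnd ℂ) (c k)).re := by
  have : ((Complex.normSq (∑ j, c j) : ℝ) : ℂ) = ∑ j, ∑ k, c j * (starRingEnd ℂ) (c k) := by
    rw [← Complex.mul_conj, map_sum, Finset.sum_mul_sum]
  have h := congrArg Complex.re this
  simpa only [Complex.ofReal_re, Complex.re_sum] using h

theorem sum_normSq_fiber {J O : Type} [Fintype J] [Fintype O] [DecidableEq O] (H : J → O)
    (c : J → ℂ) :
    ∑ o, Complex.normSq (∑ j, if H j = o then c j else 0) =
      ∑ j, ∑ k, if H j = H k then (c j * (starRingEnd ℂ) (c k)).re else 0 := by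
  simp_rw [normSq_sum_eq]
  rw [Finset.sum_comm]
  refine Finset.sum_congr rfl fun j _ => ?_
  rw [Finset.sum_comm]
  refine Finset.sum_congr rfl fun k _ => ?_
  rw [Finset.sum_eq_single (H j)]
  · by_cases h : H j = H k
    · simp [h]
    · simp [h, Ne.symm h]
  · intro o _ ho
    simp [ho.symm]
  · simp

/-- Measuring `G` erases exactly the entries between states with different values of `G`. Both
challenge states have this form, so they can be compared with the circuits that copy `G` to fresh
qubits. -/
theorem probBit_evolve_dephased {O : Type} [Fintype O] [DecidableEq O] (C₁ C₂ : List (Gate ι))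
    (a : ι → Bool) (G : (ι → Bool) → O) (ρ : Op ι)
    (hρ : ∀ x x', ρ x x' = if G x = G x' then evolve C₁ (basisState a) x x' else 0)
    (out : ι) (v : Bool) :
    probBit out v (evolve C₂ ρ) =
      ∑ o, ∑ w, if w out = v then Complex.normSq (projAmp C₁ C₂ a G o w) else 0 := by
  rw [Finset.sum_comm, probBit]
  refine Finset.sum_congr rfl fun w _ => ?_
  split_ifs
  · simp only [projAmp]
    rw [sum_normSq_fiber]
    simp only [evolve, Matrix.mul_apply, Matrix.conjTranspose_apply, Finset.sum_mul, Complex.re_sum]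
    rw [Finset.sum_comm]
    refine Finset.sum_congr rfl fun x _ => Finset.sum_congr rfl fun x' _ => ?_
    rw [hρ, evolve_basisState_apply]
    split_ifs
    · congr 1
      simp only [map_mul, RCLike.star_def]
      ring
    · simp
  · simp

/-- The interference between the components of the intermediate state on which `P` has the values
`p` and `p'`, in the event that the final value of `out` is `v`. -/
def interference {J : Type} [DecidableEq J] (C₁ C₂ : List (Gate ι)) (a : ι → Bool)
    (P : (ι → Bool) → J) (out : ι) (v : Bool) (p p' : J) : ℝ :=
  ∑ w : ι → Bool, if w out = v then
    (projAmp C₁ C₂ a P p w * (starRingEnd ℂ) (projAmp C₁ C₂ a P p' w)).re else 0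

variable {J O : Type} [Fintype J] [DecidableEq J] [Fintype O] [DecidableEq O]
  (C₁ C₂ : List (Gate ι)) (a : ι → Bool) (P : (ι → Bool) → J) (out : ι) (v : Bool)

theorem projAmp_comp (H : J → O) (o : O) (w : ι → Bool) :
    projAmp C₁ C₂ a (fun x => H (P x)) o w =
      ∑ p, if H p = o then projAmp C₁ C₂ a P p w else 0 := by
  simp only [projAmp]
  have : ∀ p, (if H p = o then ∑ x, if P x = p then circuitUnitary C₂ w x * circuitUnitary C₁ x a
      else 0 else 0) = ∑ x, if P x = p then (if H p = o then
        circuitUnitary C₂ w x * circuitUnitary C₁ x a else 0) else 0 := by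
    intro p
    split_ifs <;> simp
  simp_rw [this]
  rw [Finset.sum_comm]
  simp

/-- Expanding the square of a sum over a fibre of `H` leaves the pairs inside that fibre. The
coefficients do not depend on `H`, which makes different measurements comparable term by term. -/
theorem sum_normSq_projAmp_comp (H : J → O) :
    (∑ o, ∑ w, if w out = v then
        Complex.normSq (projAmp C₁ C₂ a (fun x => H (P x)) o w) else 0) =
      ∑ p, ∑ p', if H p = H p' then interference C₁ C₂ a P out v p p' else 0 := by
  have h1 : ∀ w, (∑ o, if w out = v then
      Complex.normSq (projAmp C₁ C₂ a (fun x => H (P x)) o w) else 0) =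
      ∑ p, ∑ p', if H p = H p' then (if w out = v then
        (projAmp C₁ C₂ a P p w * (starRingEnd ℂ) (projAmp C₁ C₂ a P p' w)).re else 0) else 0 := by
    intro w
    split_ifs
    · simp_rw [projAmp_comp C₁ C₂ a P H]
      rw [sum_normSq_fiber]
    · simp
  rw [Finset.sum_comm, Finset.sum_congr rfl fun w _ => h1 w, Finset.sum_comm]
  refine Finset.sum_congr rfl fun p _ => ?_
  rw [Finset.sum_comm]
  refine Finset.sum_congr rfl fun p' _ => ?_
  rw [interference]
  split_ifs
  · rfl
  · simp

theorem exists_of_projAmp_ne_zero {p : J} {w : ι → Bool} (h : projAmp C₁ C₂ a P p w ≠ 0) :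
    ∃ x, P x = p ∧ circuitUnitary C₁ x a ≠ 0 := by
  obtain ⟨x, -, hx⟩ := Finset.exists_ne_zero_of_sum_ne_zero h
  split_ifs at hx with hp
  · exact ⟨x, hp, right_ne_zero_of_mul hx⟩
  · exact (hx rfl).elim

theorem exists_of_interference_ne_zero {p p' : J}
    (h : interference C₁ C₂ a P out v p p' ≠ 0) :
    (∃ x, P x = p ∧ circuitUnitary C₁ x a ≠ 0) ∧ ∃ x, P x = p' ∧ circuitUnitary C₁ x a ≠ 0 := by
  obtain ⟨w, -, hw⟩ := Finset.exists_ne_zero_of_sum_ne_zero h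
  split_ifs at hw
  · refine ⟨exists_of_projAmp_ne_zero C₁ C₂ a P (w := w) fun h0 => hw (by simp [h0]),
      exists_of_projAmp_ne_zero C₁ C₂ a P (w := w) fun h0 => hw (by simp [h0])⟩
  · exact (hw rfl).elim

theorem abs_re_mul_conj_le (c d : ℂ) :
    |(c * (starRingEnd ℂ) d).re| ≤ (Complex.normSq c + Complex.normSq d) / 2 := by
  simp only [Complex.mul_re, Complex.conj_re, Complex.conj_im, Complex.normSq_apply]
  rw [abs_le]
  constructor <;> nlinarith [sq_nonneg (c.re + d.re), sq_nonneg (c.im + d.im),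
    sq_nonneg (c.re - d.re), sq_nonneg (c.im - d.im)]

/-- The weight of the component of the intermediate state on which `P` has the value `p`. -/
def weight (p : J) : ℝ := ∑ w, Complex.normSq (projAmp C₁ C₂ a P p w)

theorem abs_interference_le (p p' : J) :
    |interference C₁ C₂ a P out v p p'| ≤
      (weight C₁ C₂ a P p + weight C₁ C₂ a P p') / 2 := by
  rw [interference, weight, weight, ← Finset.sum_add_distrib, Finset.sum_div]
  refine (Finset.abs_sum_le_sum_abs _ _).trans (Finset.sum_le_sum fun w _ => ?_)
  split_ifs
  · exact abs_re_mul_conj_le _ _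
  · rw [abs_zero]
    exact div_nonneg (add_nonneg (Complex.normSq_nonneg _) (Complex.normSq_nonneg _)) two_pos.le

theorem weight_nonneg (p : J) : 0 ≤ weight C₁ C₂ a P p :=
  Finset.sum_nonneg fun _ _ => Complex.normSq_nonneg _

/-- The components are restrictions of one unit vector to disjoint sets of basis states, and `C₂`
preserves their norms. -/
theorem sum_weight : ∑ p, weight C₁ C₂ a P p = 1 := by
  have h1 : ∀ p w, projAmp C₁ C₂ a P p w = (circuitUnitary C₂).mulVec
      (fun x => if P x = p then circuitUnitary C₁ x a else 0) w := by
    intro p w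
    simp [projAmp, Matrix.mulVec, dotProduct]
  simp only [weight, h1, sum_normSq_circuit]
  rw [Finset.sum_comm, ← sum_normSq_ket a, ← sum_normSq_circuit C₁ (ket a)]
  refine Finset.sum_congr rfl fun x _ => ?_
  rw [mulVec_ket]
  simp [apply_ite Complex.normSq]

end Interference


/-! ### The reduction, for an arbitrary partial measurement of `Y` -/

section Probing
variable {ι T ρ κz κy : Type} [Fintype ι] [DecidableEq ι] [Fintype T] [DecidableEq T]
  [Fintype ρ] [DecidableEq ρ] [Fintype κz] [DecidableEq κz] [Fintype κy] [DecidableEq κy]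

/-- Between the circuits `C₁` and `C₂`, the register `Z` and a function `g` of the register `Y` can
be measured. -/
theorem exists_probe (C₁ C₂ : List (Gate ι)) (Z : κz ↪ ι) (Y : κy ↪ ι) (out : ι)
    (g : (T → Bool) → (κy → Bool) → (ρ → Bool) → Bool) (E : (ρ → Bool) → Bool) (c : ℕ)
    (hg : Computable (κ := ι ⊕ (T ⊕ ρ)) ∅ c
      {fun u => g (fun k => u (Sum.inr (Sum.inl k))) (fun k => u (Sum.inl (Y k)))
        (fun k => u (Sum.inr (Sum.inr k))), fun u => E (fun k => u (Sum.inr (Sum.inr k)))}) :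
    ∃ (N : ℕ) (C : List (Gate (((ι ⊕ (T ⊕ ρ)) ⊕ (κz ⊕ Bool)) ⊕ Fin N))),
      C.length ≤ C₁.length + C₂.length + (Fintype.card ρ +
        40 * (4 * (Fintype.card κz + c) + (Fintype.card κz + 2)) + 1) ∧
      ∀ (a : ι → Bool) (t : T → Bool),
        outProb C (Sum.inl (Sum.inl (Sum.inl out))) false
          (Sum.elim (Sum.elim (Sum.elim a (Sum.elim t fun _ => false)) fun _ => false)
            fun _ => false) =
        𝔼 r : ρ → Bool, ∑ p, ∑ p',
          if p.1 = p'.1 ∧ g t p.2 r = g t p'.2 r then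
            interference C₁ C₂ a (fun x => (fun k => x (Z k), fun k => x (Y k))) out (E r) p p'
          else 0 := by
  set G : κz ⊕ Bool → (ι ⊕ (T ⊕ ρ) → Bool) → Bool := Sum.elim (fun k u => u (Sum.inl (Z k)))
    (fun b u => if b then E (fun k => u (Sum.inr (Sum.inr k))) else
      g (fun k => u (Sum.inr (Sum.inl k))) (fun k => u (Sum.inl (Y k)))
        (fun k => u (Sum.inr (Sum.inr k)))) with hGdef
  obtain ⟨L, hL, -, hlen, hmem⟩ := ((Computable.biUnion (κ := ι ⊕ (T ⊕ ρ)) Finset.univ ∅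
    (fun k : κz => {fun u => u (Sum.inl (Z k))})
    (fun k _ => Computable.input _ _)).trans
      (hg.mono (Set.empty_subset _) subset_rfl le_rfl)) [] Straight.nil (by simp)
  have hG : ∀ o, G o ∈ L := by
    rintro (k | b)
    · exact hmem _ (Or.inl (by
        simp only [Set.mem_iUnion]
        exact ⟨k, Finset.mem_univ k, rfl⟩))
    · cases b
      · exact hmem _ (Or.inr (Or.inl rfl))
      · exact hmem _ (Or.inr (Or.inr rfl))
  obtain ⟨M, hMlen, hM⟩ := hL.exists_circuit G hG
  refine ⟨L.length, probeCircuit (Function.Embedding.inr : ρ ↪ T ⊕ ρ) C₁ C₂ M (Sum.inr true) out,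
    ?_, fun a t => ?_⟩
  · simp only [probeCircuit, List.length_map, Fintype.card_sum, Fintype.card_bool, mul_one,
      Finset.card_univ, List.length_nil,
      List.length_append, length_hadamardLayer, List.length_cons] at *
    omega
  · rw [outProb_probeCircuit (Function.Embedding.inr : ρ ↪ T ⊕ ρ) C₁ C₂ M G hM
      (Sum.inr true) (fun b => E fun k => b (Sum.inr k)) (fun x b => rfl) out a
      (Sum.elim t fun _ => false) (fun k => rfl)]
    refine Finset.expect_congr rfl fun r _ => ?_
    have hext : Function.extend (Function.Embedding.inr : ρ ↪ T ⊕ ρ) r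
        (Sum.elim t fun _ => false) = Sum.elim t r := by
      symm
      rw [eq_extend_iff]
      refine ⟨rfl, ?_⟩
      rintro (k | k) hk
      · rfl
      · exact (hk ⟨k, rfl⟩).elim
    rw [hext]
    have key := sum_normSq_projAmp_comp C₁ C₂ a
      (fun x => ((fun k => x (Z k), fun k => x (Y k)) : (κz → Bool) × (κy → Bool))) out
      (E r) (fun p => (Sum.elim p.1 fun b => if b then E r else g t p.2 r : κz ⊕ Bool → Bool))
    refine Eq.trans ?_ (key.trans ?_)
    · have : (fun (x : ι → Bool) o => G o (Sum.elim x (Sum.elim t r))) = fun x =>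
          (Sum.elim (fun k => x (Z k)) fun b => if b then E r else
            g t (fun k => x (Y k)) r : κz ⊕ Bool → Bool) := by
        funext x o
        rcases o with o | b
        · rfl
        · rfl
      rw [this]
      rfl
    · refine Finset.sum_congr rfl fun p _ => Finset.sum_congr rfl fun p' _ => ?_
      have : ((Sum.elim p.1 fun b => if b then E r else g t p.2 r : κz ⊕ Bool → Bool) =
          Sum.elim p'.1 fun b => if b then E r else g t p'.2 r) ↔
          p.1 = p'.1 ∧ g t p.2 r = g t p'.2 r := by
        rw [Sum.elim_eq_iff]
        refine and_congr_right fun _ => ⟨fun h => ?_, fun h => by rw [h]⟩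
        simpa using congrFun h false
      simp only [this]

/-- The circuit of `exists_probe`, with the qubits of the input `X` in front of the others. -/
theorem exists_probe_reindexed {X : Type} [Fintype X] [DecidableEq X] (inp : X ↪ ι ⊕ T)
    (C₁ C₂ : List (Gate ι)) (Z : κz ↪ ι) (Y : κy ↪ ι) (out : ι)
    (g : (T → Bool) → (κy → Bool) → (ρ → Bool) → Bool) (E : (ρ → Bool) → Bool) (c : ℕ)
    (hg : Computable (κ := ι ⊕ (T ⊕ ρ)) ∅ c
      {fun u => g (fun k => u (Sum.inr (Sum.inl k))) (fun k => u (Sum.inl (Y k)))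
        (fun k => u (Sum.inr (Sum.inr k))), fun u => E (fun k => u (Sum.inr (Sum.inr k)))}) :
    ∃ (anc : ℕ) (C : List (Gate (X ⊕ Fin anc))) (o : X ⊕ Fin anc),
      C.length ≤ C₁.length + C₂.length + (Fintype.card ρ +
        40 * (4 * (Fintype.card κz + c) + (Fintype.card κz + 2)) + 1) ∧
      ∀ (x : X → Bool) (a : ι → Bool) (t : T → Bool), (∀ i, Sum.elim a t (inp i) = x i) →
        (∀ k, (∀ i, inp i ≠ k) → Sum.elim a t k = false) →
        outProb C o false (Sum.elim x fun _ => false) =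
        𝔼 r : ρ → Bool, ∑ p, ∑ p',
          if p.1 = p'.1 ∧ g t p.2 r = g t p'.2 r then
            interference C₁ C₂ a (fun x => (fun k => x (Z k), fun k => x (Y k))) out (E r) p p'
          else 0 := by
  obtain ⟨N, C, hC, hprob⟩ := exists_probe C₁ C₂ Z Y out g E c hg
  let j : ι ⊕ T ↪ (((ι ⊕ (T ⊕ ρ)) ⊕ (κz ⊕ Bool)) ⊕ Fin N) :=
    (Function.Embedding.sumMap (Function.Embedding.refl ι) Function.Embedding.inl).trans
      (Function.Embedding.inl.trans Function.Embedding.inl)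
  obtain ⟨anc, e, he⟩ := exists_equiv_sum_fin (inp.trans j)
  refine ⟨anc, C.map (Gate.map e.toEmbedding), e (Sum.inl (Sum.inl (Sum.inl out))), by simpa,
    fun x a t h1 h2 => ?_⟩
  have hstart : (Sum.elim x fun _ : Fin anc => false) ∘ e =
      Sum.elim (Sum.elim (Sum.elim a (Sum.elim t fun _ => false)) fun _ => false)
        fun _ => false := by
    have hj : ∀ k, (Sum.elim (Sum.elim (Sum.elim a (Sum.elim t fun _ => false)) fun _ => false)
        fun _ => false : (((ι ⊕ (T ⊕ ρ)) ⊕ (κz ⊕ Bool)) ⊕ Fin N) → Bool) (j k) =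
        Sum.elim a t k := by
      rintro (k | k) <;> rfl
    funext k
    by_cases hk : ∃ i, j (inp i) = k
    · obtain ⟨i, rfl⟩ := hk
      rw [hj, h1, Function.comp_apply]
      have := he i
      rw [Function.Embedding.trans_apply] at this
      rw [this, Sum.elim_inl]
    · obtain ⟨j', hj'⟩ : ∃ j, e k = Sum.inr j := by
        rcases h : e k with i | j
        · exact (hk ⟨i, e.injective ((he i).trans h.symm)⟩).elim
        · exact ⟨j, rfl⟩
      rw [Function.comp_apply, hj', Sum.elim_inr]
      have hin : ∀ k', j k' = k → Sum.elim a t k' = false := by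
        rintro k' rfl
        exact h2 k' fun i hi => hk ⟨i, by rw [hi]⟩
      rcases k with ((i | (i | i)) | o) | n
      · exact (hin (Sum.inl i) rfl).symm
      · exact (hin (Sum.inr i) rfl).symm
      · rfl
      · rfl
      · rfl
  rw [outProb_map_equiv, hstart]
  exact hprob a t

end Probing

/-! ### The collapsing experiment and the probed circuit in terms of interference coefficients. -/

section Reduction

/-- The qubits of the input of the `MLWE` problem in the register of the reduction; the matrix is
transposed. -/
def inputEmb (q n m l : ℕ) (W : Type) : MatQubits q n l m ⊕ VecQubits q n l ↪
    (MatQubits q n m l ⊕ W) ⊕ VecQubits q n l where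
  toFun := Sum.map (fun i => Sum.inl (i.2.1, i.1, i.2.2)) id
  inj' := by
    rintro (⟨i, j, k⟩ | k) (⟨i', j', k'⟩ | k') h
    · cases Sum.inl.inj (Sum.inl.inj h)
      rfl
    · exact absurd h Sum.inl_ne_inr
    · exact absurd h Sum.inr_ne_inl
    · cases Sum.inr.inj h
      rfl

variable {q n m l : ℕ} [NeZero q] [NeZero n]

/-- The initial state of the register of a collapsing algorithm. -/
def CollapseAlg.start (𝒜 : CollapseAlg q n m l) (A : Matrix (Fin m) (Fin l) (Rq q n)) :
    MatQubits q n m l ⊕ Fin 𝒜.anc → Bool :=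
  Sum.elim (encMat A) fun _ => false

/-- The contents of the registers `Z` and `Y`. -/
def CollapseAlg.registers (𝒜 : CollapseAlg q n m l) (x : MatQubits q n m l ⊕ Fin 𝒜.anc → Bool) :
    (VecQubits q n m → Bool) × (VecQubits q n l → Bool) :=
  (fun k => x (𝒜.Z k), fun k => x (𝒜.Y k))

/-- The interference between the components with contents `p` and `p'` of `Z` and `Y` in the event
that the second stage returns `v`. -/
def CollapseAlg.interf (𝒜 : CollapseAlg q n m l) (A : Matrix (Fin m) (Fin l) (Rq q n)) (v : Bool)
    (p p' : (VecQubits q n m → Bool) × (VecQubits q n l → Bool)) : ℝ :=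
  interference 𝒜.gates₁ 𝒜.gates₂ (𝒜.start A) 𝒜.registers 𝒜.out v p p'

theorem CollapseAlg.probBit_challenge_false (𝒜 : CollapseAlg q n m l)
    (A : Matrix (Fin m) (Fin l) (Rq q n)) (v : Bool) :
    probBit 𝒜.out v (evolve 𝒜.gates₂ (𝒜.challengeState A false)) =
      ∑ p, ∑ p', if p.1 = p'.1 then 𝒜.interf A v p p' else 0 := by
  rw [probBit_evolve_dephased 𝒜.gates₁ 𝒜.gates₂ (𝒜.start A) (fun x => (𝒜.registers x).1)]
  · exact sum_normSq_projAmp_comp 𝒜.gates₁ 𝒜.gates₂ (𝒜.start A) 𝒜.registers 𝒜.out v Prod.fst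
  · intro x x'
    rw [challengeState, if_neg (by simp), measure_apply]
    rfl

theorem CollapseAlg.probBit_challenge_true (𝒜 : CollapseAlg q n m l)
    (A : Matrix (Fin m) (Fin l) (Rq q n)) (v : Bool) :
    probBit 𝒜.out v (evolve 𝒜.gates₂ (𝒜.challengeState A true)) =
      ∑ p, ∑ p', if p = p' then 𝒜.interf A v p p' else 0 := by
  rw [probBit_evolve_dephased 𝒜.gates₁ 𝒜.gates₂ (𝒜.start A) (fun x => 𝒜.registers x)]
  · exact sum_normSq_projAmp_comp 𝒜.gates₁ 𝒜.gates₂ (𝒜.start A) 𝒜.registers 𝒜.out v id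
  · intro x x'
    have : 𝒜.registers x = 𝒜.registers x' ↔ (fun k => x (𝒜.Y k)) = (fun k => x' (𝒜.Y k)) ∧
        (fun k => x (𝒜.Z k)) = (fun k => x' (𝒜.Z k)) := by
      rw [registers, registers, Prod.mk.injEq, and_comm]
    rw [challengeState, if_pos rfl, measure_apply, measure_apply]
    simp only [this, ite_and]
    rfl

/-- Any computable randomised function `g` of `t` and `y` can serve as the partial measurement of
`Y`, at an additive cost proportional to its program length; `E` tells when the answer is
complemented. -/
theorem CollapseAlg.exists_mlweAlg (𝒜 : CollapseAlg q n m l) {ρ : Type} [Fintype ρ]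
    [DecidableEq ρ] (g : (VecQubits q n l → Bool) → (VecQubits q n l → Bool) → (ρ → Bool) → Bool)
    (E : (ρ → Bool) → Bool) (c : ℕ)
    (hg : Computable
      (κ := (MatQubits q n m l ⊕ Fin 𝒜.anc) ⊕ (VecQubits q n l ⊕ ρ)) ∅ c
      {fun u => g (fun k => u (Sum.inr (Sum.inl k))) (fun k => u (Sum.inl (𝒜.Y k)))
        (fun k => u (Sum.inr (Sum.inr k))), fun u => E (fun k => u (Sum.inr (Sum.inr k)))}) :
    ∃ ℬ : MLWEAlg q n l m,
      ℬ.time ≤ 𝒜.time + (Fintype.card ρ +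
        40 * (4 * (m * (n * Nat.clog 2 q) + c) + (m * (n * Nat.clog 2 q) + 2)) + 1) ∧
      ∀ (A : Matrix (Fin l) (Fin m) (Rq q n)) (t : Fin l → Rq q n),
        ℬ.probZero A t = 𝔼 r : ρ → Bool, ∑ p, ∑ p',
          if p.1 = p'.1 ∧ g (encVec t) p.2 r = g (encVec t) p'.2 r then
            𝒜.interf A.transpose (E r) p p' else 0 := by
  obtain ⟨anc, C, o, hC, hprob⟩ := exists_probe_reindexed (inputEmb q n m l (Fin 𝒜.anc))
    𝒜.gates₁ 𝒜.gates₂ 𝒜.Z 𝒜.Y 𝒜.out g E c hg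
  refine ⟨⟨anc, C, o⟩, ?_, fun A t => ?_⟩
  · have h1 : Fintype.card (VecQubits q n m) = m * (n * Nat.clog 2 q) := by
      simp
    rw [h1] at hC
    exact hC
  · rw [MLWEAlg.probZero, startState, probBit_evolve_basisState]
    refine hprob _ (𝒜.start A.transpose) _ ?_ ?_
    · rintro (i | i) <;> rfl
    · rintro ((i | i) | i) hk
      · exact (hk (Sum.inl (i.2.1, i.1, i.2.2)) rfl).elim
      · rfl
      · exact (hk (Sum.inr i) rfl).elim

end Reduction


/-! ### The constant coefficient of a product in `R_q` -/

section Ring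
variable {q n : ℕ} [NeZero n]

theorem Rq.coeff_add (r s : Rq q n) (i : Fin n) : (r + s).coeff i = r.coeff i + s.coeff i := by
  simp [Rq.coeff]

theorem Rq.coeff_smul (c : ZMod q) (r : Rq q n) (i : Fin n) :
    (c • r).coeff i = c * r.coeff i := by
  simp [Rq.coeff]

/-- The constant coefficient, as a linear map. -/
def Rq.constCoeff : Rq q n →ₗ[ZMod q] ZMod q where
  toFun r := r.coeff 0
  map_add' r s := Rq.coeff_add r s 0
  map_smul' c r := Rq.coeff_smul c r 0

/-- The class of `X`. -/
def Rq.root (q n : ℕ) : Rq q n := AdjoinRoot.root _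

theorem Rq.root_pow_self : Rq.root q n ^ n = -1 := by
  have h : (Polynomial.X ^ n + 1 : Polynomial (ZMod q)).eval₂
      (AdjoinRoot.of _) (Rq.root q n) = 0 := AdjoinRoot.eval₂_root _
  simp only [Polynomial.eval₂_add, Polynomial.eval₂_pow, Polynomial.eval₂_X,
    Polynomial.eval₂_one] at h
  exact eq_neg_of_add_eq_zero_left h

theorem natDegree_modulus [Nontrivial (ZMod q)] :
    (Polynomial.X ^ n + 1 : Polynomial (ZMod q)).natDegree = n := by
  simpa using Polynomial.natDegree_X_pow_add_C (R := ZMod q) (n := n) (r := 1)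

theorem Rq.coeff_root_pow [Nontrivial (ZMod q)] {k : ℕ} (hk : k < n) (i : Fin n) :
    (Rq.root q n ^ k).coeff i = if (i : ℕ) = k then 1 else 0 := by
  have h : Rq.root q n ^ k = AdjoinRoot.mk _ (Polynomial.X ^ k) := by
    rw [map_pow, AdjoinRoot.mk_X, Rq.root]
  rw [Rq.coeff, h, AdjoinRoot.modByMonicHom_mk,
    (Polynomial.modByMonic_eq_self_iff (monic_modulus q n)).2, Polynomial.coeff_X_pow]
  rw [Polynomial.degree_X_pow, Polynomial.degree_eq_natDegree (monic_modulus q n).ne_zero,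
    natDegree_modulus]
  exact_mod_cast hk

theorem Rq.eq_sum_coeff [Nontrivial (ZMod q)] (r : Rq q n) :
    r = ∑ i : Fin n, r.coeff i • Rq.root q n ^ (i : ℕ) := by
  set p := AdjoinRoot.modByMonicHom (monic_modulus q n) r with hp
  have h1 : AdjoinRoot.mk _ p = r := AdjoinRoot.mk_leftInverse (monic_modulus q n) r
  have h2 : p.natDegree < n := by
    obtain ⟨f, rfl⟩ := AdjoinRoot.mk_surjective r
    rw [hp, AdjoinRoot.modByMonicHom_mk]
    have := Polynomial.natDegree_modByMonic_lt f (monic_modulus q n) (by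
      intro h
      have := congrArg Polynomial.natDegree h
      rw [natDegree_modulus, Polynomial.natDegree_one] at this
      exact NeZero.ne n this)
    rwa [natDegree_modulus] at this
  conv_lhs => rw [← h1, p.as_sum_range' n h2, map_sum, Finset.sum_range]
  refine Finset.sum_congr rfl fun i _ => ?_
  rw [← Polynomial.C_mul_X_pow_eq_monomial, map_mul, map_pow, AdjoinRoot.mk_X, AdjoinRoot.mk_C,
    Algebra.smul_def]
  rfl

/-- The constant coefficient of `X ^ (i + j)`. -/
def negacyclicSign {n : ℕ} (i j : Fin n) : ℤ :=
  if (i : ℕ) + j = 0 then 1 else if (i : ℕ) + j = n then -1 else 0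

theorem Rq.constCoeff_root_pow [Nontrivial (ZMod q)] (i j : Fin n) :
    Rq.constCoeff (Rq.root q n ^ (i : ℕ) * Rq.root q n ^ (j : ℕ)) = (negacyclicSign i j : ℤ) := by
  rw [← pow_add, negacyclicSign]
  have hn := Nat.pos_of_ne_zero (NeZero.ne n)
  by_cases h : (i : ℕ) + j < n
  · have : Rq.constCoeff (Rq.root q n ^ ((i : ℕ) + j)) = _ := Rq.coeff_root_pow h 0
    rw [this, Fin.val_zero]
    by_cases h0 : (i : ℕ) + j = 0
    · rw [if_pos h0.symm, if_pos h0, Int.cast_one]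
    · rw [if_neg (Ne.symm h0), if_neg h0, if_neg h.ne, Int.cast_zero]
  · obtain ⟨k, hk⟩ := Nat.exists_eq_add_of_le (not_lt.1 h)
    have hk' : k < n := by omega
    rw [hk, pow_add, Rq.root_pow_self, neg_one_mul, map_neg]
    have : Rq.constCoeff (Rq.root q n ^ k) = _ := Rq.coeff_root_pow hk' 0
    rw [this, Fin.val_zero]
    by_cases h0 : k = 0
    · rw [if_pos h0.symm, if_neg (by omega), if_pos (by omega), Int.cast_neg, Int.cast_one]
    · rw [if_neg (Ne.symm h0), if_neg (by omega), if_neg (by omega), neg_zero, Int.cast_zero]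

theorem Rq.constCoeff_mul [Nontrivial (ZMod q)] (r s : Rq q n) :
    Rq.constCoeff (r * s) =
      ∑ i, ∑ j, (negacyclicSign i j : ℤ) * r.coeff i * s.coeff j := by
  conv_lhs => rw [r.eq_sum_coeff, s.eq_sum_coeff, Finset.sum_mul_sum, map_sum]
  refine Finset.sum_congr rfl fun i _ => ?_
  rw [map_sum]
  refine Finset.sum_congr rfl fun j _ => ?_
  rw [smul_mul_smul_comm, map_smul, Rq.constCoeff_root_pow, smul_eq_mul]
  ring

/-- Given `i`, at most one `j` has `i + j` equal to 0 or `n`. This is why products of short vectors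
grow by the factor `n * l` and not `n ^ 2 * l`. -/
theorem sum_abs_negacyclicSign_le (i : Fin n) : ∑ j, |negacyclicSign i j| ≤ 1 := by
  have h : ∀ j, |negacyclicSign i j| =
      if ((i : ℕ) + j = 0 ∨ (i : ℕ) + j = n) then 1 else 0 := by
    intro j
    unfold negacyclicSign
    split_ifs <;> simp_all
  simp_rw [h]
  rw [Finset.sum_boole]
  have : (Finset.univ.filter fun j : Fin n => (i : ℕ) + j = 0 ∨ (i : ℕ) + j = n).card ≤ 1 := by
    rw [Finset.card_le_one]
    intro a ha b hb
    simp only [Finset.mem_filter, Finset.mem_univ, true_and] at ha hb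
    ext
    have := i.2; have := a.2; have := b.2
    omega
  exact_mod_cast this

theorem Rq.coeff_ne_zero [Nontrivial (ZMod q)] {r : Rq q n} (hr : r ≠ 0) : ∃ i, r.coeff i ≠ 0 := by
  by_contra h
  push Not at h
  apply hr
  rw [r.eq_sum_coeff]
  simp [h]

/-- Multiplication by `X ^ (n - j)` moves the `j`-th coefficient to the constant one, up to sign.
The element `r` need not be a unit. -/
theorem Rq.exists_constCoeff_mul_ne_zero [Nontrivial (ZMod q)] {r : Rq q n} (hr : r ≠ 0) :
    ∃ s : Rq q n, Rq.constCoeff (s * r) ≠ 0 := by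
  obtain ⟨j, hj⟩ := Rq.coeff_ne_zero hr
  have hn := Nat.pos_of_ne_zero (NeZero.ne n)
  by_cases h0 : (j : ℕ) = 0
  · refine ⟨1, ?_⟩
    rw [one_mul]
    have : j = 0 := Fin.ext (by simpa using h0)
    subst this
    exact hj
  · refine ⟨Rq.root q n ^ (n - j), ?_⟩
    have hlt : n - (j : ℕ) < n := by omega
    rw [Rq.constCoeff_mul, Finset.sum_eq_single ⟨n - j, hlt⟩, Finset.sum_eq_single j]
    · rw [Rq.coeff_root_pow hlt, negacyclicSign]
      have h1 : n - (j : ℕ) + j = n := by omega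
      simp only [h1]
      simpa [hn.ne'] using hj
    · intro k _ hk
      have : negacyclicSign (⟨n - j, hlt⟩ : Fin n) k = 0 := by
        unfold negacyclicSign
        have h1 : ¬ (k : ℕ) = j := fun h => hk (Fin.ext h)
        have := j.2; have := k.2
        rw [if_neg (by simp only; omega), if_neg (by simp only; omega)]
      simp [this]
    · simp
    · intro i _ hi
      have : (Rq.root q n ^ (n - (j : ℕ))).coeff i = 0 := by
        rw [Rq.coeff_root_pow hlt, if_neg]
        intro h
        exact hi (Fin.ext h)
      simp [this]
    · simp

/-! ### Pairing with a uniformly random vector -/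

/-- The average of `f (φ t)` over `t`, where `φ` is a surjective homomorphism. -/
theorem expect_comp_surjective {G H : Type} [Fintype G] [AddCommGroup G] [Fintype H]
    [AddCommGroup H] (φ : G →+ H) (hφ : Function.Surjective φ) (f : H → ℝ) :
    𝔼 t, f (φ t) = 𝔼 x, f x := by
  have h1 : ∀ x : H, 𝔼 t, f (φ t) = 𝔼 t, f (φ t + x) := by
    intro x
    obtain ⟨s, rfl⟩ := hφ x
    refine (Fintype.expect_equiv (Equiv.addRight s) _ _ fun t => ?_).symm
    simp
  have h2 : ∀ t : G, 𝔼 x, f (φ t + x) = 𝔼 x, f x := fun t =>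
    Fintype.expect_equiv (Equiv.addLeft (φ t)) _ _ fun x => rfl
  calc 𝔼 t, f (φ t) = 𝔼 _x : H, 𝔼 t, f (φ t) := by rw [Fintype.expect_const]
    _ = 𝔼 x, 𝔼 t, f (φ t + x) := Finset.expect_congr rfl fun x _ => h1 x
    _ = 𝔼 t, 𝔼 x, f (φ t + x) := Finset.expect_comm _ _ _
    _ = 𝔼 _t : G, 𝔼 x, f x := Finset.expect_congr rfl fun t _ => h2 t
    _ = 𝔼 x, f x := by rw [Fintype.expect_const]

/-- A nonzero linear functional to a field is surjective, and a surjective homomorphism carries the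
uniform distribution to the uniform one. -/
theorem expect_constCoeff_dotProduct [NeZero q] [Fact q.Prime] {k : ℕ} {d : Fin k → Rq q n}
    (hd : d ≠ 0) (f : ZMod q → ℝ) :
    𝔼 t : Fin k → Rq q n, f (Rq.constCoeff (t ⬝ᵥ d)) = 𝔼 x, f x := by
  let φ : (Fin k → Rq q n) →+ ZMod q :=
    { toFun := fun t => Rq.constCoeff (t ⬝ᵥ d)
      map_zero' := by simp
      map_add' := fun s t => by simp [add_dotProduct] }
  refine expect_comp_surjective φ ?_ f
  obtain ⟨i, hi⟩ := Function.ne_iff.1 hd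
  obtain ⟨s, hs⟩ := Rq.exists_constCoeff_mul_ne_zero hi
  intro x
  refine ⟨Pi.single i ((x / Rq.constCoeff (s * d i)) • s), ?_⟩
  simp only [φ, AddMonoidHom.coe_mk, ZeroHom.coe_mk, single_dotProduct, smul_mul_assoc, map_smul,
    smul_eq_mul]
  exact div_mul_cancel₀ x hs

/-! ### The pairing of encoded vectors -/

/-- The natural number with the given binary digits. -/
def bitsVal {c : ℕ} (b : Fin c → Bool) : ℕ := ∑ i, if b i then 2 ^ (i : ℕ) else 0

theorem bitsVal_testBit (c x : ℕ) : bitsVal (fun i : Fin c => x.testBit i) = x % 2 ^ c := by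
  induction c with
  | zero => simp [bitsVal, Nat.mod_one]
  | succ c ih =>
    rw [bitsVal, Fin.sum_univ_castSucc]
    rw [bitsVal] at ih
    simp only [Fin.val_castSucc, Fin.val_last]
    rw [ih, Nat.mod_pow_succ, Nat.testBit_eq_decide_div_mod_eq]
    rcases Nat.mod_two_eq_zero_or_one (x / 2 ^ c) with h | h <;> simp [h]

theorem bitsVal_lt {c : ℕ} (b : Fin c → Bool) : bitsVal b < 2 ^ c := by
  induction c with
  | zero => simp [bitsVal]
  | succ c ih =>
    have := ih fun i => b i.castSucc
    rw [bitsVal, Fin.sum_univ_castSucc]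
    rw [bitsVal] at this
    simp only [Fin.val_castSucc, Fin.val_last, pow_succ] at *
    split_ifs <;> omega

/-- The number encoded by the `j`-th coefficient of the `i`-th entry. -/
def digit {k : ℕ} (y : VecQubits q n k → Bool) (i : Fin k) (j : Fin n) : ℕ :=
  bitsVal fun b => y (i, j, b)

theorem digit_encVec [NeZero q] {k : ℕ} (v : Fin k → Rq q n) (i : Fin k) (j : Fin n) :
    digit (encVec v) i j = ((v i).coeff j).val := by
  rw [digit]
  simp only [encVec]
  rw [bitsVal_testBit, Nat.mod_eq_of_lt]
  exact (ZMod.val_lt _).trans_le (Nat.le_pow_clog one_lt_two q)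

theorem encVec_injective [NeZero q] [Nontrivial (ZMod q)] {k : ℕ} :
    Function.Injective (encVec : (Fin k → Rq q n) → VecQubits q n k → Bool) := by
  intro v v' h
  funext i
  rw [(v i).eq_sum_coeff, (v' i).eq_sum_coeff]
  refine Finset.sum_congr rfl fun j _ => ?_
  congr 1
  apply ZMod.val_injective
  rw [← digit_encVec, ← digit_encVec, h]

/-- An integer that represents the constant coefficient of the scalar product of two encoded
vectors. -/
def pairing {k : ℕ} (t y : VecQubits q n k → Bool) : ℤ :=
  ∑ i, ∑ j, ∑ j', negacyclicSign j j' * digit t i j * digit y i j'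

theorem pairing_encVec [NeZero q] [Nontrivial (ZMod q)] {k : ℕ} (t y : Fin k → Rq q n) :
    ((pairing (encVec t) (encVec y) : ℤ) : ZMod q) = Rq.constCoeff (t ⬝ᵥ y) := by
  rw [pairing, dotProduct, map_sum]
  push_cast
  refine Finset.sum_congr rfl fun i _ => ?_
  rw [Rq.constCoeff_mul]
  simp [digit_encVec]

theorem abs_sum_sign_mul_le {k : ℕ} {B : ℤ} (hB : 0 ≤ B) (f : Fin k → Fin n → Fin n → ℤ)
    (hf : ∀ i j j', |f i j j'| ≤ B) :
    |∑ i, ∑ j, ∑ j', negacyclicSign j j' * f i j j'| ≤ k * n * B := by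
  have h1 : ∀ (i : Fin k) (j : Fin n), |∑ j', negacyclicSign j j' * f i j j'| ≤ B := by
    intro i j
    calc |∑ j', negacyclicSign j j' * f i j j'| ≤ ∑ j', |negacyclicSign j j' * f i j j'| :=
          Finset.abs_sum_le_sum_abs _ _
      _ ≤ ∑ j', |negacyclicSign j j'| * B := by
          refine Finset.sum_le_sum fun j' _ => ?_
          rw [abs_mul]
          exact mul_le_mul_of_nonneg_left (hf i j j') (abs_nonneg _)
      _ = (∑ j', |negacyclicSign j j'|) * B := by rw [Finset.sum_mul]
      _ ≤ 1 * B := mul_le_mul_of_nonneg_right (sum_abs_negacyclicSign_le j) hB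
      _ = B := one_mul B
  calc |∑ i, ∑ j, ∑ j', negacyclicSign j j' * f i j j'|
      ≤ ∑ i : Fin k, ∑ j : Fin n, |∑ j', negacyclicSign j j' * f i j j'| :=
        (Finset.abs_sum_le_sum_abs _ _).trans
          (Finset.sum_le_sum fun i _ => Finset.abs_sum_le_sum_abs _ _)
    _ ≤ ∑ i : Fin k, ∑ j : Fin n, B :=
        Finset.sum_le_sum fun i _ => Finset.sum_le_sum fun j _ => h1 i j
    _ = k * n * B := by simp [mul_assoc]

theorem abs_pairing_le {k : ℕ} (t y : VecQubits q n k → Bool) :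
    |pairing t y| ≤ k * n * (2 ^ Nat.clog 2 q * 2 ^ Nat.clog 2 q) := by
  have : pairing t y = ∑ i, ∑ j, ∑ j', negacyclicSign j j' *
      ((digit t i j : ℤ) * digit y i j') := by
    simp only [pairing, mul_assoc]
  rw [this]
  refine abs_sum_sign_mul_le (by positivity) _ fun i j j' => ?_
  have h : ∀ (z : VecQubits q n k → Bool) i j, (digit z i j : ℤ) ≤ 2 ^ Nat.clog 2 q := by
    intro z i j
    exact_mod_cast (bitsVal_lt fun b => z (i, j, b)).le
  rw [abs_of_nonneg (by positivity)]
  exact mul_le_mul (h _ _ _) (h _ _ _) (by positivity) (by positivity)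

theorem abs_valMinAbs_coeff_le [NeZero q] {k B : ℕ} {v : Fin k → Rq q n} (hv : vecNorm v ≤ B)
    (i : Fin k) (j : Fin n) : |((v i).coeff j).valMinAbs| ≤ (B : ℤ) := by
  rw [Int.abs_eq_natAbs]
  have h1 : ((v i).coeff j).valMinAbs.natAbs ≤ (v i).norm :=
    Finset.le_sup (f := fun j : Fin n => ((v i).coeff j).valMinAbs.natAbs) (Finset.mem_univ j)
  have h2 : (v i).norm ≤ vecNorm v := Finset.le_sup (f := fun i => (v i).norm) (Finset.mem_univ i)
  exact_mod_cast (h1.trans h2).trans hv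

theorem vecNorm_le_of_mem_shortVecs [NeZero q] {k η : ℕ} {s : Fin k → Rq q n}
    (hs : s ∈ shortVecs q n k η) : vecNorm s ≤ η := by
  refine Finset.sup_le fun i _ => ?_
  have := Fintype.mem_piFinset.1 hs i
  simpa [shortSet] using this

/-- For an `MLWE` sample, the pairings with two short vectors with the same image differ by a small
integer modulo `q`. -/
theorem exists_small_pairing_sub [NeZero q] [Nontrivial (ZMod q)] {m l γ η : ℕ}
    (A : Matrix (Fin l) (Fin m) (Rq q n)) {s₁ : Fin m → Rq q n} {s₂ : Fin l → Rq q n}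
    (hs₂ : vecNorm s₂ ≤ η) {y y' : Fin l → Rq q n} (hy : vecNorm y ≤ γ) (hy' : vecNorm y' ≤ γ)
    (hA : A.transpose.mulVec y = A.transpose.mulVec y') :
    ∃ d : ℤ, |d| ≤ 2 * γ * η * n * l ∧
      (q : ℤ) ∣ pairing (encVec (A.mulVec s₁ + s₂)) (encVec y) -
        pairing (encVec (A.mulVec s₁ + s₂)) (encVec y') - d := by
  refine ⟨∑ i, ∑ j, ∑ j', negacyclicSign j j' * (((s₂ i).coeff j).valMinAbs *
    (((y i).coeff j').valMinAbs - ((y' i).coeff j').valMinAbs)), ?_, ?_⟩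
  · have := abs_sum_sign_mul_le (n := n) (k := l) (B := (η : ℤ) * (γ + γ)) (by positivity)
      (fun i j j' => ((s₂ i).coeff j).valMinAbs *
        (((y i).coeff j').valMinAbs - ((y' i).coeff j').valMinAbs)) ?_
    · refine this.trans (le_of_eq ?_)
      ring
    · intro i j j'
      rw [abs_mul]
      exact mul_le_mul (abs_valMinAbs_coeff_le hs₂ i j)
        ((abs_sub _ _).trans (add_le_add (abs_valMinAbs_coeff_le hy i j')
          (abs_valMinAbs_coeff_le hy' i j'))) (abs_nonneg _) (by positivity)
  · rw [← ZMod.intCast_zmod_eq_zero_iff_dvd]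
    -- The `s₁` part depends on `y` only through its image under the transpose of `A`, so it is the
    -- same for `y` and `y'`. Only the short vector `s₂` against the short difference survives.
    have hdot : ∀ y : Fin l → Rq q n, (A.mulVec s₁ + s₂) ⬝ᵥ y =
        s₁ ⬝ᵥ A.transpose.mulVec y + s₂ ⬝ᵥ y := by
      intro y
      rw [add_dotProduct, Matrix.dotProduct_transpose_mulVec, dotProduct_comm y]
    push_cast
    rw [pairing_encVec, pairing_encVec, hdot, hdot, hA, map_add, map_add]
    simp only [dotProduct, map_sum, Rq.constCoeff_mul, mul_sub,
      Finset.sum_sub_distrib, mul_assoc]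
    ring

end Ring


/-! ### The top bit of a randomly shifted residue -/

/-- The probability that a random half circle in `ℤ / N` (for even `N`) does not separate two points
at distance `x`. -/
def triangle (N : ℕ) (x : ZMod N) : ℝ := 1 - 2 * (x.valMinAbs.natAbs : ℝ) / N

theorem sum_zmod_eq_sum_range (N : ℕ) [NeZero N] (F : ℕ → ℝ) :
    ∑ x : ZMod N, F x.val = ∑ v ∈ Finset.range N, F v := by
  refine Finset.sum_bij (fun x _ => x.val) (fun x _ => Finset.mem_range.2 (ZMod.val_lt x))
    (fun x _ y _ h => ZMod.val_injective N h) (fun v hv => ⟨(v : ZMod N), Finset.mem_univ _, ?_⟩)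
    (fun x _ => rfl)
  exact ZMod.val_cast_of_lt (Finset.mem_range.1 hv)

/-- The indicator of the second half of `ℤ / 2m`. -/
def upperHalf (m : ℕ) (x : ZMod (2 * m)) : Bool := decide (m ≤ x.val)

theorem sum_upperHalf_ne_natCast (m k : ℕ) [NeZero (2 * m)] (hk : k ≤ m) :
    (∑ x : ZMod (2 * m), if upperHalf m x = upperHalf m (x + k) then (0 : ℝ) else 1) = 2 * k := by
  have hm : 0 < 2 * m := Nat.pos_of_ne_zero (NeZero.ne _)
  have h1 : ∀ x : ZMod (2 * m),
      (if upperHalf m x = upperHalf m (x + k) then (0 : ℝ) else 1) =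
      (fun v : ℕ => if (m ≤ v ↔ m ≤ (v + k) % (2 * m)) then (0 : ℝ) else 1) x.val := by
    intro x
    have : (x + (k : ZMod (2 * m))).val = (x.val + k) % (2 * m) := by
      rw [ZMod.val_add, ZMod.val_natCast, Nat.add_mod_mod]
    simp only [upperHalf, this, decide_eq_decide]
  rw [Finset.sum_congr rfl fun x _ => h1 x, sum_zmod_eq_sum_range (2 * m)
    (fun v : ℕ => if (m ≤ v ↔ m ≤ (v + k) % (2 * m)) then (0 : ℝ) else 1)]
  have h2 : ∀ v : ℕ, (if (m ≤ v ↔ m ≤ (v + k) % (2 * m)) then (0 : ℝ) else 1) =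
      if ¬ (m ≤ v ↔ m ≤ (v + k) % (2 * m)) then 1 else 0 := by
    intro v
    split_ifs <;> simp_all
  simp_rw [h2]
  rw [Finset.sum_boole]
  -- A shift by `k ≤ m` changes the half exactly when it crosses `m` or wraps around at `2 * m`;
  -- each boundary is crossed by `k` residues.
  have h3 : (Finset.range (2 * m)).filter (fun v => ¬ (m ≤ v ↔ m ≤ (v + k) % (2 * m))) =
      Finset.Ico (m - k) m ∪ Finset.Ico (2 * m - k) (2 * m) := by
    ext v
    simp only [Finset.mem_filter, Finset.mem_range, Finset.mem_union, Finset.mem_Ico]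
    by_cases hv : v < 2 * m
    · have : (v + k) % (2 * m) = if v + k < 2 * m then v + k else v + k - 2 * m := by
        split_ifs with h
        · exact Nat.mod_eq_of_lt h
        · rw [Nat.mod_eq_sub_mod (by omega), Nat.mod_eq_of_lt (by omega)]
      rw [this]
      split_ifs <;> omega
    · omega
  rw [h3, Finset.card_union_of_disjoint, Nat.card_Ico, Nat.card_Ico]
  · have : m - (m - k) + (2 * m - (2 * m - k)) = 2 * k := by omega
    rw [this]
    push_cast
    ring
  · rw [Finset.disjoint_left]
    intro v h h'
    rw [Finset.mem_Ico] at h h'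
    omega

theorem sum_upperHalf_ne (m : ℕ) [NeZero (2 * m)] (d : ZMod (2 * m)) :
    (∑ x : ZMod (2 * m), if upperHalf m x = upperHalf m (x + d) then (0 : ℝ) else 1) =
      2 * d.valMinAbs.natAbs := by
  have hle : d.valMinAbs.natAbs ≤ m := by
    have := ZMod.natAbs_valMinAbs_le d
    omega
  rcases Int.natAbs_eq d.valMinAbs with h | h
  · have hd : d = ((d.valMinAbs.natAbs : ℕ) : ZMod (2 * m)) := by
      have := ZMod.coe_valMinAbs d
      rw [h, Int.cast_natCast] at this
      exact this.symm
    conv_lhs => rw [hd]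
    exact sum_upperHalf_ne_natCast m _ hle
  · have hd : -d = ((d.valMinAbs.natAbs : ℕ) : ZMod (2 * m)) := by
      have := ZMod.coe_valMinAbs d
      rw [h, Int.cast_neg, Int.cast_natCast] at this
      exact neg_eq_iff_eq_neg.2 this.symm
    rw [← sum_upperHalf_ne_natCast m _ hle, ← hd]
    refine Fintype.sum_equiv (Equiv.addRight d) _ _ fun x => ?_
    simp [eq_comm]

/-- Translating by `u'` leaves only the difference `u - u'`; the random half circle separates the
points for a number of shifts equal to twice their cyclic distance. -/
theorem expect_upperHalf_eq (m : ℕ) [NeZero (2 * m)] (u u' : ZMod (2 * m)) :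
    (𝔼 x : ZMod (2 * m), if upperHalf m (u + x) = upperHalf m (u' + x) then (1 : ℝ) else 0) =
      triangle (2 * m) (u - u') := by
  have hN : ((2 * m : ℕ) : ℝ) ≠ 0 := Nat.cast_ne_zero.2 (NeZero.ne _)
  have h1 : (∑ x : ZMod (2 * m), if upperHalf m (u + x) = upperHalf m (u' + x) then (1 : ℝ) else 0) =
      ∑ x : ZMod (2 * m), (1 - if upperHalf m x = upperHalf m (x + (u - u')) then (0 : ℝ) else 1) := by
    refine Fintype.sum_equiv (Equiv.addLeft u') _ _ fun x => ?_
    have : u' + x + (u - u') = u + x := by ring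
    simp only [Equiv.coe_addLeft, this, eq_comm (a := upperHalf m (u' + x))]
    split_ifs <;> simp
  rw [Finset.expect_eq_sum_div_card, h1, Finset.sum_sub_distrib, sum_upperHalf_ne, triangle]
  simp only [Finset.sum_const, Finset.card_univ, ZMod.card, nsmul_eq_mul, mul_one]
  field_simp

theorem testBit_top (K v : ℕ) :
    v.testBit K = upperHalf (2 ^ K) (v : ZMod (2 * 2 ^ K)) := by
  rw [upperHalf, ZMod.val_natCast, Nat.testBit_eq_decide_div_mod_eq, decide_eq_decide,
    ← pow_succ', Nat.mod_pow_succ]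
  have : v % 2 ^ K < 2 ^ K := Nat.mod_lt _ (by positivity)
  rcases Nat.mod_two_eq_zero_or_one (v / 2 ^ K) with h | h
  · simpa [h] using this
  · simp [h]

theorem expect_bits (K : ℕ) (F : ZMod (2 * 2 ^ K) → ℝ) :
    𝔼 r : Fin (K + 1) → Bool, F (bitsVal r : ℕ) = 𝔼 x, F x := by
  have hs : Function.Surjective
      (fun r : Fin (K + 1) → Bool => ((bitsVal r : ℕ) : ZMod (2 * 2 ^ K))) := by
    intro x
    refine ⟨fun i => x.val.testBit i, ?_⟩
    have h : x.val < 2 ^ (K + 1) := by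
      rw [pow_succ']
      exact ZMod.val_lt x
    simp only [bitsVal_testBit, Nat.mod_eq_of_lt h, ZMod.natCast_val, ZMod.cast_id', id]
  have hb := (Fintype.bijective_iff_surjective_and_card
    (fun r : Fin (K + 1) → Bool => ((bitsVal r : ℕ) : ZMod (2 * 2 ^ K)))).2
      ⟨hs, by simp [pow_succ', ZMod.card]⟩
  exact Fintype.expect_equiv (Equiv.ofBijective _ hb) _ _ fun r => rfl

/-- Two numbers are shifted by the same random number; how often do their top bits agree? -/
theorem expect_testBit_eq (K u u' : ℕ) :
    (𝔼 r : Fin (K + 1) → Bool,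
      if (u + bitsVal r).testBit K = (u' + bitsVal r).testBit K then (1 : ℝ) else 0) =
      triangle (2 * 2 ^ K) ((u : ZMod (2 * 2 ^ K)) - u') := by
  rw [← expect_upperHalf_eq, ← expect_bits]
  refine Finset.expect_congr rfl fun r _ => ?_
  rw [testBit_top, testBit_top, Nat.cast_add, Nat.cast_add]

/-! ### Scaling residues modulo `q` to residues modulo `Q` -/

theorem natAbs_valMinAbs_intCast_le (N : ℕ) [NeZero N] (a : ℤ) :
    ((a : ZMod N)).valMinAbs.natAbs ≤ a.natAbs :=
  ZMod.natAbs_min_of_le_div_two N _ a (by simp) (ZMod.natAbs_valMinAbs_le _)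

theorem natAbs_valMinAbs_intCast_eq (N : ℕ) [NeZero N] (a : ℤ) (ha : a.natAbs ≤ N / 2) :
    ((a : ZMod N)).valMinAbs.natAbs = a.natAbs :=
  le_antisymm (natAbs_valMinAbs_intCast_le N a)
    (ZMod.natAbs_min_of_le_div_two N a _ (by simp) ha)

theorem abs_natAbs_valMinAbs_sub_le (N : ℕ) [NeZero N] (a b : ℤ) :
    |(((a + b : ℤ) : ZMod N).valMinAbs.natAbs : ℝ) - ((a : ZMod N).valMinAbs.natAbs : ℝ)| ≤
      |(b : ℝ)| := by
  have h1 : ((a + b : ℤ) : ZMod N).valMinAbs.natAbs ≤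
      (a : ZMod N).valMinAbs.natAbs + b.natAbs := by
    refine (ZMod.natAbs_min_of_le_div_two N _ ((a : ZMod N).valMinAbs + b) (by simp)
      (ZMod.natAbs_valMinAbs_le _)).trans (Int.natAbs_add_le _ _)
  have h2 : (a : ZMod N).valMinAbs.natAbs ≤
      ((a + b : ℤ) : ZMod N).valMinAbs.natAbs + b.natAbs := by
    refine (ZMod.natAbs_min_of_le_div_two N _ (((a + b : ℤ) : ZMod N).valMinAbs - b) (by simp)
      (ZMod.natAbs_valMinAbs_le _)).trans (Int.natAbs_sub_le _ _)
  have h3 : |(b : ℝ)| = (b.natAbs : ℝ) := by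
    rw [← Int.cast_abs, Int.abs_eq_natAbs]
    simp
  rw [h3, abs_le]
  constructor
  · have : ((a : ZMod N).valMinAbs.natAbs : ℝ) ≤
      ((a + b : ℤ) : ZMod N).valMinAbs.natAbs + b.natAbs := by exact_mod_cast h2
    linarith
  · have : (((a + b : ℤ) : ZMod N).valMinAbs.natAbs : ℝ) ≤
      (a : ZMod N).valMinAbs.natAbs + b.natAbs := by exact_mod_cast h1
    linarith

/-- Multiplication by `⌊Q / q⌋` maps residues modulo `q` to residues modulo `Q`, up to a small
error. -/
theorem scale_intCast (Q q : ℕ) (D d M : ℤ) (hD : D = d + q * M) :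
    (((Q / q : ℕ) * D : ℤ) : ZMod Q) =
      (((Q / q : ℕ) * d + -((Q % q : ℕ) * M) : ℤ) : ZMod Q) := by
  have h : (q : ℤ) * (Q / q : ℕ) + (Q % q : ℕ) = Q := by exact_mod_cast Nat.div_add_mod Q q
  have h2 : ((Q / q : ℕ) : ℤ) * D = (Q / q : ℕ) * d + -((Q % q : ℕ) * M) + Q * M := by
    rw [hD, ← h]
    ring
  rw [h2]
  push_cast
  simp

/-- The rounding error comes from the remainder `Q % q < q` multiplied by the number of wraps `M`.
It is bounded independently of `Q`, so it becomes negligible relative to a large `Q`. -/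
theorem abs_mod_mul_le (Q q : ℕ) (hq : 0 < q) (D d M B : ℤ) (hD : D = d + q * M)
    (hB : |D| ≤ B) : |-(((Q % q : ℕ) : ℤ) * M)| ≤ B + |d| := by
  rw [abs_neg, abs_mul, Nat.abs_cast]
  have h1 : ((Q % q : ℕ) : ℤ) ≤ q := by exact_mod_cast (Nat.mod_lt Q hq).le
  calc ((Q % q : ℕ) : ℤ) * |M| ≤ q * |M| := mul_le_mul_of_nonneg_right h1 (abs_nonneg _)
    _ = |(q : ℤ) * M| := by rw [abs_mul, Nat.abs_cast]
    _ = |D - d| := by rw [hD]; ring_nf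
    _ ≤ |D| + |d| := abs_sub _ _
    _ ≤ B + |d| := by linarith

/-- Modulo `Q` the scaled difference is represented by some `δ` with `8 * |δ| ≤ Q`, rounding error
included. Then neither `δ` nor `4 * δ` wraps around, both triangles are linear in `|δ|`, and the
linear terms `3/4 * 2` and `3/16 * 8` cancel. The result is exact in spite of the rounding. -/
theorem triangle_scale_small (Q q : ℕ) [NeZero Q] (D d B : ℤ) (hd : 32 * |d| < q)
    (hdvd : (q : ℤ) ∣ D - d) (hB : |D| ≤ B) (hQ : 16 * (B + q) ≤ Q) :
    3 / 4 * triangle Q (((Q / q : ℕ) * D : ℤ) : ZMod Q) -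
      3 / 16 * triangle Q ((4 * ((Q / q : ℕ) * D) : ℤ) : ZMod Q) = 9 / 16 := by
  obtain ⟨M, hM⟩ := hdvd
  have hD : D = d + q * M := by linarith
  have hq : 0 < q := by
    have := abs_nonneg d
    omega
  have h1 := abs_mod_mul_le Q q hq D d M B hD hB
  set δ : ℤ := (Q / q : ℕ) * d + -((Q % q : ℕ) * M) with hδ
  have hc : ((Q / q : ℕ) : ℤ) * q ≤ Q := by exact_mod_cast Nat.div_mul_le_self Q q
  have h2 : 32 * |((Q / q : ℕ) : ℤ) * d| ≤ Q := by
    rw [abs_mul, Nat.abs_cast]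
    have : ((Q / q : ℕ) : ℤ) * (32 * |d|) ≤ (Q / q : ℕ) * q :=
      mul_le_mul_of_nonneg_left hd.le (by positivity)
    linarith
  have h3 : |δ| ≤ |((Q / q : ℕ) : ℤ) * d| + |-(((Q % q : ℕ) : ℤ) * M)| := abs_add_le _ _
  have hQ0 : 0 < Q := Nat.pos_of_ne_zero (NeZero.ne Q)
  have h4 : 8 * |δ| ≤ Q := by
    have := abs_nonneg d
    omega
  rw [Int.abs_eq_natAbs] at h4
  rw [scale_intCast Q q D d M hD, ← hδ]
  have h5 : ((4 * ((Q / q : ℕ) * D) : ℤ) : ZMod Q) = ((4 * δ : ℤ) : ZMod Q) := by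
    rw [Int.cast_mul, scale_intCast Q q D d M hD, ← hδ, ← Int.cast_mul]
  rw [h5, triangle, triangle, natAbs_valMinAbs_intCast_eq, natAbs_valMinAbs_intCast_eq,
    Int.natAbs_mul]
  · push_cast
    ring
  · have : Int.natAbs 4 = 4 := rfl
    omega
  · omega

/-- Two errors are added: the wrapping remainder, at most `B + q / 2`, and the replacement of `⌊Q /
q⌋` by `Q / q`, at most `q`. The slope of the triangle contributes the factor `2 / Q`. -/
theorem abs_triangle_scale_sub_le (Q q : ℕ) [NeZero Q] [NeZero q] (D B : ℤ) (hB : |D| ≤ B) :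
    |triangle Q (((Q / q : ℕ) * D : ℤ) : ZMod Q) - triangle q (D : ZMod q)| ≤
      (2 * B + 3 * q) / Q := by
  have hq : 0 < q := Nat.pos_of_ne_zero (NeZero.ne q)
  have hQ0 : 0 < Q := Nat.pos_of_ne_zero (NeZero.ne Q)
  have hqr : (0 : ℝ) < q := by exact_mod_cast hq
  have hQr : (0 : ℝ) < Q := by exact_mod_cast hQ0
  set d := (D : ZMod q).valMinAbs with hd
  have hdvd : (q : ℤ) ∣ D - d := by
    rw [← ZMod.intCast_zmod_eq_zero_iff_dvd]
    simp [hd]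
  obtain ⟨M, hM⟩ := hdvd
  have hD : D = d + q * M := by linarith
  have hdle : 2 * d.natAbs ≤ q := by
    have := ZMod.natAbs_valMinAbs_le (D : ZMod q)
    omega
  have hc : (Q / q) * q ≤ Q := Nat.div_mul_le_self Q q
  have h1 := abs_mod_mul_le Q q hq D d M B hD hB
  have h2 := abs_natAbs_valMinAbs_sub_le Q ((Q / q : ℕ) * d) (-((Q % q : ℕ) * M))
  rw [← scale_intCast Q q D d M hD] at h2
  have h3 : ((((Q / q : ℕ) * d : ℤ) : ZMod Q)).valMinAbs.natAbs = (Q / q) * d.natAbs := by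
    rw [natAbs_valMinAbs_intCast_eq, Int.natAbs_mul, Int.natAbs_natCast]
    rw [Int.natAbs_mul, Int.natAbs_natCast, Nat.le_div_iff_mul_le two_pos]
    calc Q / q * d.natAbs * 2 = Q / q * (2 * d.natAbs) := by ring
      _ ≤ Q / q * q := Nat.mul_le_mul_left _ hdle
      _ ≤ Q := hc
  rw [h3] at h2
  have h4 : |((-(((Q % q : ℕ) : ℤ) * M) : ℤ) : ℝ)| ≤ B + q / 2 := by
    rw [← Int.cast_abs]
    have : ((|-(((Q % q : ℕ) : ℤ) * M)| : ℤ) : ℝ) ≤ ((B + |d| : ℤ) : ℝ) := by exact_mod_cast h1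
    refine this.trans ?_
    have h5 : (2 : ℝ) * (|d| : ℤ) ≤ q := by
      rw [Int.abs_eq_natAbs]
      exact_mod_cast hdle
    push_cast at h5 ⊢
    linarith
  have hQq : (Q : ℝ) - q ≤ ((Q / q : ℕ) : ℝ) * q ∧ ((Q / q : ℕ) : ℝ) * q ≤ Q := by
    constructor
    · have := Nat.div_add_mod Q q
      have h6 : Q % q < q := Nat.mod_lt _ hq
      have h7 : Q ≤ (Q / q) * q + q := by
        rw [Nat.mul_comm]
        omega
      have : (Q : ℝ) ≤ ((Q / q : ℕ) : ℝ) * q + q := by exact_mod_cast h7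
      linarith
    · exact_mod_cast hc
  set V : ℝ := (((((Q / q : ℕ) * D : ℤ) : ZMod Q)).valMinAbs.natAbs : ℝ) with hV
  have hn : (2 : ℝ) * (d.natAbs : ℝ) ≤ q := by exact_mod_cast hdle
  have hn0 : (0 : ℝ) ≤ d.natAbs := by positivity
  push_cast at h2
  have h8 : |V - ((Q / q : ℕ) : ℝ) * (d.natAbs : ℝ)| ≤ B + q / 2 := h2.trans (by exact_mod_cast h4)
  have h9 : |((Q / q : ℕ) : ℝ) * (d.natAbs : ℝ) - Q * d.natAbs / q| ≤ q := by
    have : ((Q / q : ℕ) : ℝ) * (d.natAbs : ℝ) - Q * d.natAbs / q =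
        -((Q - ((Q / q : ℕ) : ℝ) * q) * (d.natAbs / q)) := by
      field_simp
      ring
    rw [this, abs_neg, abs_of_nonneg (mul_nonneg (by linarith [hQq.2]) (by positivity))]
    calc (Q - ((Q / q : ℕ) : ℝ) * q) * (d.natAbs / q) ≤ q * (d.natAbs / q) :=
          mul_le_mul_of_nonneg_right (by linarith [hQq.1]) (by positivity)
      _ = d.natAbs := by field_simp
      _ ≤ q := by linarith
  have h10 : |V - Q * d.natAbs / q| ≤ B + 3 / 2 * q := by
    have := abs_sub_le V (((Q / q : ℕ) : ℝ) * (d.natAbs : ℝ)) (Q * d.natAbs / q)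
    linarith
  have h11 : triangle Q (((Q / q : ℕ) * D : ℤ) : ZMod Q) - triangle q (D : ZMod q) =
      -(2 / Q * (V - Q * d.natAbs / q)) := by
    rw [triangle, triangle, ← hV, ← hd]
    field_simp
    ring
  rw [h11, abs_neg, abs_mul, abs_of_pos (by positivity)]
  calc 2 / (Q : ℝ) * |V - Q * d.natAbs / q| ≤ 2 / Q * (B + 3 / 2 * q) :=
        mul_le_mul_of_nonneg_left h10 (by positivity)
    _ = (2 * B + 3 * q) / Q := by ring

/-- The average of `triangle` over all residues is about one half. -/
theorem expect_triangle_le (q : ℕ) [NeZero q] (hq : 16 ≤ q) (hodd : q % 2 = 1) :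
    𝔼 x : ZMod q, triangle q x ≤ 17 / 32 := by
  have hqr : (16 : ℝ) ≤ q := by exact_mod_cast hq
  have hq0 : (0 : ℝ) < q := by linarith
  obtain ⟨k, hk⟩ : ∃ k, q = 2 * k + 1 := ⟨q / 2, by omega⟩
  set s := ∑ x : ZMod q, (x.valMinAbs.natAbs : ℝ) with hs
  have hshift : ∑ x : ZMod q, ((x + (k : ℕ)).valMinAbs.natAbs : ℝ) = s :=
    Fintype.sum_equiv (Equiv.addRight ((k : ℕ) : ZMod q)) _ _ fun x => rfl
  -- The points `x` and `x + k` are at cyclic distance `k = (q - 1) / 2`, so their distances from 0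
  -- add up to at least `k`, and the mean distance is at least `k / 2`.
  have hpt : ∀ x : ZMod q, (k : ℝ) ≤ x.valMinAbs.natAbs + (x + (k : ℕ)).valMinAbs.natAbs := by
    intro x
    have h1 := natAbs_valMinAbs_intCast_eq q (k : ℤ) (by simp; omega)
    have h2 : (k : ℤ).natAbs ≤ ((x + (k : ℕ)).valMinAbs - x.valMinAbs).natAbs := by
      rw [← h1]
      exact ZMod.natAbs_min_of_le_div_two q _ _ (by simp) (ZMod.natAbs_valMinAbs_le _)
    have h3 := h2.trans (Int.natAbs_sub_le _ _)
    rw [Int.natAbs_natCast] at h3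
    have : (k : ℝ) ≤ (x + (k : ℕ)).valMinAbs.natAbs + x.valMinAbs.natAbs := by exact_mod_cast h3
    linarith
  have hsum : (q : ℝ) * k ≤ 2 * s := by
    have := Finset.sum_le_sum fun x (_ : x ∈ (Finset.univ : Finset (ZMod q))) => hpt x
    rw [Finset.sum_add_distrib, hshift, Finset.sum_const, Finset.card_univ, ZMod.card,
      nsmul_eq_mul] at this
    linarith
  have hexp : 𝔼 x : ZMod q, triangle q x = 1 - 2 * s / q / q := by
    rw [Finset.expect_eq_sum_div_card, Finset.card_univ, ZMod.card]
    simp only [triangle]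
    rw [Finset.sum_sub_distrib, ← Finset.sum_div, ← Finset.mul_sum, ← hs]
    simp only [Finset.sum_const, Finset.card_univ, ZMod.card, nsmul_eq_mul, mul_one]
    field_simp
  rw [hexp]
  have hkr : (q : ℝ) = 2 * k + 1 := by exact_mod_cast hk
  -- The left-hand quantity to beat is `k / q = (1 - 1 / q) / 2`, which is at least 15/32 precisely
  -- when `q ≥ 16`.
  have : 15 / 32 ≤ 2 * s / q / q := by
    rw [le_div_iff₀ hq0, le_div_iff₀ hq0]
    nlinarith
  linarith


/-! ### The partial measurement used by the reduction -/

section Measurement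
variable {q n l : ℕ}

/-- A natural number congruent to `C` times the pairing of `t` and `y` modulo `2 ^ (K + 1)`. -/
def scaledPairing (C K : ℕ) (t y : VecQubits q n l → Bool) : ℕ :=
  ∑ p : Fin l × Fin n × Fin n × Fin (Nat.clog 2 q) × Fin (Nat.clog 2 q),
    if t (p.1, p.2.1, p.2.2.2.1) && y (p.1, p.2.2.1, p.2.2.2.2) then
      ((C * (negacyclicSign p.2.1 p.2.2.1 * 2 ^ (p.2.2.2.1 : ℕ) * 2 ^ (p.2.2.2.2 : ℕ)) : ℤ) %
        ((2 * 2 ^ K : ℕ) : ℤ)).toNat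
    else 0

/-- The signed coefficients are replaced by nonnegative residues modulo `2 ^ (K + 1)`. The pairing
becomes a sum of constants switched by products of bits, and no subtraction or multiplication
circuit is needed. -/
theorem scaledPairing_cast (C K : ℕ) (t y : VecQubits q n l → Bool) :
    ((scaledPairing C K t y : ℕ) : ZMod (2 * 2 ^ K)) = ((C * pairing t y : ℤ) : ZMod (2 * 2 ^ K)) := by
  have hQ : ((2 * 2 ^ K : ℕ) : ℤ) ≠ 0 := by positivity
  have h1 : ∀ x : ℤ, ((((x % ((2 * 2 ^ K : ℕ) : ℤ)).toNat : ℕ) : ZMod (2 * 2 ^ K))) = (x : ℤ) := by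
    intro x
    rw [← Int.cast_natCast, Int.toNat_of_nonneg (Int.emod_nonneg _ hQ), ZMod.intCast_mod]
  rw [scaledPairing, Nat.cast_sum]
  simp only [Nat.cast_ite, h1, Nat.cast_zero]
  rw [pairing, Finset.mul_sum, Int.cast_sum, Fintype.sum_prod_type]
  refine Finset.sum_congr rfl fun i _ => ?_
  rw [Finset.mul_sum, Int.cast_sum, Fintype.sum_prod_type]
  refine Finset.sum_congr rfl fun j _ => ?_
  rw [Finset.mul_sum, Int.cast_sum, Fintype.sum_prod_type]
  refine Finset.sum_congr rfl fun j' _ => ?_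
  rw [Fintype.sum_prod_type, digit, digit, bitsVal, bitsVal]
  push_cast
  rw [mul_assoc (negacyclicSign j j' : ZMod (2 * 2 ^ K)), Finset.sum_mul_sum, Finset.mul_sum,
    Finset.mul_sum]
  refine Finset.sum_congr rfl fun a _ => ?_
  rw [Finset.mul_sum, Finset.mul_sum]
  refine Finset.sum_congr rfl fun b _ => ?_
  cases t (i, j, a) <;> cases y (i, j', b) <;> simp [mul_assoc]

/-- The selection of the first measurement, with probability `3/4`. -/
def selectFine (s : Fin 4 → Bool) : Bool := xor true (s 0 && s 1)

/-- The selection of the second measurement, with probability `3/16`. -/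
def selectCoarse (s : Fin 4 → Bool) : Bool :=
  (s 0 && s 1) && xor (xor (s 2) (s 3)) (s 2 && s 3)

/-- The bit that is measured. -/
def measuredBit (C K : ℕ) (t y : VecQubits q n l → Bool) (r : Fin (K + 1) ⊕ Fin 4 → Bool) : Bool :=
  xor
    (selectFine (fun i => r (Sum.inr i)) &&
      (scaledPairing C K t y + bitsVal fun i => r (Sum.inl i)).testBit K)
    (selectCoarse (fun i => r (Sum.inr i)) &&
      (scaledPairing (4 * C) K t y + bitsVal fun i => r (Sum.inl i)).testBit K)

theorem expect_select (F : Bool → Bool → ℝ) :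
    𝔼 s : Fin 4 → Bool, F (selectFine s) (selectCoarse s) =
      3 / 4 * F true false + 3 / 16 * F false true + 1 / 16 * F false false := by
  -- Of the 16 coin patterns, 12 select the fine measurement, 3 the coarse one, and one selects
  -- neither.
  have h : ∀ b : Bool × Bool, ((Finset.univ : Finset (Fin 4 → Bool)).filter
      fun s => (selectFine s, selectCoarse s) = b).card =
        if b = (true, false) then 12 else if b = (false, true) then 3 else
          if b = (false, false) then 1 else 0 := by
    decide
  rw [Finset.expect_eq_sum_div_card,
    ← Finset.sum_fiberwise (Finset.univ : Finset (Fin 4 → Bool))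
      (fun s => (selectFine s, selectCoarse s))]
  have h2 : ∀ b : Bool × Bool, (∑ s ∈ (Finset.univ : Finset (Fin 4 → Bool)).filter
      fun s => (selectFine s, selectCoarse s) = b, F (selectFine s) (selectCoarse s)) =
      ((Finset.univ : Finset (Fin 4 → Bool)).filter
        fun s => (selectFine s, selectCoarse s) = b).card * F b.1 b.2 := by
    intro b
    rw [← nsmul_eq_mul, ← Finset.sum_const]
    refine Finset.sum_congr rfl fun s hs => ?_
    rw [← (Finset.mem_filter.1 hs).2]
  rw [Finset.sum_congr rfl fun b _ => h2 b]
  simp only [h, Fintype.sum_prod_type, Fintype.sum_bool, Finset.card_univ, Fintype.card_fun,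
    Fintype.card_bool, Fintype.card_fin]
  norm_num
  ring

/-- The number of lines of a program for `measuredBit`. -/
def programLength (n l c K : ℕ) : ℕ :=
  2 + (2 * (l * (n * c)) + (K + 1 + 4)) + l * (n * (n * (c * c))) +
    2 * ((l * (n * (n * (c * c))) + (K + 1)) * (5 * (K + 1) + 1)) + 9

theorem computable_measuredBit {κ : Type} (C K : ℕ) (tI yI : VecQubits q n l → κ)
    (rI : Fin (K + 1) ⊕ Fin 4 → κ) :
    Computable ∅ (programLength n l (Nat.clog 2 q) K)
      {fun u => measuredBit C K (fun k => u (tI k)) (fun k => u (yI k)) (fun k => u (rI k)),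
        fun u => selectCoarse fun i => u (rI (Sum.inr i))} := by
  classical
  set J := Fin l × Fin n × Fin n × Fin (Nat.clog 2 q) × Fin (Nat.clog 2 q) with hJ
  let inp : (VecQubits q n l ⊕ VecQubits q n l) ⊕ (Fin (K + 1) ⊕ Fin 4) → κ :=
    Sum.elim (Sum.elim tI yI) rI
  set S₁ : Set ((κ → Bool) → Bool) := ⋃ b ∈ (Finset.univ : Finset Bool), {fun _ => b} with hS₁
  have h1 : Computable ∅ 2 S₁ :=
    (Computable.biUnion Finset.univ ∅ _ fun b _ => Computable.const _ b).mono subset_rfl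
      subset_rfl (by simp)
  set S₂ : Set ((κ → Bool) → Bool) := ⋃ k ∈ (Finset.univ : Finset
    ((VecQubits q n l ⊕ VecQubits q n l) ⊕ (Fin (K + 1) ⊕ Fin 4))), {fun u => u (inp k)} with hS₂
  have h2 := h1.trans ((Computable.biUnion Finset.univ (∅ ∪ S₁)
    (fun k : (VecQubits q n l ⊕ VecQubits q n l) ⊕ (Fin (K + 1) ⊕ Fin 4) =>
      {fun u => u (inp k)}) fun k _ => Computable.input _ _))
  rw [← hS₂] at h2
  have hb : ∀ b, (fun _ => b) ∈ S₁ := fun b => by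
    simp only [hS₁, Set.mem_iUnion]
    exact ⟨b, Finset.mem_univ b, rfl⟩
  have hin : ∀ k, (fun u : κ → Bool => u (inp k)) ∈ S₂ := fun k => by
    simp only [hS₂, Set.mem_iUnion]
    exact ⟨k, Finset.mem_univ k, rfl⟩
  set prod : J → (κ → Bool) → Bool := fun p u =>
    u (tI (p.1, p.2.1, p.2.2.2.1)) && u (yI (p.1, p.2.2.1, p.2.2.2.2)) with hprod
  set S₃ : Set ((κ → Bool) → Bool) := ⋃ p ∈ (Finset.univ : Finset J), {prod p} with hS₃
  have h3 := h2.trans (Computable.biUnion (Finset.univ : Finset J) (∅ ∪ (S₁ ∪ S₂))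
    (fun p => {prod p}) fun p _ => Computable.and
      (Or.inr (Or.inr (hin (Sum.inl (Sum.inl (p.1, p.2.1, p.2.2.2.1))))))
      (Or.inr (Or.inr (hin (Sum.inl (Sum.inr (p.1, p.2.2.1, p.2.2.2.2)))))))
  rw [← hS₃] at h3
  have hp : ∀ p, prod p ∈ S₃ := fun p => by
    simp only [hS₃, Set.mem_iUnion]
    exact ⟨p, Finset.mem_univ p, rfl⟩
  set f : J ⊕ Fin (K + 1) → (κ → Bool) → Bool :=
    Sum.elim prod fun i u => u (rI (Sum.inl i)) with hf
  set V : ℕ → (κ → Bool) → ℕ := fun C u =>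
    scaledPairing C K (fun k => u (tI k)) (fun k => u (yI k)) +
      bitsVal fun i => u (rI (Sum.inl i)) with hV
  have hword : ∀ (C : ℕ) (S : Set ((κ → Bool) → Bool)), S₁ ⊆ S → S₂ ⊆ S → S₃ ⊆ S →
      Computable S ((Fintype.card J + (K + 1)) * (5 * (K + 1) + 1)) (word (K + 1) (V C)) := by
    intro C S hS1 hS2 hS3
    have := Computable.sum (S := S) (Finset.univ : Finset (J ⊕ Fin (K + 1))) (K + 1)
      (Sum.elim (fun p => ((C * (negacyclicSign p.2.1 p.2.2.1 * 2 ^ (p.2.2.2.1 : ℕ) *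
        2 ^ (p.2.2.2.2 : ℕ)) : ℤ) % ((2 * 2 ^ K : ℕ) : ℤ)).toNat) fun i => 2 ^ (i : ℕ)) f
      (by
        rintro (p | i) _
        · exact hS3 (hp p)
        · exact hS2 (hin (Sum.inr (Sum.inl i))))
      (hS1 (hb false))
    refine this.mono subset_rfl (subset_of_eq ?_) (le_of_eq ?_)
    · congr 1
      funext u
      rw [Fintype.sum_sum_type]
      rfl
    · rw [Finset.card_univ, Fintype.card_sum, Fintype.card_fin]
  have h4 := h3.trans (hword C _
    (fun f hf => Or.inr (Or.inl (Or.inl hf))) (fun f hf => Or.inr (Or.inl (Or.inr hf)))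
    (fun f hf => Or.inr (Or.inr hf)))
  have h5 := h4.trans (hword (4 * C) _
    (fun f hf => Or.inr (Or.inl (Or.inl (Or.inl hf))))
    (fun f hf => Or.inr (Or.inl (Or.inl (Or.inr hf))))
    (fun f hf => Or.inr (Or.inl (Or.inr hf))))
  set B : Set ((κ → Bool) → Bool) :=
    ((S₁ ∪ S₂ ∪ S₃) ∪ word (K + 1) (V C)) ∪ word (K + 1) (V (4 * C)) with hB
  have hs : ∀ i : Fin 4, (fun u : κ → Bool => u (rI (Sum.inr i))) ∈ B := fun i =>
    Or.inl (Or.inl (Or.inl (Or.inr (hin (Sum.inr (Sum.inr i))))))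
  have htrue : (fun _ : κ → Bool => true) ∈ B := Or.inl (Or.inl (Or.inl (Or.inl (hb true))))
  have hv1 : (fun u : κ → Bool => (V C u).testBit K) ∈ B :=
    Or.inl (Or.inr ⟨K, Nat.lt_succ_self K, rfl⟩)
  have hv2 : (fun u : κ → Bool => (V (4 * C) u).testBit K) ∈ B :=
    Or.inr ⟨K, Nat.lt_succ_self K, rfl⟩
  clear_value B
  set s : Fin 4 → (κ → Bool) → Bool := fun i u => u (rI (Sum.inr i)) with hsdef
  -- The last nine lines are `s 0 ∧ s 1`, its negation, three lines for `s 2 ∨ s 3` as `s 2 ⊕ s 3 ⊕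
  -- s 2 s 3`, the coarse selector, the two gated top bits, and their exclusive or.
  have k1 := h5.trans (Computable.and (Or.inr (hs 0)) (Or.inr (hs 1)))
  have k2 := k1.trans (Computable.xor (Or.inr (Or.inl htrue)) (Or.inr (Or.inr rfl)))
  have k3 := k2.trans (Computable.xor (Or.inr (Or.inl (Or.inl (hs 2))))
    (Or.inr (Or.inl (Or.inl (hs 3)))))
  have k4 := k3.trans (Computable.and (Or.inr (Or.inl (Or.inl (Or.inl (hs 2)))))
    (Or.inr (Or.inl (Or.inl (Or.inl (hs 3))))))
  have k5 := k4.trans (Computable.xor (Or.inr (Or.inl (Or.inr rfl))) (Or.inr (Or.inr rfl)))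
  have k6 := k5.trans (Computable.and (f := fun x => s 0 x && s 1 x)
    (Or.inr (Or.inl (Or.inl (Or.inl (Or.inl (Or.inr rfl)))))) (Or.inr (Or.inr rfl)))
  have k7 := k6.trans (Computable.and (f := fun x => xor true (s 0 x && s 1 x))
    (Or.inr (Or.inl (Or.inl (Or.inl (Or.inl (Or.inr rfl))))))
    (Or.inr (Or.inl (Or.inl (Or.inl (Or.inl (Or.inl (Or.inl hv1))))))))
  have k8 := k7.trans (Computable.and (Or.inr (Or.inl (Or.inr rfl)))
    (Or.inr (Or.inl (Or.inl (Or.inl (Or.inl (Or.inl (Or.inl (Or.inl hv2)))))))))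
  have k9 := k8.trans (Computable.xor (Or.inr (Or.inl (Or.inr rfl))) (Or.inr (Or.inr rfl)))
  refine k9.mono subset_rfl ?_ ?_
  · rintro g (rfl | rfl)
    · exact Or.inr rfl
    · exact Or.inl (Or.inl (Or.inl (Or.inr rfl)))
  · have hcJ : Fintype.card J = l * (n * (n * (Nat.clog 2 q * Nat.clog 2 q))) := by
      simp [hJ]
    have hcI : (Finset.univ : Finset ((VecQubits q n l ⊕ VecQubits q n l) ⊕
        (Fin (K + 1) ⊕ Fin 4))).card = 2 * (l * (n * Nat.clog 2 q)) + (K + 1 + 4) := by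
      simp
      ring
    have hcJ' : (Finset.univ : Finset J).card = l * (n * (n * (Nat.clog 2 q * Nat.clog 2 q))) := by
      rw [Finset.card_univ, hcJ]
    rw [hcI, hcJ', hcJ, programLength]
    omega

end Measurement


/-! ### Orthogonality of the components. -/

section Orthogonality
variable {ι J : Type} [Fintype ι] [DecidableEq ι] [Fintype J] [DecidableEq J]
  (C₁ C₂ : List (Gate ι)) (a : ι → Bool) (P : (ι → Bool) → J) (out : ι)

/-- Summing over both output values gives the real part of the inner product of two components after
`C₂`. Before `C₂` they have disjoint supports, and a unitary preserves inner products. -/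
theorem interference_false_add_true (p p' : J) :
    interference C₁ C₂ a P out false p p' + interference C₁ C₂ a P out true p p' =
      if p = p' then weight C₁ C₂ a P p else 0 := by
  have h1 : interference C₁ C₂ a P out false p p' + interference C₁ C₂ a P out true p p' =
      ∑ w, (projAmp C₁ C₂ a P p w * (starRingEnd ℂ) (projAmp C₁ C₂ a P p' w)).re := by
    rw [interference, interference, ← Finset.sum_add_distrib]
    refine Finset.sum_congr rfl fun w _ => ?_
    cases w out <;> simp
  rw [h1]
  split_ifs with h
  · subst h
    rw [weight]
    refine Finset.sum_congr rfl fun w _ => ?_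
    rw [Complex.mul_conj, Complex.ofReal_re]
  · set v : J → (ι → Bool) → ℂ := fun p x => if P x = p then circuitUnitary C₁ x a else 0 with hv
    have h2 : ∀ p w, projAmp C₁ C₂ a P p w = (circuitUnitary C₂).mulVec (v p) w := by
      intro p w
      simp [projAmp, Matrix.mulVec, dotProduct, hv]
    have h3 : star ((circuitUnitary C₂).mulVec (v p')) ⬝ᵥ (circuitUnitary C₂).mulVec (v p) = 0 := by
      rw [Matrix.star_mulVec, Matrix.dotProduct_mulVec, Matrix.vecMul_vecMul,
        circuitUnitary_conjTranspose_mul, Matrix.vecMul_one, dotProduct]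
      refine Finset.sum_eq_zero fun x _ => ?_
      simp only [hv, Pi.star_apply]
      by_cases h4 : P x = p
      · rw [if_neg (fun h5 => h (h4.symm.trans h5)), star_zero, zero_mul]
      · rw [if_neg h4, mul_zero]
    rw [← Complex.re_sum]
    have h4 : ∑ w, projAmp C₁ C₂ a P p w * (starRingEnd ℂ) (projAmp C₁ C₂ a P p' w) = 0 := by
      rw [← h3, dotProduct]
      refine Finset.sum_congr rfl fun w _ => ?_
      rw [h2, h2, mul_comm]
      rfl
    rw [h4, Complex.zero_re]

end Orthogonality

/-! ### Damping the coherence between values of `Y`. -/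

section Analysis
variable {q n m l : ℕ} [NeZero q] [NeZero n] (𝒜 : CollapseAlg q n m l)
  (A : Matrix (Fin m) (Fin l) (Rq q n))

/-- The probability that the second stage returns `v` if the coherence between the values `y` and
`y'` of the register `Y` is multiplied by `Φ y y'`. -/
def CollapseAlg.damped (v : Bool)
    (Φ : (VecQubits q n l → Bool) → (VecQubits q n l → Bool) → ℝ) : ℝ :=
  ∑ p, ∑ p', if p.1 = p'.1 then Φ p.2 p'.2 * 𝒜.interf A v p p' else 0

/-- The probability of the components with contents `p` of the registers. -/
def CollapseAlg.mass (p : (VecQubits q n m → Bool) × (VecQubits q n l → Bool)) : ℝ :=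
  weight 𝒜.gates₁ 𝒜.gates₂ (𝒜.start A) 𝒜.registers p

/-- By orthogonality only the diagonal terms contribute to the total, and there the damping is 1.
This turns the complemented output of the coarse measurement into one minus a damped probability. -/
theorem CollapseAlg.damped_false_add_true
    (Φ : (VecQubits q n l → Bool) → (VecQubits q n l → Bool) → ℝ) (hΦ : ∀ y, Φ y y = 1) :
    𝒜.damped A false Φ + 𝒜.damped A true Φ = 1 := by
  rw [damped, damped, ← Finset.sum_add_distrib,
    ← sum_weight 𝒜.gates₁ 𝒜.gates₂ (𝒜.start A) 𝒜.registers]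
  refine Finset.sum_congr rfl fun p _ => ?_
  rw [← Finset.sum_add_distrib, Finset.sum_eq_single p]
  · rw [if_pos rfl, if_pos rfl, ← mul_add, interf, interf, interference_false_add_true, if_pos rfl,
      hΦ, one_mul]
  · intro p' _ hp'
    split_ifs
    · rw [← mul_add, interf, interf, interference_false_add_true, if_neg hp'.symm, mul_zero]
    · rw [add_zero]
  · simp

/-- The probability that the second stage returns `0` if `Y` is not measured. -/
def CollapseAlg.coherent : ℝ := 𝒜.damped A false fun _ _ => 1

/-- The probability that the second stage returns `0` if `Y` is measured. -/
def CollapseAlg.collapsed : ℝ := 𝒜.damped A false fun y y' => if y = y' then 1 else 0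

theorem CollapseAlg.damped_collapsed (v : Bool) :
    (𝒜.damped A v fun y y' => if y = y' then 1 else 0) =
      probBit 𝒜.out v (evolve 𝒜.gates₂ (𝒜.challengeState A true)) := by
  rw [probBit_challenge_true, damped]
  refine Finset.sum_congr rfl fun p _ => Finset.sum_congr rfl fun p' _ => ?_
  simp only [Prod.ext_iff]
  split_ifs <;> simp_all

theorem CollapseAlg.damped_coherent (v : Bool) :
    (𝒜.damped A v fun _ _ => 1) =
      probBit 𝒜.out v (evolve 𝒜.gates₂ (𝒜.challengeState A false)) := by
  rw [probBit_challenge_false, damped]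
  simp only [one_mul]

theorem CollapseAlg.advantage_eq :
    𝒜.advantage = 𝔼 A, (𝒜.coherent A - 𝒜.collapsed A) := by
  have h : ∀ A, (𝔼 b : Bool, probBit 𝒜.out b (evolve 𝒜.gates₂ (𝒜.challengeState A b))) =
      1 / 2 + (𝒜.coherent A - 𝒜.collapsed A) / 2 := by
    intro A
    have h1 := 𝒜.damped_false_add_true A (fun y y' => if y = y' then 1 else 0) (by simp)
    rw [Finset.expect_eq_sum_div_card, Fintype.sum_bool, ← damped_collapsed, ← damped_coherent]
    simp only [Finset.card_univ, Fintype.card_bool, coherent, collapsed]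
    push_cast
    linarith
  rw [advantage, winProb, Finset.expect_congr rfl fun A _ => h A, Finset.expect_add_distrib,
    Fintype.expect_const, ← Finset.expect_div]
  ring

theorem CollapseAlg.damped_congr {v : Bool}
    {Φ Ψ : (VecQubits q n l → Bool) → (VecQubits q n l → Bool) → ℝ}
    (h : ∀ p p', p.1 = p'.1 → 𝒜.interf A v p p' ≠ 0 → Φ p.2 p'.2 = Ψ p.2 p'.2) :
    𝒜.damped A v Φ = 𝒜.damped A v Ψ := by
  refine Finset.sum_congr rfl fun p _ => Finset.sum_congr rfl fun p' _ => ?_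
  split_ifs with hp
  · by_cases h0 : 𝒜.interf A v p p' = 0
    · rw [h0, mul_zero, mul_zero]
    · rw [h p p' hp h0]
  · rfl

theorem CollapseAlg.damped_linear (v : Bool) (a b : ℝ)
    (Φ Ψ : (VecQubits q n l → Bool) → (VecQubits q n l → Bool) → ℝ) :
    (𝒜.damped A v fun y y' => a * Φ y y' + b * Ψ y y') =
      a * 𝒜.damped A v Φ + b * 𝒜.damped A v Ψ := by
  simp only [damped, Finset.mul_sum, ← Finset.sum_add_distrib]
  refine Finset.sum_congr rfl fun p _ => Finset.sum_congr rfl fun p' _ => ?_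
  split_ifs <;> ring

theorem CollapseAlg.expect_damped {R : Type} [Fintype R] (v : Bool)
    (Φ : R → (VecQubits q n l → Bool) → (VecQubits q n l → Bool) → ℝ) :
    𝔼 r, 𝒜.damped A v (Φ r) = 𝒜.damped A v fun y y' => 𝔼 r, Φ r y y' := by
  simp only [damped]
  rw [Finset.expect_sum_comm]
  refine Finset.sum_congr rfl fun p _ => ?_
  rw [Finset.expect_sum_comm]
  refine Finset.sum_congr rfl fun p' _ => ?_
  split_ifs
  · rw [Finset.expect_mul]
  · simp

/-- An interference coefficient is at most the mean of the two masses. Each component meets `2 ^ (l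
* (n * Nat.clog 2 q))` others with the same `z`, so summing costs this factor; it is affordable
because the precision can be increased. -/
theorem CollapseAlg.damped_sub_le (v : Bool)
    (Φ Ψ : (VecQubits q n l → Bool) → (VecQubits q n l → Bool) → ℝ) {τ : ℝ} (hτ : 0 ≤ τ)
    (h : ∀ p p', p.1 = p'.1 → 𝒜.interf A v p p' ≠ 0 → |Φ p.2 p'.2 - Ψ p.2 p'.2| ≤ τ) :
    𝒜.damped A v Φ - 𝒜.damped A v Ψ ≤ τ * 2 ^ (l * (n * Nat.clog 2 q)) := by
  have h1 : 𝒜.damped A v Φ - 𝒜.damped A v Ψ ≤ ∑ p, ∑ p',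
      if p.1 = p'.1 then τ * ((𝒜.mass A p + 𝒜.mass A p') / 2) else 0 := by
    rw [damped, damped, ← Finset.sum_sub_distrib]
    refine Finset.sum_le_sum fun p _ => ?_
    rw [← Finset.sum_sub_distrib]
    refine Finset.sum_le_sum fun p' _ => ?_
    split_ifs with hp
    · rw [← sub_mul]
      by_cases h0 : 𝒜.interf A v p p' = 0
      · rw [h0, mul_zero]
        exact mul_nonneg hτ (div_nonneg (add_nonneg (weight_nonneg _ _ _ _ _)
          (weight_nonneg _ _ _ _ _)) two_pos.le)
      · refine (le_abs_self _).trans ?_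
        rw [abs_mul]
        exact mul_le_mul (h p p' hp h0) (abs_interference_le _ _ _ _ _ _ _ _) (abs_nonneg _) hτ
    · rw [sub_zero]
  refine h1.trans (le_of_eq ?_)
  have hcard : ((Fintype.card (VecQubits q n l → Bool) : ℕ) : ℝ) =
      2 ^ (l * (n * Nat.clog 2 q)) := by
    simp
  have h2 : ∀ p : (VecQubits q n m → Bool) × (VecQubits q n l → Bool), ∀ F : _ → ℝ,
      (∑ p' : (VecQubits q n m → Bool) × (VecQubits q n l → Bool),
        if p.1 = p'.1 then F p' else 0) = ∑ y, F (p.1, y) := by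
    intro p F
    rw [Fintype.sum_prod_type, Finset.sum_comm]
    refine Finset.sum_congr rfl fun y _ => ?_
    rw [Finset.sum_ite_eq, if_pos (Finset.mem_univ _)]
  have hs : ∀ F : (VecQubits q n m → Bool) × (VecQubits q n l → Bool) → ℝ,
      (∑ p : (VecQubits q n m → Bool) × (VecQubits q n l → Bool),
        ∑ y : VecQubits q n l → Bool, F (p.1, y)) =
      2 ^ (l * (n * Nat.clog 2 q)) * ∑ p, F p := by
    intro F
    rw [Fintype.sum_prod_type, Fintype.sum_prod_type, Finset.mul_sum]
    refine Finset.sum_congr rfl fun z _ => ?_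
    change (∑ _y : VecQubits q n l → Bool, ∑ y' : VecQubits q n l → Bool, F (z, y')) = _
    rw [Finset.sum_const, nsmul_eq_mul, Finset.card_univ, hcard]
  simp_rw [h2]
  have hmass : ∑ p, 𝒜.mass A p = 1 := sum_weight _ _ _ _
  have h3 : ∀ p : (VecQubits q n m → Bool) × (VecQubits q n l → Bool),
      (∑ y : VecQubits q n l → Bool, τ * ((𝒜.mass A p + 𝒜.mass A (p.1, y)) / 2)) =
      τ / 2 * (2 ^ (l * (n * Nat.clog 2 q)) * 𝒜.mass A p) +
        τ / 2 * ∑ y : VecQubits q n l → Bool, 𝒜.mass A (p.1, y) := by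
    intro p
    rw [← hcard, Finset.mul_sum, ← nsmul_eq_mul, ← Finset.card_univ, ← Finset.sum_const,
      Finset.mul_sum, ← Finset.sum_add_distrib]
    refine Finset.sum_congr rfl fun y _ => ?_
    ring
  rw [Finset.sum_congr rfl fun p _ => h3 p, Finset.sum_add_distrib, ← Finset.mul_sum,
    ← Finset.mul_sum, ← Finset.mul_sum, hs, hmass]
  ring

/-- A nonzero interference term requires nonzero amplitude on both sides, so validity applies to
both register contents. -/
theorem CollapseAlg.exists_of_interf_ne_zero {γ : ℕ} (h𝒜 : 𝒜.Valid γ) {v : Bool}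
    {p p' : (VecQubits q n m → Bool) × (VecQubits q n l → Bool)} (hp : p.1 = p'.1)
    (h : 𝒜.interf A v p p' ≠ 0) :
    ∃ y y' : Fin l → Rq q n, p.2 = encVec y ∧ p'.2 = encVec y' ∧
      encVec (A.mulVec y) = (encVec (A.mulVec y') : VecQubits q n m → Bool) ∧
        vecNorm y ≤ γ ∧ vecNorm y' ≤ γ := by
  have key : ∀ x, circuitUnitary 𝒜.gates₁ x (𝒜.start A) ≠ 0 → ∃ y : Fin l → Rq q n,
      (𝒜.registers x).2 = encVec y ∧ (𝒜.registers x).1 = encVec (A.mulVec y) ∧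
        vecNorm y ≤ γ := by
    intro x hx
    obtain ⟨y, z, h1, h2, rfl, h4⟩ := h𝒜 A x (by
      rw [firstState, startState]
      have := evolve_basisState_apply 𝒜.gates₁ (𝒜.start A) x x
      rw [start] at this
      rw [this, ← start]
      exact mul_ne_zero hx ((map_ne_zero _).2 hx))
    exact ⟨y, h1, h2, h4⟩
  obtain ⟨⟨x, rfl, hx⟩, ⟨x', rfl, hx'⟩⟩ := exists_of_interference_ne_zero _ _ _ _ _ _ h
  obtain ⟨y, h1, h2, h3⟩ := key x hx
  obtain ⟨y', h1', h2', h3'⟩ := key x' hx'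
  exact ⟨y, y', h1, h1', by rw [← h2, ← h2', hp], h3, h3'⟩

/-- The output distribution of the reduction. -/
theorem CollapseAlg.expect_measuredBit (C K : ℕ) (t : VecQubits q n l → Bool) :
    (𝔼 r : Fin (K + 1) ⊕ Fin 4 → Bool, ∑ p, ∑ p',
      if p.1 = p'.1 ∧ measuredBit C K t p.2 r = measuredBit C K t p'.2 r then
        𝒜.interf A (selectCoarse fun i => r (Sum.inr i)) p p' else 0) =
      3 / 16 + 𝒜.coherent A / 16 + 𝒜.damped A false fun y y' =>
        3 / 4 * triangle (2 * 2 ^ K) ((C * (pairing t y - pairing t y') : ℤ) : ZMod (2 * 2 ^ K)) -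
        3 / 16 * triangle (2 * 2 ^ K)
          ((4 * (C * (pairing t y - pairing t y')) : ℤ) : ZMod (2 * 2 ^ K)) := by
  set T : ℕ → (VecQubits q n l → Bool) → (Fin (K + 1) → Bool) → Bool := fun C y R =>
    (scaledPairing C K t y + bitsVal R).testBit K with hT
  set Ψ : Bool → Bool → (Fin (K + 1) → Bool) →
      (VecQubits q n l → Bool) → (VecQubits q n l → Bool) → ℝ := fun b₁ b₂ R y y' =>
    if xor (b₁ && T C y R) (b₂ && T (4 * C) y R) = xor (b₁ && T C y' R) (b₂ && T (4 * C) y' R)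
      then 1 else 0 with hΨ
  have h1 : (𝔼 r : Fin (K + 1) ⊕ Fin 4 → Bool, ∑ p, ∑ p',
      if p.1 = p'.1 ∧ measuredBit C K t p.2 r = measuredBit C K t p'.2 r then
        𝒜.interf A (selectCoarse fun i => r (Sum.inr i)) p p' else 0) =
      𝔼 s : Fin 4 → Bool, 𝔼 R : Fin (K + 1) → Bool,
        𝒜.damped A (selectCoarse s) (Ψ (selectFine s) (selectCoarse s) R) := by
    rw [Fintype.expect_equiv (Equiv.sumArrowEquivProdArrow (Fin (K + 1)) (Fin 4) Bool) _
      (fun Rs => 𝒜.damped A (selectCoarse Rs.2) (Ψ (selectFine Rs.2) (selectCoarse Rs.2) Rs.1)),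
      ← Finset.univ_product_univ, Finset.expect_product, Finset.expect_comm]
    intro r
    refine Finset.sum_congr rfl fun p _ => Finset.sum_congr rfl fun p' _ => ?_
    rw [ite_and]
    refine if_congr Iff.rfl ?_ rfl
    simp only [hΨ, hT, measuredBit, Equiv.sumArrowEquivProdArrow, Equiv.coe_fn_mk,
      Function.comp_def, ite_mul, one_mul, zero_mul]
    congr
  have htri : ∀ C y y', (𝔼 R : Fin (K + 1) → Bool, if T C y R = T C y' R then (1 : ℝ) else 0) =
      triangle (2 * 2 ^ K) ((C * (pairing t y - pairing t y') : ℤ) : ZMod (2 * 2 ^ K)) := by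
    intro C y y'
    rw [hT, expect_testBit_eq, scaledPairing_cast, scaledPairing_cast]
    push_cast
    rw [mul_sub]
  rw [h1]
  simp only [expect_damped]
  rw [expect_select (fun b₁ b₂ => 𝒜.damped A b₂ fun y y' => 𝔼 R, Ψ b₁ b₂ R y y')]
  simp only [hΨ, Bool.true_and, Bool.false_and, Bool.xor_false, Bool.false_xor, htri, if_true,
    Fintype.expect_const]
  -- The coarse branch counts the output 1 in place of 0, so it contributes 3/16 minus 3/16 of a
  -- damped probability; this is the source of the minus sign.
  have h4 := 𝒜.damped_false_add_true A (fun y y' => triangle (2 * 2 ^ K)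
    (((4 * C : ℕ) * (pairing t y - pairing t y') : ℤ) : ZMod (2 * 2 ^ K)))
    (fun y => by simp [triangle])
  have h5 := 𝒜.damped_linear A false (3 / 4) (-(3 / 16))
    (fun y y' => triangle (2 * 2 ^ K)
      ((C * (pairing t y - pairing t y') : ℤ) : ZMod (2 * 2 ^ K)))
    (fun y y' => triangle (2 * 2 ^ K)
      (((4 * C : ℕ) * (pairing t y - pairing t y') : ℤ) : ZMod (2 * 2 ^ K)))
  have h6 : (𝒜.damped A false fun y y' =>
        3 / 4 * triangle (2 * 2 ^ K) ((C * (pairing t y - pairing t y') : ℤ) : ZMod (2 * 2 ^ K)) -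
        3 / 16 * triangle (2 * 2 ^ K)
          ((4 * (C * (pairing t y - pairing t y')) : ℤ) : ZMod (2 * 2 ^ K))) =
      𝒜.damped A false fun y y' =>
        3 / 4 * triangle (2 * 2 ^ K) ((C * (pairing t y - pairing t y') : ℤ) : ZMod (2 * 2 ^ K)) +
        -(3 / 16) * triangle (2 * 2 ^ K)
          (((4 * C : ℕ) * (pairing t y - pairing t y') : ℤ) : ZMod (2 * 2 ^ K)) := by
    congr 1
    funext y y'
    push_cast
    ring_nf
  rw [h6, h5, coherent]
  linarith

end Analysis


/-- The factor by which the difference `D` of two pairings damps the coherence, for a modulus `Q`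
and the scaling factor `Q / q`. -/
def damping (Q q : ℕ) (D : ℤ) : ℝ :=
  3 / 4 * triangle Q (((Q / q : ℕ) * D : ℤ) : ZMod Q) -
    3 / 16 * triangle Q ((4 * ((Q / q : ℕ) * D) : ℤ) : ZMod Q)

theorem damping_zero (Q q : ℕ) : damping Q q 0 = 9 / 16 := by
  simp [damping, triangle]
  norm_num

/-- The rounding estimate is applied to `D` with bound `B` and to `4 * D` with bound `4 * B`, with
weights 3/4 and 3/16. -/
theorem abs_damping_sub_le (Q q : ℕ) [NeZero Q] [NeZero q] {D B : ℤ} (hB : |D| ≤ B) :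
    |damping Q q D - (3 / 4 * triangle q (D : ZMod q) - 3 / 16 * triangle q (4 * D : ZMod q))| ≤
      3 * (B + q) / Q := by
  have hQ : (0 : ℝ) < Q := by exact_mod_cast Nat.pos_of_ne_zero (NeZero.ne Q)
  have h1 := abs_triangle_scale_sub_le Q q D B hB
  have h2 := abs_triangle_scale_sub_le Q q (4 * D) (4 * B) (by
    rw [abs_mul]
    norm_num
    exact hB)
  rw [show ((Q / q : ℕ) : ℤ) * (4 * D) = 4 * ((Q / q : ℕ) * D) by ring, Int.cast_mul 4 D,
    Int.cast_ofNat] at h2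
  rw [abs_le] at h1 h2 ⊢
  have h3 : (3 : ℝ) * (B + q) / Q = 3 / 4 * ((2 * B + 3 * q) / Q) +
      3 / 16 * ((2 * (4 * B : ℤ) + 3 * q) / Q) + 3 / 16 * (q / Q) := by
    push_cast
    field_simp
    ring
  have h4 : (0 : ℝ) ≤ q / Q := by positivity
  rw [h3, damping]
  constructor <;> linarith [h1.1, h1.2, h2.1, h2.2]

/-! ### The advantage of the reduction. -/

section
variable {q n m l : ℕ} [NeZero q] [NeZero n]

theorem abs_pairing_sub_le {k : ℕ} (t y y' : VecQubits q n k → Bool) :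
    |pairing t y - pairing t y'| ≤ 2 * (k * n * (2 ^ Nat.clog 2 q * 2 ^ Nat.clog 2 q)) := by
  have h1 := abs_pairing_le t y
  have h2 := abs_pairing_le t y'
  rw [abs_le] at h1 h2 ⊢
  constructor <;> linarith [h1.1, h1.2, h2.1, h2.2]

theorem shortVecs_nonempty (k η : ℕ) : (shortVecs q n k η).Nonempty := by
  refine ⟨0, Fintype.mem_piFinset.2 fun i => Finset.mem_filter.2 ⟨Finset.mem_univ _, ?_⟩⟩
  refine Finset.sup_le fun j _ => ?_
  simp [Rq.coeff]

variable [Fact q.Prime]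

theorem expect_triangle_mul_four (hodd : q % 2 = 1) :
    𝔼 x : ZMod q, triangle q (4 * x) = 𝔼 x : ZMod q, triangle q x := by
  have h4 : (4 : ZMod q) ≠ 0 := by
    have h : ((4 : ℕ) : ZMod q) ≠ 0 := by
      rw [Ne, ZMod.natCast_eq_zero_iff, show (4 : ℕ) = 2 ^ 2 by norm_num]
      intro h
      have := Nat.le_of_dvd two_pos ((Fact.out : q.Prime).dvd_of_dvd_pow h)
      have := (Fact.out : q.Prime).two_le
      omega
    exact_mod_cast h
  exact Fintype.expect_equiv (Equiv.mulLeft₀ 4 h4) _ _ fun x => rfl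

/-- For a uniformly random vector, the pairings with different vectors differ by a nearly uniform
residue modulo `q`. -/
theorem abs_expect_damping_sub_le (Q : ℕ) [NeZero Q] (hodd : q % 2 = 1) {y y' : Fin l → Rq q n}
    (h : y ≠ y') {B : ℤ}
    (hB : ∀ t : VecQubits q n l → Bool, |pairing t (encVec y) - pairing t (encVec y')| ≤ B) :
    |(𝔼 t : Fin l → Rq q n,
        damping Q q (pairing (encVec t) (encVec y) - pairing (encVec t) (encVec y'))) -
      9 / 16 * 𝔼 x, triangle q x| ≤ 3 * (B + q) / Q := by
  have h1 : 9 / 16 * (𝔼 x, triangle q x) = 𝔼 t : Fin l → Rq q n,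
      (3 / 4 * triangle q
          ((pairing (encVec t) (encVec y) - pairing (encVec t) (encVec y') : ℤ) : ZMod q) -
        3 / 16 * triangle q (4 *
          ((pairing (encVec t) (encVec y) - pairing (encVec t) (encVec y') : ℤ) : ZMod q))) := by
    have h2 : ∀ t : Fin l → Rq q n,
        ((pairing (encVec t) (encVec y) - pairing (encVec t) (encVec y') : ℤ) : ZMod q) =
          Rq.constCoeff (t ⬝ᵥ (y - y')) := by
      intro t
      rw [Int.cast_sub, pairing_encVec, pairing_encVec, dotProduct_sub, map_sub]
    simp only [h2]
    rw [expect_constCoeff_dotProduct (sub_ne_zero.2 h)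
      (fun x => 3 / 4 * triangle q x - 3 / 16 * triangle q (4 * x)), Finset.expect_sub_distrib,
      ← Finset.mul_expect, ← Finset.mul_expect, expect_triangle_mul_four hodd]
    ring
  rw [h1, ← Finset.expect_sub_distrib]
  refine (Finset.abs_expect_le _ _).trans ?_
  exact Finset.expect_le Finset.univ_nonempty fun t _ => abs_damping_sub_le Q q (hB _)

variable (𝒜 : CollapseAlg q n m l) {γ η : ℕ}

/-- On every pair with nonzero interference the damping is the constant 9/16, so an `MLWE` sample
acts as if `Y` were not measured, up to a scalar. -/
theorem CollapseAlg.damped_sample (h𝒜 : 𝒜.Valid γ) (hsmall : 2 * γ * η * n * l < q / 32)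
    (Q : ℕ) [NeZero Q]
    (hQ : 16 * (2 * (l * n * (2 ^ Nat.clog 2 q * 2 ^ Nat.clog 2 q)) + q) ≤ Q)
    (A : Matrix (Fin l) (Fin m) (Rq q n)) (s₁ : Fin m → Rq q n) {s₂ : Fin l → Rq q n}
    (hs₂ : vecNorm s₂ ≤ η) :
    (𝒜.damped A.transpose false fun y y' => damping Q q
      (pairing (encVec (A.mulVec s₁ + s₂)) y - pairing (encVec (A.mulVec s₁ + s₂)) y')) =
      9 / 16 * 𝒜.coherent A.transpose := by
  have h := 𝒜.damped_linear A.transpose false (9 / 16) 0 (fun _ _ => 1) (fun _ _ => 0)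
  have h' : 9 / 16 * 𝒜.coherent A.transpose =
      𝒜.damped A.transpose false fun _ _ => 9 / 16 * 1 + 0 * 0 := by
    rw [h, zero_mul _, add_zero, coherent]
  rw [h']
  refine 𝒜.damped_congr _ fun p p' hp h0 => ?_
  obtain ⟨y, y', hy, hy', hA, hn, hn'⟩ := 𝒜.exists_of_interf_ne_zero _ h𝒜 hp h0
  obtain ⟨d, hd, hdvd⟩ := exists_small_pairing_sub A (s₁ := s₁) hs₂ hn hn' (encVec_injective hA)
  rw [hy, hy', mul_one, mul_zero, add_zero]
  refine triangle_scale_small Q q _ d _ ?_ hdvd (abs_pairing_sub_le _ _ _) ?_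
  · have : (2 * γ * η * n * l : ℤ) < (q / 32 : ℕ) := by exact_mod_cast hsmall
    omega
  · exact_mod_cast hQ

/-- Averaged over `t`, the damping is 9/16 on the diagonal and within the rounding error of `9/16 *
π` off it, with `π` the mean triangle. That is a mixture of the factor 1 and the Kronecker delta
with weights `π` and `1 - π`. -/
theorem CollapseAlg.le_damped_uniform_gap (h𝒜 : 𝒜.Valid γ) (hodd : q % 2 = 1)
    (Q : ℕ) [NeZero Q] (A : Matrix (Fin m) (Fin l) (Rq q n)) :
    9 / 16 * (1 - 𝔼 x, triangle q x) * (𝒜.coherent A - 𝒜.collapsed A) -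
      3 * (2 * (l * n * (2 ^ Nat.clog 2 q * 2 ^ Nat.clog 2 q)) + q) / Q *
        2 ^ (l * (n * Nat.clog 2 q)) ≤
    9 / 16 * 𝒜.coherent A - 𝔼 t : Fin l → Rq q n, 𝒜.damped A false fun y y' =>
      damping Q q (pairing (encVec t) y - pairing (encVec t) y') := by
  set π := 𝔼 x, triangle q x with hπ
  have h1 := 𝒜.damped_linear A false (9 / 16 * π) (9 / 16 * (1 - π)) (fun _ _ => 1)
    (fun y y' => if y = y' then 1 else 0)
  have h2 := 𝒜.damped_sub_le A false
    (fun y y' => 𝔼 t : Fin l → Rq q n, damping Q q (pairing (encVec t) y - pairing (encVec t) y'))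
    (fun y y' => 9 / 16 * π * 1 + 9 / 16 * (1 - π) * if y = y' then 1 else 0)
    (τ := 3 * (2 * (l * n * (2 ^ Nat.clog 2 q * 2 ^ Nat.clog 2 q)) + q) / Q) (by positivity) (by
      intro p p' hp h0
      obtain ⟨y, y', hy, hy', -⟩ := 𝒜.exists_of_interf_ne_zero _ h𝒜 hp h0
      rw [hy, hy']
      by_cases h : y = y'
      · subst h
        simp only [sub_self, damping_zero, Fintype.expect_const, if_true]
        rw [show 9 / 16 - (9 / 16 * π * 1 + 9 / 16 * (1 - π) * 1) = 0 by ring, abs_zero]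
        positivity
      · have h3 := abs_expect_damping_sub_le Q hodd h
          (B := 2 * (l * n * (2 ^ Nat.clog 2 q * 2 ^ Nat.clog 2 q)))
          (fun t => abs_pairing_sub_le t _ _)
        rw [if_neg (fun h' => h (encVec_injective h')), mul_zero, add_zero, mul_one]
        push_cast at h3 ⊢
        exact h3)
  rw [h1] at h2
  rw [expect_damped]
  rw [coherent, collapsed] at *
  linarith

/-- The precision, in bits, with which the reduction computes the pairing. -/
def precision (w n c l : ℕ) : ℕ := l * (n * c) + 2 * w + l + n + 2 * c + 8

/-- The exponent collects `l * n ≤ 2 ^ l * 2 ^ n`, `q ≤ 2 ^ c`, the number of values of `Y`, `4 ^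
w`, and `64 * 4 = 2 ^ 8`. -/
theorem precision_bound (w : ℕ) :
    64 * (2 * (l * n * (2 ^ Nat.clog 2 q * 2 ^ Nat.clog 2 q)) + q) *
      2 ^ (l * (n * Nat.clog 2 q)) * 4 ^ w ≤ 2 * 2 ^ precision w n (Nat.clog 2 q) l := by
  set c := Nat.clog 2 q with hc
  have h1 : q ≤ 2 ^ c := Nat.le_pow_clog one_lt_two q
  have h2 : l * n ≤ 2 ^ l * 2 ^ n := Nat.mul_le_mul Nat.lt_two_pow_self.le Nat.lt_two_pow_self.le
  have h3 : (1 : ℕ) ≤ 2 ^ c := Nat.one_le_two_pow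
  have h4 : 1 ≤ 2 ^ l * 2 ^ n := Nat.mul_pos (by positivity) (by positivity)
  have h5 : 2 * (l * n * (2 ^ c * 2 ^ c)) + q ≤ 4 * (2 ^ l * 2 ^ n * (2 ^ c * 2 ^ c)) := by
    have h6 : l * n * (2 ^ c * 2 ^ c) ≤ 2 ^ l * 2 ^ n * (2 ^ c * 2 ^ c) :=
      Nat.mul_le_mul_right _ h2
    have h7 : 1 * (1 * 2 ^ c) ≤ 2 ^ l * 2 ^ n * (2 ^ c * 2 ^ c) :=
      Nat.mul_le_mul h4 (Nat.mul_le_mul_right _ h3)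
    omega
  calc _ ≤ 64 * (4 * (2 ^ l * 2 ^ n * (2 ^ c * 2 ^ c))) * 2 ^ (l * (n * c)) * 4 ^ w := by gcongr
    _ ≤ 2 * (64 * (4 * (2 ^ l * 2 ^ n * (2 ^ c * 2 ^ c))) * 2 ^ (l * (n * c)) * 4 ^ w) := by omega
    _ = 2 * 2 ^ precision w n c l := by
      rw [precision, show (4 : ℕ) ^ w = 2 ^ (2 * w) by rw [pow_mul]; norm_num]
      ring

theorem precision_error_le {b Q e w : ℕ} (hQ : Q ≠ 0) (hb : 64 * b * 2 ^ e * 4 ^ w ≤ Q) :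
    (3 : ℝ) * b / Q * 2 ^ e ≤ (3 : ℝ)⁻¹ ^ w / 4 := by
  have hQpos : (0 : ℝ) < Q := by exact_mod_cast Nat.pos_of_ne_zero hQ
  have h1 : (64 * b * 2 ^ e * 4 ^ w : ℝ) ≤ Q := by exact_mod_cast hb
  have h2 : ((4 : ℝ)⁻¹) ^ w ≤ (3 : ℝ)⁻¹ ^ w :=
    pow_le_pow_left₀ (by norm_num) (by norm_num) w
  have h3 : (3 : ℝ) * b / Q * 2 ^ e ≤ (4 : ℝ)⁻¹ ^ w / 4 := by
    rw [div_mul_eq_mul_div, div_le_iff₀ hQpos, inv_pow, div_mul_eq_mul_div,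
      le_div_iff₀ (by norm_num), inv_mul_eq_div, le_div_iff₀ (by positivity)]
    refine le_trans ?_ h1
    have : (0 : ℝ) ≤ b * 2 ^ e * 4 ^ w := by positivity
    linarith
  linarith

/-- The reduction from `MLWE` to the collapsing experiment. -/
theorem CollapseAlg.exists_mlweAlg_advantage (h𝒜 : 𝒜.Valid γ) (hq : 16 ≤ q)
    (hsmall : 2 * γ * η * n * l < q / 32) (w : ℕ) :
    ∃ ℬ : MLWEAlg q n l m, (𝒜.advantage - (3 : ℝ)⁻¹ ^ w) / 4 ≤ ℬ.advantage η ∧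
      ℬ.time ≤ 𝒜.time + (precision w n (Nat.clog 2 q) l + 5 +
        40 * (4 * (m * (n * Nat.clog 2 q) +
          programLength n l (Nat.clog 2 q) (precision w n (Nat.clog 2 q) l)) +
            (m * (n * Nat.clog 2 q) + 2)) + 1) := by
  set K := precision w n (Nat.clog 2 q) l with hK
  set Q : ℕ := 2 * 2 ^ K with hQ
  have : NeZero Q := ⟨by positivity⟩
  have hodd : q % 2 = 1 := by
    rcases (Fact.out : q.Prime).eq_two_or_odd with h | h
    · omega
    · exact h
  obtain ⟨ℬ, htime, hprob⟩ := 𝒜.exists_mlweAlg (measuredBit (Q / q) K)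
    (fun r => selectCoarse fun i => r (Sum.inr i)) _
    (computable_measuredBit (Q / q) K (fun k => Sum.inr (Sum.inl k)) (fun k => Sum.inl (𝒜.Y k))
      (fun k => Sum.inr (Sum.inr k)))
  refine ⟨ℬ, ?_, by simpa using htime⟩
  have hb := precision_bound (q := q) (n := n) (l := l) w
  rw [← hK, ← hQ] at hb
  set b : ℕ := 2 * (l * n * (2 ^ Nat.clog 2 q * 2 ^ Nat.clog 2 q)) + q with hbdef
  have hp : ∀ A t, ℬ.probZero A t = 3 / 16 + 𝒜.coherent A.transpose / 16 +
      𝒜.damped A.transpose false fun y y' =>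
        damping Q q (pairing (encVec t) y - pairing (encVec t) y') := by
    intro A t
    rw [hprob]
    exact 𝒜.expect_measuredBit A.transpose (Q / q) K (encVec t)
  have hQb : 16 * b ≤ Q := by
    refine le_trans ?_ hb
    have h1 : 1 ≤ 2 ^ (l * (n * Nat.clog 2 q)) * 4 ^ w :=
      Nat.mul_pos (by positivity) (by positivity)
    nlinarith
  have hsample : ∀ A : Matrix (Fin l) (Fin m) (Rq q n),
      (𝔼 s ∈ shortVecs q n m η ×ˢ shortVecs q n l η, ℬ.probZero A (A.mulVec s.1 + s.2)) =
        3 / 16 + 𝒜.coherent A.transpose / 16 + 9 / 16 * 𝒜.coherent A.transpose := by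
    intro A
    rw [← Finset.expect_const ((shortVecs_nonempty (q := q) (n := n) m η).product
      (shortVecs_nonempty (q := q) (n := n) l η))
      (3 / 16 + 𝒜.coherent A.transpose / 16 + 9 / 16 * 𝒜.coherent A.transpose)]
    refine Finset.expect_congr rfl fun s hs => ?_
    rw [hp, 𝒜.damped_sample h𝒜 hsmall Q hQb A s.1
      (vecNorm_le_of_mem_shortVecs (Finset.mem_product.1 hs).2)]
  set π := 𝔼 x, triangle q x with hπ
  set τ : ℝ := 3 * b / Q * 2 ^ (l * (n * Nat.clog 2 q)) with hτ
  have hπle : π ≤ 17 / 32 := expect_triangle_le q hq hodd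
  have hgap : ∀ A : Matrix (Fin l) (Fin m) (Rq q n),
      9 / 16 * (1 - π) * (𝒜.coherent A.transpose - 𝒜.collapsed A.transpose) - τ ≤
        (𝔼 s ∈ shortVecs q n m η ×ˢ shortVecs q n l η, ℬ.probZero A (A.mulVec s.1 + s.2)) -
          𝔼 t, ℬ.probZero A t := by
    intro A
    have h := 𝒜.le_damped_uniform_gap h𝒜 hodd Q A.transpose
    rw [hsample, Finset.expect_congr rfl fun t _ => hp A t, Finset.expect_add_distrib,
      Fintype.expect_const, hτ, hbdef]
    push_cast
    linarith
  have hsum : 9 / 16 * (1 - π) * 𝒜.advantage - τ ≤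
      (𝔼 A : Matrix (Fin l) (Fin m) (Rq q n),
        𝔼 s ∈ shortVecs q n m η ×ˢ shortVecs q n l η, ℬ.probZero A (A.mulVec s.1 + s.2)) -
          𝔼 A : Matrix (Fin l) (Fin m) (Rq q n), 𝔼 t, ℬ.probZero A t := by
    have h1 : 𝒜.advantage = 𝔼 A : Matrix (Fin l) (Fin m) (Rq q n),
        (𝒜.coherent A.transpose - 𝒜.collapsed A.transpose) := by
      rw [𝒜.advantage_eq]
      exact (Fintype.expect_equiv ⟨Matrix.transpose, Matrix.transpose,
        Matrix.transpose_transpose, Matrix.transpose_transpose⟩ _ _ fun A => rfl).symm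
    rw [h1, Finset.mul_expect, ← Finset.expect_sub_distrib,
      ← Fintype.expect_const (ι := Matrix (Fin l) (Fin m) (Rq q n)) τ,
      ← Finset.expect_sub_distrib]
    exact Finset.expect_le_expect fun A _ => by
      exact hgap A
  have hτle : τ ≤ (3 : ℝ)⁻¹ ^ w / 4 := precision_error_le (NeZero.ne Q) hb
  rw [MLWEAlg.advantage, abs_sub_comm]
  rcases le_total 0 𝒜.advantage with h0 | h0
  · refine le_trans ?_ (hsum.trans (le_abs_self _))
    -- From `π ≤ 17/32` the constant is at least `9/16 * 15/32 = 135/512`, which exceeds 1/4.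
    have : 1 / 4 * 𝒜.advantage ≤ 9 / 16 * (1 - π) * 𝒜.advantage :=
      mul_le_mul_of_nonneg_right (by linarith) h0
    linarith
  · refine le_trans ?_ (abs_nonneg _)
    have : (0 : ℝ) ≤ 3⁻¹ ^ w := by positivity
    linarith

end


/-- A polynomial in `w`, `n`, `log q`, `m`, `l` that evaluates to the overhead of the reduction. -/
def overhead : MvPolynomial (Fin 5) ℕ :=
  let w := MvPolynomial.X 0
  let n := MvPolynomial.X 1
  let c := MvPolynomial.X 2
  let m := MvPolynomial.X 3
  let l := MvPolynomial.X 4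
  let k := l * (n * c) + 2 * w + l + n + 2 * c + 8
  let s := 2 + (2 * (l * (n * c)) + (k + 1 + 4)) + l * (n * (n * (c * c))) +
    2 * ((l * (n * (n * (c * c))) + (k + 1)) * (5 * (k + 1) + 1)) + 9
  k + 5 + 40 * (4 * (m * (n * c) + s) + (m * (n * c) + 2)) + 1

theorem eval_overhead (w n c m l : ℕ) :
    MvPolynomial.eval ![w, n, c, m, l] overhead = precision w n c l + 5 +
      40 * (4 * (m * (n * c) + programLength n l c (precision w n c l)) + (m * (n * c) + 2)) + 1 := by
  simp [overhead, precision, programLength]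

/-! ### Polynomial and negligible bounds. -/

theorem PolyBounded.mono {f g : ℕ → ℕ} (hg : PolyBounded g) (h : ∀ i, f i ≤ g i) :
    PolyBounded f := by
  obtain ⟨p, hp⟩ := hg
  exact ⟨p, fun i => (h i).trans (hp i)⟩

theorem PolyBounded.add {f g : ℕ → ℕ} (hf : PolyBounded f) (hg : PolyBounded g) :
    PolyBounded fun i => f i + g i := by
  obtain ⟨p, hp⟩ := hf
  obtain ⟨r, hr⟩ := hg
  exact ⟨p + r, fun i => by simpa using add_le_add (hp i) (hr i)⟩

theorem PolyBounded.mul {f g : ℕ → ℕ} (hf : PolyBounded f) (hg : PolyBounded g) :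
    PolyBounded fun i => f i * g i := by
  obtain ⟨p, hp⟩ := hf
  obtain ⟨r, hr⟩ := hg
  exact ⟨p * r, fun i => by simpa using Nat.mul_le_mul (hp i) (hr i)⟩

theorem PolyBounded.eval {σ : Type} {f : ℕ → σ → ℕ} (hf : ∀ j, PolyBounded fun i => f i j)
    (P : MvPolynomial σ ℕ) : PolyBounded fun i => MvPolynomial.eval (f i) P := by
  induction P using MvPolynomial.induction_on with
  | C a => exact ⟨Polynomial.C a, fun i => by simp⟩
  | add p r hp hr => simpa using hp.add hr
  | mul_X p j hp => simpa using hp.mul (hf j)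

theorem Negligible.of_le_add {f g : ℕ → ℝ} (hg : Negligible g)
    (h : ∀ i, (f i - (3 : ℝ)⁻¹ ^ i) / 4 ≤ g i) : Negligible f := by
  intro c
  have h3 : Filter.Tendsto (fun i : ℕ => (i : ℝ) ^ (c + 1) * (3 : ℝ)⁻¹ ^ i) Filter.atTop (nhds 0) :=
    tendsto_pow_const_mul_const_pow_of_lt_one (c + 1) (by norm_num) (by norm_num)
  filter_upwards [hg (c + 1), h3.eventually (ge_mem_nhds zero_lt_one),
    Filter.eventually_ge_atTop 5] with i h1 h2 h5
  have hi : (5 : ℝ) ≤ i := by exact_mod_cast h5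
  have hpos : (0 : ℝ) < (i : ℝ) ^ (c + 1) := by positivity
  have h4 : (3 : ℝ)⁻¹ ^ i ≤ 1 / (i : ℝ) ^ (c + 1) := by
    rw [le_div_iff₀ hpos, mul_comm]
    exact h2
  -- Four times the bound on `g` plus the exponential term gives the factor 5, which one extra power
  -- of `i ≥ 5` absorbs.
  have h6 : 5 * (1 / (i : ℝ) ^ (c + 1)) ≤ 1 / (i : ℝ) ^ c := by
    rw [mul_one_div, div_le_div_iff₀ hpos (by positivity), one_mul, pow_succ, mul_comm]
    exact mul_le_mul_of_nonneg_left hi (by positivity)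
  linarith [h i]

end
end MSISHash

theorem proposition3p5 :
    -- the reduction, with an overhead polynomial in `w`, `n`, `log q`, `m`, `l`
    (∃ P : MvPolynomial (Fin 5) ℕ,
      ∀ (q n m l γ η : ℕ) [NeZero q] [NeZero n],
        q.Prime → (∃ e : ℕ, n = 2 ^ e) → 0 < m → 0 < l → 0 < γ → 0 < η →
        16 ≤ q → 2 * γ * η * n * l < q / 32 →
        ∀ 𝒜 : MSISHash.CollapseAlg q n m l, 𝒜.Valid γ →
        ∀ w : ℕ, ∃ ℬ : MSISHash.MLWEAlg q n l m,
          (𝒜.advantage - (3 : ℝ)⁻¹ ^ w) / 4 ≤ ℬ.advantage η ∧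
          ℬ.time ≤ 𝒜.time + MvPolynomial.eval ![w, n, Nat.clog 2 q, m, l] P) ∧
    -- the asymptotic consequence
    (∀ (q n m l γ η : ℕ → ℕ) [∀ i, NeZero (q i)] [∀ i, NeZero (n i)],
      (∀ i, (q i).Prime ∧ (∃ e : ℕ, n i = 2 ^ e) ∧ 0 < m i ∧ 0 < l i ∧ 0 < γ i ∧ 0 < η i ∧
        16 ≤ q i ∧ 2 * γ i * η i * n i * l i < q i / 32) →
      MSISHash.PolyBounded n → MSISHash.PolyBounded (fun i => Nat.clog 2 (q i)) →
      MSISHash.PolyBounded m → MSISHash.PolyBounded l →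
      MSISHash.MLWEHard q n l m η → MSISHash.IsCollapsing q n m l γ) := by
  refine ⟨⟨MSISHash.overhead, ?_⟩, ?_⟩
  · intro q n m l γ η _ _ hq _ _ _ _ _ h16 hsmall 𝒜 h𝒜 w
    have : Fact q.Prime := ⟨hq⟩
    obtain ⟨ℬ, hadv, htime⟩ := 𝒜.exists_mlweAlg_advantage h𝒜 h16 hsmall w
    exact ⟨ℬ, hadv, htime.trans (by rw [MSISHash.eval_overhead])⟩
  · intro q n m l γ η _ _ h hn hc hm hl hard 𝒜 h𝒜 htime
    -- The accuracy parameter `w` is taken to be the security parameter: the loss `3^(-i)` is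
    -- negligible and the overhead stays polynomial.
    have key : ∀ i, ∃ ℬ : MSISHash.MLWEAlg (q i) (n i) (l i) (m i),
        ((𝒜 i).advantage - (3 : ℝ)⁻¹ ^ i) / 4 ≤ ℬ.advantage (η i) ∧
          ℬ.time ≤ (𝒜 i).time + MvPolynomial.eval ![i, n i, Nat.clog 2 (q i), m i, l i]
            MSISHash.overhead := by
      intro i
      obtain ⟨hq, -, -, -, -, -, h16, hsmall⟩ := h i
      have : Fact (q i).Prime := ⟨hq⟩
      obtain ⟨ℬ, hadv, ht⟩ := (𝒜 i).exists_mlweAlg_advantage (h𝒜 i) h16 hsmall i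
      exact ⟨ℬ, hadv, ht.trans (by rw [MSISHash.eval_overhead])⟩
    choose ℬ hadv ht using key
    refine MSISHash.Negligible.of_le_add (hard ℬ ?_) hadv
    refine (htime.add (MSISHash.PolyBounded.eval (fun j => ?_) MSISHash.overhead)).mono ht
    fin_cases j
    exacts [⟨Polynomial.X, fun i => by simp⟩, hn, hc, hm, hl]
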